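/- **Setting.** Energy amounts $\mathcal E_i>0$ arrive at a transmitter at epochs $0=\tau_0<\tau_1<\tau_2<\cdots$, $\tau_i\to\infty$. Write $\mathcal E(t)=\sum_{\tau_i\le t}\mathcal E_i$, $\mathcal E(t^-)=\sum_{\tau_i<t}\mathcal E_i$ and $\mathcal P(a,b)=\frac{\mathcal E(b^-)-\mathcal E(a^-)}{b-a}$. The receiver may be on for a total time of at most $\Gamma_0>0$. Power $p\ge 0$ gives the rate $g(p)$, where $g(0)=0$, $g$ is increasing and strictly concave on $[0,\infty)$, $g(p)\to\infty$, and $g(p)/p$ is convex and decreasing on $(0,\infty)$ with limit $0$ as $p\to\infty$. A policy $\{p,s,N\}$ consists of times $0\le s_1\le\cdots\le s_{N+1}$ and powers $p_i\ge 0$ used on $[s_i,s_{i+1}]$; $U(t)$ and $B(t)$ are the energy used and the number of bits sent up to time $t$. Given $B_0>0$, the single-receiver-arrival problem is to minimize the finish time $T=s_{N+1}$ subject to $B(T)=B_0$, $U(t)\le\mathcal E(t)$ for all $t\in[0,T]$, and $\sum_{i:p_i\ne0}(s_{i+1}-s_i)\le\Gamma_0$. A policy is energy-feasible if $0\le s_1$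 and $U(t)\le\mathcal E(t)$ for $0\le t\le s_{N+1}$. **Algorithm OFF.** In all phases, every epoch $\tau_k$ inside the transmission interval with $U(\tau_k)=\mathcal E(\tau_k^-)$ is recorded in $s$, even if the power does not change there. *INIT_POLICY.* Let $n$ be the least index with $\Gamma_0\,g(\mathcal E(\tau_n)/\Gamma_0)\ge B_0$, let $\widetilde T>0$ solve $\widetilde T g(\mathcal E(\tau_n)/\widetilde T)=B_0$, and put $p_c=\mathcal E(\tau_n)/\widetilde T$. Let $q$ be the least $k\in\{0,\dots,n\}$ for which using power $p_c$ from $\tau_k-\mathcal E(\tau_k^-)/p_c$ to $\tau_k+(\mathcal E(\tau_n)-\mathcal E(\tau_k^-))/p_c$ is energy-feasible. If, for $k=q$, this constant-power policy has used all energy harvested strictly before its finish time, it is the output. Otherwise its part after $\tau_q$ is replaced by the following transmitter-only procedure, which sends the same number of bits from $\tau_q$ on. With $m=q$ initially and $b$ the number of bits still to be sent, let $h>m$ be the first index with $(\tau_h-\tau_m)\,g(\mathcal P(\tau_m,\tau_h))\ge b$, let $T$ solve $T g(H/T)=b$ with $H=\mathcal E(\tau_h^-)-\mathcal E(\tau_m^-)$,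 and put $\hat p=H/T$. If $\hat p<\mathcal P(\tau_m,\tau_i)$ for all $m<i<h$, use power $\hat p$ on $[\tau_m,\tau_m+T]$ and stop. Otherwise let $i$ be the first minimizer of $\mathcal P(\tau_m,\tau_i)$ over $m<i<h$, use this minimal power on $[\tau_m,\tau_i]$, and repeat from $m:=i$ with the remaining bits. *PULL_BACK.* Start from the policy of INIT_POLICY with $\tau_l=s_2$, $\tau_r=s_N$, $T_{start}=s_1$, $T_{stop}=s_{N+1}$, $p_l=p_1$, $p_r=p_N$. While $T_{stop}-T_{start}<\Gamma_0$ and $T_{start}>0$, iterate as follows. 1. Put $F=\mathcal E(T_{stop}^-)-\mathcal E(\tau_r^-)$ and $b=g(p_r)(T_{stop}-\tau_r)+g(p_l)(\tau_l-T_{start})$. If there are arrivals strictly between $\tau_r$ and $T_{stop}$, let $\pi$ be the minimum of $\mathcal P(\tau_r,\tau_i)$ over these and $B_l=b-g(\pi)F/\pi$; otherwise $B_l=b$. 2. Look for $\tilde p\in(0,p_l)$ with $\frac{\mathcal E(\tau_l^-)}{\tilde p}g(\tilde p)=B_l$. 3. If $\tilde p$ exists and its use on $[\tau_l-\mathcal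 E(\tau_l^-)/\tilde p,\ \tau_l]$ is energy-feasible, put $p_l:=\tilde p$ and $T_{start}:=\tau_l-\mathcal E(\tau_l^-)/\tilde p$, and let $\tau_l$ become the first epoch after $T_{start}$ at which all energy harvested before has been used (in general $\tau_l$ does not change). If there were arrivals between $\tau_r$ and $T_{stop}$, put $p_r:=\pi$, $T_{stop}:=\tau_r+F/\pi$, and then move $\tau_r$ to the last minimizing epoch; otherwise put $T_{stop}:=\tau_r$, move $\tau_r$ back to the preceding recorded epoch (if there is one), and let $p_r$ be the power used between the two. 4. Otherwise, put $p_l:=\pi'=\max\mathcal P(\tau_i,\tau_l)$ over the epochs $\tau_i<\tau_l$ (not earlier than $\tau_l-\mathcal E(\tau_l^-)/\tilde p$, if $\tilde p$ exists) and $T_{start}:=\tau_l-\mathcal E(\tau_l^-)/\pi'$, let $p_r$ solve $\frac{F}{p_r}g(p_r)=b-g(\pi')\mathcal E(\tau_l^-)/\pi'$, put $T_{stop}:=\tau_r+F/p_r$, and then move $\tau_l$ to the first maximizing epoch. The powers between the old $\tau_l$ and $\tau_r$ are otherwise kept. *QUIT.* If $T_{stop}-T_{start}\le\Gamma_0$ at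 the end of PULL_BACK, output the last policy. Otherwise take the policy before the last iteration, keep it between its $\tau_l$ and $\tau_r$, and change the power before $\tau_l$ and the power after $\tau_r$ such that the energies spent there and the total number of bits are unchanged, the total duration is exactly $\Gamma_0$, and the start and finish times lie between those of the last two policies of PULL_BACK. **Theorem.** If the problem has a feasible policy, then the following hold. (a) The output of OFF is an optimal policy (feasible, with the least finish time among all feasible policies), and all its powers are positive. (b) The output $\{p,s,N\}$ of OFF satisfies: $\sum_i g(p_i)(s_{i+1}-s_i)=B_0$; $p_1\le\cdots\le p_N$; each $s_i$, $2\le i\le N$, is some $\tau_j$; $U(s_i)=\mathcal E(s_i^-)$ for $2\le i\le N+1$; $s_{N+1}-s_1=\Gamma_0$ if $s_1>0$, and $s_{N+1}\le\Gamma_0$ if $s_1=0$; and $s_j=\tau_q$ for some $j$. (c) The transmission time $T_{stop}-T_{start}$ strictly increases in every iteration of PULL_BACK. (d) PULL_BACK terminates after at most $2M$ iterations, where $M$ is the number of energy arrivals at the transmitter strictly before the finish time of the policy returned by INIT_POLICY. -/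

import Mathlib

open Filter

noncomputable section

namespace Harvest

/-! ## Algorithmic primitives -/

/-- "Solve for `x` such that `P x`": some solution of `P` (arbitrary if there is none). -/
def solve (P : ℝ → Prop) : ℝ := Classical.epsilon P

/-- Number of executions of the body in `while guard do body`, started in `x`: the first `k` such
that the guard fails after `k` executions (`0` if there is no such `k`). -/
def loopCount {σ : Type} (guard : σ → Prop) (body : σ → σ) (x : σ) : ℕ :=
  sInf {k | ¬ guard (body^[k] x)}

/-- Final value of `while guard do body`, started in `x`. -/
def whileLoop {σ : Type} (guard : σ → Prop) (body : σ → σ) (x : σ) : σ :=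
  body^[loopCount guard body x] x

/-! ## The model -/

/-- Properties of the rate function `g` (bits per unit time as a function of transmit power). -/
structure IsRate (g : ℝ → ℝ) : Prop where
  zero : g 0 = 0
  mono : StrictMonoOn g (Set.Ici 0)
  tendsto : Tendsto g atTop atTop
  concave : StrictConcaveOn ℝ (Set.Ici 0) g
  div_convex : ConvexOn ℝ (Set.Ioi 0) (fun p => g p / p)
  div_anti : StrictAntiOn (fun p => g p / p) (Set.Ioi 0)
  div_tendsto : Tendsto (fun p => g p / p) atTop (nhds 0)

/-- An instance: energy amounts `e i > 0` arriving at the transmitter at the epochs `τ i`, the rate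
function `g`, the number `B₀` of bits to be sent, and the total time `Γ₀` for which the receiver
can be on (all of it available from time `0`). -/
structure Problem where
  τ : ℕ → ℝ
  e : ℕ → ℝ
  g : ℝ → ℝ
  B₀ : ℝ
  Γ₀ : ℝ
  τ_zero : τ 0 = 0
  τ_strictMono : StrictMono τ
  τ_tendsto : Tendsto τ atTop atTop
  e_pos : ∀ i, 0 < e i
  rate : IsRate g
  B₀_pos : 0 < B₀
  Γ₀_pos : 0 < Γ₀

/-- A transmission policy `{p, s, N}`: the power is `p_i` between the times `s_i` and `s_{i+1}`. -/
structure Policy where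
  p : List ℝ
  s : List ℝ

namespace Policy

/-- The number `N` of segments. -/
def N (X : Policy) : ℕ := X.p.length

/-- The power `p_i`, `1 ≤ i ≤ N`. -/
def pow (X : Policy) (i : ℕ) : ℝ := X.p.getD (i - 1) 0

/-- The time `s_i`, `1 ≤ i ≤ N + 1`. -/
def time (X : Policy) (i : ℕ) : ℝ := X.s.getD (i - 1) 0

/-- The start time `s_1`. -/
def start (X : Policy) : ℝ := X.time 1

/-- The finish time `s_{N+1}`. -/
def finish (X : Policy) : ℝ := X.time (X.N + 1)

/-- The data describe a policy: `0 ≤ s_1 ≤ s_2 ≤ ⋯ ≤ s_{N+1}` and all powers are nonnegative. -/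
def WellFormed (X : Policy) : Prop :=
  X.s.length = X.N + 1 ∧ X.s.Pairwise (· ≤ ·) ∧ 0 ≤ X.start ∧ ∀ x ∈ X.p, 0 ≤ x

/-- `U(t)`, the energy used up to time `t`; segment `i` contributes the part of
`[s_i, s_{i+1}]` that lies before `t`. -/
def used (X : Policy) (t : ℝ) : ℝ :=
  ∑ i ∈ Finset.Icc 1 X.N, X.pow i * (min (X.time (i + 1)) t - min (X.time i) t)

/-- `B(t)`, the number of bits sent up to time `t`. -/
def bits (g : ℝ → ℝ) (X : Policy) (t : ℝ) : ℝ :=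
  ∑ i ∈ Finset.Icc 1 X.N, g (X.pow i) * (min (X.time (i + 1)) t - min (X.time i) t)

/-- The total number of bits sent. -/
def totalBits (g : ℝ → ℝ) (X : Policy) : ℝ :=
  ∑ i ∈ Finset.Icc 1 X.N, g (X.pow i) * (X.time (i + 1) - X.time i)

/-- The total time for which the receiver is on. -/
def onTime (X : Policy) : ℝ :=
  ∑ i ∈ (Finset.Icc 1 X.N).filter (fun i => X.pow i ≠ 0), (X.time (i + 1) - X.time i)

end Policy

/-- A state of PULL_BACK: `τ_l`, `τ_r`, `T_start = tBegin`, `T_stop = tEnd`, `p_l`, `p_r`, the powers `p` used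
between `τ_l` and `τ_r`, and the list `s` of the epochs from `τ_l` to `τ_r`. -/
structure State where
  tl : ℝ
  tr : ℝ
  tBegin : ℝ
  tEnd : ℝ
  pl : ℝ
  pr : ℝ
  p : List ℝ
  s : List ℝ

/-- The policy described by a state. -/
def State.policy (S : State) : Policy :=
  ⟨S.pl :: S.p ++ [S.pr], S.tBegin :: S.s ++ [S.tEnd]⟩

/-- A state of the transmitter-only algorithm: current epoch `τ_m`, bits still to be sent, and the
powers and times produced so far. -/
structure TxState where
  m : ℕ
  b : ℝ
  p : List ℝ
  s : List ℝ

namespace Problem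

variable (Q : Problem)

theorem finite_upto (t : ℝ) : {i | Q.τ i ≤ t}.Finite := by
  obtain ⟨n, hn⟩ := (Q.τ_tendsto.eventually_gt_atTop t).exists
  refine (Set.finite_Iio n).subset fun i hi => ?_
  by_contra h
  exact absurd (hn.trans_le (Q.τ_strictMono.monotone (not_lt.mp h))) (not_lt.mpr hi)

/-- The indices of the arrivals up to time `t`, inclusive. -/
def upto (t : ℝ) : Finset ℕ := (Q.finite_upto t).toFinset

open Classical in
/-- The indices of the arrivals strictly before time `t`. -/
def before (t : ℝ) : Finset ℕ := (Q.upto t).filter (fun i => Q.τ i < t)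

/-- `𝓔(t)`, the energy harvested up to time `t`. -/
def energy (t : ℝ) : ℝ := ∑ i ∈ Q.upto t, Q.e i

/-- `𝓔(t⁻)`, the energy harvested strictly before time `t`. -/
def energyLeft (t : ℝ) : ℝ := ∑ i ∈ Q.before t, Q.e i

/-- `𝓟(a, b)`, the constant power that spends exactly the energy harvested in `[a, b)`. -/
def chord (a b : ℝ) : ℝ := (Q.energyLeft b - Q.energyLeft a) / (b - a)

/-- The policy respects the energy neutrality constraint of the transmitter. -/
def EnergyFeasible (X : Policy) : Prop :=
  X.WellFormed ∧ ∀ t ∈ Set.Icc 0 X.finish, X.used t ≤ Q.energy t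

/-- The policy satisfies all constraints of the single-receiver-arrival problem. -/
def Feasible (X : Policy) : Prop :=
  Q.EnergyFeasible X ∧ X.bits Q.g X.finish = Q.B₀ ∧ X.onTime ≤ Q.Γ₀

/-- The policy is feasible and has the least finish time among all feasible policies (including
those that switch the receiver off and on during the transmission). -/
def IsOptimal (X : Policy) : Prop :=
  Q.Feasible X ∧ ∀ Y, Q.Feasible Y → X.finish ≤ Y.finish

/-! ## The transmitter-only algorithm

It sends `b` bits from `τ_q` on, in minimum time and without a limit on the time the receiver is
on, using the energy that arrives at `τ_q` and later. -/

/-- The first epoch `τ_i` after `τ_m` such that the energy harvested in `[τ_m, τ_i)`, spent at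
constant power, suffices to send `b` bits by the time `τ_i`. -/
def txHorizon (m : ℕ) (b : ℝ) : ℕ :=
  sInf {i | m < i ∧ b ≤ (Q.τ i - Q.τ m) * Q.g (Q.chord (Q.τ m) (Q.τ i))}

/-- The energy harvested from `τ_m` until just before the horizon. -/
def txEnergy (m : ℕ) (b : ℝ) : ℝ :=
  Q.energyLeft (Q.τ (Q.txHorizon m b)) - Q.energyLeft (Q.τ m)

/-- The time in which that energy, spent at constant power, sends exactly `b` bits. -/
def txTime (m : ℕ) (b : ℝ) : ℝ :=
  solve fun T => 0 < T ∧ T * Q.g (Q.txEnergy m b / T) = b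

/-- The corresponding constant power. -/
def txPower (m : ℕ) (b : ℝ) : ℝ := Q.txEnergy m b / Q.txTime m b

/-- The constant power has to be reduced: it is not smaller than all the average powers available
up to the epochs before the horizon. -/
def txGuard (S : TxState) : Prop :=
  ¬ ∀ i, S.m < i → i < Q.txHorizon S.m S.b →
    Q.txPower S.m S.b < Q.chord (Q.τ S.m) (Q.τ i)

/-- The first epoch before the horizon with the smallest average power available up to it. -/
def txNext (m : ℕ) (b : ℝ) : ℕ :=
  sInf {i | m < i ∧ i < Q.txHorizon m b ∧
    ∀ i', m < i' → i' < Q.txHorizon m b → Q.chord (Q.τ m) (Q.τ i) ≤ Q.chord (Q.τ m) (Q.τ i')}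

/-- Transmit at that smallest average power up to that epoch. -/
def txStep (S : TxState) : TxState :=
  let i := Q.txNext S.m S.b
  let x := Q.chord (Q.τ S.m) (Q.τ i)
  { m := i
    b := S.b - Q.g x * (Q.τ i - Q.τ S.m)
    p := S.p ++ [x]
    s := S.s ++ [Q.τ i] }

/-- The transmitter-only algorithm for `b` bits from `τ_q` on. -/
def txAlgorithm (q : ℕ) (b : ℝ) : Policy :=
  let S := whileLoop Q.txGuard Q.txStep ⟨q, b, [], [Q.τ q]⟩
  ⟨S.p ++ [Q.txPower S.m S.b], S.s ++ [Q.τ S.m + Q.txTime S.m S.b]⟩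

/-! ## INIT_POLICY -/

/-- `n`: the first arrival with which `B₀` or more bits can be sent in receiver time `Γ₀`. -/
def n : ℕ := sInf {k | Q.B₀ ≤ Q.Γ₀ * Q.g (Q.energy (Q.τ k) / Q.Γ₀)}

/-- `T̃`: the time in which the energy `𝓔(τ_n)` sends exactly `B₀` bits at constant power. -/
def initTime : ℝ := solve fun T => 0 < T ∧ T * Q.g (Q.energy (Q.τ Q.n) / T) = Q.B₀

/-- The constant power `p_c`. -/
def pc : ℝ := Q.energy (Q.τ Q.n) / Q.initTime

/-- Power `p_c`, timed such that all the energy harvested before `τ_k` is used up at `τ_k`. -/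
def constPolicy (k : ℕ) : Policy :=
  ⟨[Q.pc, Q.pc],
   [Q.τ k - Q.energyLeft (Q.τ k) / Q.pc, Q.τ k,
    Q.τ k + (Q.energy (Q.τ Q.n) - Q.energyLeft (Q.τ k)) / Q.pc]⟩

/-- `q`: the first `k ≤ n` such that the policy above is feasible. -/
def q : ℕ := sInf {k | k ≤ Q.n ∧ Q.EnergyFeasible (Q.constPolicy k)}

open Classical in
/-- The epochs from `τ_q` on, before the end of the constant power policy, at which this policy has
used up all the energy harvested before. -/
def initEpochs : List ℝ :=
  (((Q.before (Q.constPolicy Q.q).finish).filter fun i =>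
    Q.q ≤ i ∧ (Q.constPolicy Q.q).used (Q.τ i) = Q.energyLeft (Q.τ i)).sort (· ≤ ·)).map Q.τ

open Classical in
/-- INIT_POLICY. The epochs at which all the harvested energy has been used up are recorded in `s`
even if the power does not change there. -/
def initPolicy : Policy :=
  let X := Q.constPolicy Q.q
  if X.used X.finish < Q.energyLeft X.finish then
    let Y := Q.txAlgorithm Q.q (Q.g Q.pc * (X.finish - Q.τ Q.q))
    ⟨Q.pc :: Y.p, X.start :: Y.s⟩
  else
    ⟨List.replicate (Q.initEpochs.length + 1) Q.pc, X.start :: Q.initEpochs ++ [X.finish]⟩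

/-! ## PULL_BACK -/

/-- The state from which PULL_BACK starts. -/
def pullBackInit : State :=
  let X := Q.initPolicy
  { tl := X.time 2
    tr := X.time X.N
    tBegin := X.start
    tEnd := X.finish
    pl := X.pow 1
    pr := X.pow X.N
    p := X.p.tail.dropLast
    s := X.s.tail.dropLast }

/-- The condition under which PULL_BACK goes on. -/
def pullBackGuard (S : State) : Prop := S.tEnd - S.tBegin < Q.Γ₀ ∧ 0 < S.tBegin

open Classical in
/-- The arrivals strictly between `τ_r` and `T_stop`. -/
def rightArrivals (S : State) : Finset ℕ := (Q.before S.tEnd).filter fun i => S.tr < Q.τ i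

/-- The smallest power that spends, from `τ_r` to one of these arrivals, all the energy available
up to it. -/
def rightPower (S : State) : ℝ :=
  sInf ((fun i => Q.chord S.tr (Q.τ i)) '' (Q.rightArrivals S : Set ℕ))

open Classical in
/-- The epochs at which this minimum is attained, in increasing order. -/
def rightEpochs (S : State) : List ℝ :=
  (((Q.rightArrivals S).filter fun i => Q.chord S.tr (Q.τ i) = Q.rightPower S).sort (· ≤ ·)).map Q.τ

/-- The energy spent after `τ_r`. -/
def rightEnergy (S : State) : ℝ := Q.energyLeft S.tEnd - Q.energyLeft S.tr

/-- The bits sent before `τ_l` and after `τ_r`. -/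
def outerBits (S : State) : ℝ :=
  Q.g S.pr * (S.tEnd - S.tr) + Q.g S.pl * (S.tl - S.tBegin)

open Classical in
/-- The bits that are left for the part before `τ_l` once `p_r` has been raised as far as possible
(to infinity, if there is no arrival between `τ_r` and `T_stop`). -/
def leftBits (S : State) : ℝ :=
  if Q.rightArrivals S = ∅ then Q.outerBits S
  else Q.outerBits S - Q.g (Q.rightPower S) * (Q.rightEnergy S / Q.rightPower S)

/-- `x < p_l` is a power that sends these bits with the energy harvested before `τ_l`. -/
def IsLeftPower (S : State) (x : ℝ) : Prop :=
  0 < x ∧ x < S.pl ∧ Q.energyLeft S.tl / x * Q.g x = Q.leftBits S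

/-- The power `p̃`. -/
def leftPower (S : State) : ℝ := solve (Q.IsLeftPower S)

/-- The power `p̃` exists and its use until `τ_l` is feasible. -/
def Accepts (S : State) : Prop :=
  (∃ x, Q.IsLeftPower S x) ∧
    Q.EnergyFeasible
      ⟨[Q.leftPower S], [S.tl - Q.energyLeft S.tl / Q.leftPower S, S.tl]⟩

/-- The start time that belongs to `p̃`. -/
def leftStart (S : State) : ℝ := S.tl - Q.energyLeft S.tl / Q.leftPower S

open Classical in
/-- The epochs between that start time and `τ_l` at which transmission with `p̃` has used up all the
energy harvested before (in general there are none). They are recorded in `s`, so that `τ_l`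
remains the first epoch with this property. -/
def leftTouches (S : State) : List ℝ :=
  (((Q.before S.tl).filter fun i => Q.leftStart S < Q.τ i ∧
    Q.leftPower S * (Q.τ i - Q.leftStart S) = Q.energyLeft (Q.τ i)).sort (· ≤ ·)).map Q.τ

open Classical in
/-- An iteration of PULL_BACK in which `p̃` is feasible. If there is an arrival between `τ_r` and
`T_stop`, then `τ_r` moves right to the last epoch that the raised power `p_r` touches; otherwise
the part after `τ_r` is dropped, and `τ_r` moves left to the preceding epoch of `s`. -/
def acceptStep (S : State) : State :=
  let K := Q.leftTouches S
  let x := Q.leftPower S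
  if Q.rightArrivals S = ∅ then
    { tl := K.headD S.tl
      tr := if S.p = [] then S.tr else S.s.dropLast.getLastD S.tr
      tBegin := Q.leftStart S
      tEnd := S.tr
      pl := x
      pr := S.p.getLastD S.pr
      p := List.replicate K.length x ++ S.p.dropLast
      s := K ++ (if S.p = [] then S.s else S.s.dropLast) }
  else
    let L := Q.rightEpochs S
    { tl := K.headD S.tl
      tr := L.getLastD S.tr
      tBegin := Q.leftStart S
      tEnd := S.tr + Q.rightEnergy S / Q.rightPower S
      pl := x
      pr := Q.rightPower S
      p := List.replicate K.length x ++ S.p ++ List.replicate L.length (Q.rightPower S)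
      s := K ++ S.s ++ L }

open Classical in
/-- The arrivals before `τ_l` (and after the start time that belongs to `p̃`, if `p̃` exists). -/
def leftArrivals (S : State) : Finset ℕ :=
  (Q.before S.tl).filter fun i => (∃ x, Q.IsLeftPower S x) → max (Q.leftStart S) (Q.τ 0) ≤ Q.τ i

/-- The smallest feasible power before `τ_l`. -/
def minLeftPower (S : State) : ℝ :=
  sSup ((fun i => Q.chord (Q.τ i) S.tl) '' (Q.leftArrivals S : Set ℕ))

open Classical in
/-- The epochs at which this maximum is attained, in increasing order. -/
def leftEpochs (S : State) : List ℝ :=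
  (((Q.leftArrivals S).filter fun i =>
    Q.chord (Q.τ i) S.tl = Q.minLeftPower S).sort (· ≤ ·)).map Q.τ

/-- An iteration of PULL_BACK in which `p̃` does not exist or is infeasible: `p_l` becomes the
smallest feasible power, `τ_l` moves left to the first epoch that it touches, and `p_r` is adjusted
so that the number of bits is unchanged. -/
def rejectStep (S : State) : State :=
  let K := Q.leftEpochs S
  let x := Q.minLeftPower S
  let Br := Q.outerBits S - Q.g x * (Q.energyLeft S.tl / x)
  let y := solve fun y => 0 < y ∧ Q.rightEnergy S / y * Q.g y = Br
  { tl := K.headD S.tl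
    tr := S.tr
    tBegin := S.tl - Q.energyLeft S.tl / x
    tEnd := S.tr + Q.rightEnergy S / y
    pl := x
    pr := y
    p := List.replicate K.length x ++ S.p
    s := K ++ S.s }

open Classical in
/-- One iteration of PULL_BACK. -/
def pullBackStep (S : State) : State :=
  if Q.Accepts S then Q.acceptStep S else Q.rejectStep S

/-- The state of PULL_BACK after `k` iterations. -/
def pullBackState (k : ℕ) : State := Q.pullBackStep^[k] Q.pullBackInit

/-- The number of iterations of PULL_BACK: its running time. -/
def pullBackCount : ℕ := loopCount Q.pullBackGuard Q.pullBackStep Q.pullBackInit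

/-! ## QUIT -/

/-- `x` is the length of the first segment of the output of QUIT, where `S'` and `S` are the
penultimate and the last state of PULL_BACK. -/
def IsQuitLength (S' S : State) (x : ℝ) : Prop :=
  let T := Q.Γ₀ - (S'.tr - S'.tl)
  0 < x ∧ x < T ∧
  S'.tl - x ∈ Set.Icc S.tBegin S'.tBegin ∧
  S'.tr + (T - x) ∈ Set.Icc S.tEnd S'.tEnd ∧
  x * Q.g (Q.energyLeft S'.tl / x) + (T - x) * Q.g (Q.rightEnergy S' / (T - x))
    = Q.B₀ - (Policy.mk S'.p S'.s).totalBits Q.g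

open Classical in
/-- QUIT, from the penultimate state `S'` and the last state `S` of PULL_BACK. -/
def quit (S' S : State) : Policy :=
  if Q.Γ₀ < S.tEnd - S.tBegin then
    let T := Q.Γ₀ - (S'.tr - S'.tl)
    let x := solve (Q.IsQuitLength S' S)
    ⟨Q.energyLeft S'.tl / x :: S'.p ++ [Q.rightEnergy S' / (T - x)],
     (S'.tl - x) :: S'.s ++ [S'.tr + (T - x)]⟩
  else S.policy

/-! ## OFF -/

/-- The algorithm OFF: INIT_POLICY, then PULL_BACK, then QUIT. (If PULL_BACK makes no iteration,
then QUIT does not use the penultimate state.) -/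
def OFF : Policy :=
  Q.quit (Q.pullBackState (Q.pullBackCount - 1)) (Q.pullBackState Q.pullBackCount)

/-- The sufficient conditions for optimality. -/
structure SufficientConditions (X : Policy) : Prop where
  bits_eq : X.totalBits Q.g = Q.B₀
  powers_mono : ∀ i j, 1 ≤ i → i ≤ j → j ≤ X.N → X.pow i ≤ X.pow j
  epochs : ∀ i, 2 ≤ i → i ≤ X.N → ∃ j, X.time i = Q.τ j
  tight : ∀ i, 2 ≤ i → i ≤ X.N + 1 → X.used (X.time i) = Q.energyLeft (X.time i)
  duration_of_pos : 0 < X.start → X.finish - X.start = Q.Γ₀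
  duration_of_zero : X.start = 0 → X.finish ≤ Q.Γ₀
  contains_q : ∃ j, 1 ≤ j ∧ j ≤ X.N + 1 ∧ X.time j = Q.τ Q.q

end Problem

end Harvest

end

/-!
A policy that is returned has increasing powers `p₁ ≤ ⋯ ≤ p_N`, and it has used up the harvested
energy at each epoch where the power changes and at its finish time. Such states of the algorithm
are called valid (`Valid`); the proof shows that valid states with the right duration are optimal,
that INIT_POLICY produces a valid state, and that PULL_BACK and QUIT preserve validity.

*Optimality* (`Valid.le_finish`) is a Lagrange certificate. The supporting line of the concave rate
`g` at `P` bounds the bits of a rival by `intercept g P` per unit of receiver time plus `marginal g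
P` per unit of energy. Along the policy, the supporting line at the current power is used. Where the
power increases, at a touching epoch, the price of energy falls and the price of receiver time
rises. Both changes favour the policy: the rival has not used more energy before, and if it finishes
earlier, it spends less receiver time than the policy from then on. Hence it sends too few bits,
strictly so if the policy starts at time `0` or if its power is not constant. If the power is
constant, `τ_q` is a touching epoch before the finish time, and the supporting line at a slightly
higher power after `τ_q` makes the inequality strict.

*INIT_POLICY.* The line of slope `p_c` through the corner of the energy curve at `τ_q` supports the
corners up to `τ_n` (`q_spec`), so that the constant power policy is feasible. If it leaves energy
unused, the transmitter-only algorithm takes over from `τ_q` on. It keeps an invariant (`TxInv`):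
the remaining bits can be sent with powers not lower than the last power, hence not lower than
`p_c`. Therefore the new policy does not last longer than the constant power policy.

*PULL_BACK.* An iteration starts earlier with a lower power and finishes earlier with a higher power
(or drops the part after `τ_r`), at equal energies and an equal number of bits; by concavity this
takes more time (`IsRate.time_lt_of_spread`). The quantity `2 |{arrivals before T_stop}| - |s|`
falls in each iteration except possibly the last one (`Progress`), because an iteration records a
new touching epoch or drops an arrival. The epoch `τ_q` is not lost: if the part after `τ_r = τ_q`
is dropped, the energy harvested before `τ_q` has to send `B₀` bits, which by the minimality of `n`
takes longer than `Γ₀` (`Valid.duration_of_drop`), so that QUIT returns to the state before.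

*QUIT.* The duration varies continuously along the policies that send the same bits with the same
energies before `τ_l` and after `τ_r`, so that the duration `Γ₀` is attained between the last two
policies (`IsRate.exists_split`).
-/

namespace Harvest

/-! ### Tangents and secants of the rate function -/

/-- The slope of a supporting line of `g` at `p`; `g` may have kinks, and the right derivative is
one choice of a supergradient. -/
noncomputable def marginal (g : ℝ → ℝ) (p : ℝ) : ℝ := derivWithin g (Set.Ioi p) p

/-- The value at `0` of the supporting line of `g` at `p`. -/
noncomputable def intercept (g : ℝ → ℝ) (p : ℝ) : ℝ := g p - marginal g p * p

/-- The number of bits sent when the energy `E` is spent at constant power during the time `T`. -/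
noncomputable def sent (g : ℝ → ℝ) (E T : ℝ) : ℝ := T * g (E / T)

theorem eq_tangent (g : ℝ → ℝ) (p : ℝ) : g p = intercept g p + marginal g p * p := by
  unfold intercept; ring

theorem sent_eq (g : ℝ → ℝ) {E T : ℝ} (hE : E ≠ 0) :
    sent g E T = E * (g (E / T) / (E / T)) := by
  rcases eq_or_ne T 0 with rfl | hT
  · simp [sent]
  · unfold sent
    field_simp

namespace IsRate

variable {g : ℝ → ℝ} (h : IsRate g)
include h

theorem pos {p : ℝ} (hp : 0 < p) : 0 < g p := by
  have := h.mono (Set.mem_Ici.2 le_rfl) (Set.mem_Ici.2 hp.le) hp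
  rwa [h.zero] at this

theorem lt_of_lt {p x : ℝ} (hp : 0 ≤ p) (hx : p < x) : g p < g x :=
  h.mono (Set.mem_Ici.2 hp) (Set.mem_Ici.2 (hp.trans hx.le)) hx

theorem continuousOn_Ioi : ContinuousOn g (Set.Ioi 0) :=
  ConcaveOn.continuousOn isOpen_Ioi
    (h.concave.concaveOn.subset Set.Ioi_subset_Ici_self (convex_Ioi 0))

theorem lt_tangent {p x : ℝ} (hp : 0 < p) (hx : 0 ≤ x) (hne : x ≠ p) :
    g x < intercept g p + marginal g p * x := by
  have hpm : p ∈ interior (Set.Ici (0 : ℝ)) := by simpa using hp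
  have hl : derivWithin g (Set.Ioi p) p ≤ derivWithin g (Set.Iio p) p := by
    have := h.concave.concaveOn.neg.leftDeriv_le_rightDeriv_of_mem_interior hpm
    simpa [derivWithin.neg] using this
  unfold intercept marginal
  rcases lt_or_gt_of_ne hne with hlt | hgt
  · have h1 := h.concave.leftDeriv_lt_slope (Set.mem_Ici.2 hx) (Set.mem_Ici.2 hp.le) hlt
      (by
        have := (h.concave.concaveOn.neg.differentiableWithinAt_Iio_of_mem_interior hpm).neg
        simpa using this)
    rw [slope_def_field] at h1
    have h2 := lt_of_le_of_lt hl h1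
    rw [lt_div_iff₀ (by linarith)] at h2
    nlinarith
  · have h1 := h.concave.slope_lt_rightDeriv (Set.mem_Ici.2 hp.le) (Set.mem_Ici.2 hx) hgt
      (by
        have := (h.concave.concaveOn.neg.differentiableWithinAt_Ioi_of_mem_interior hpm).neg
        simpa using this)
    rw [slope_def_field, div_lt_iff₀ (by linarith)] at h1
    nlinarith

theorem le_tangent {p x : ℝ} (hp : 0 < p) (hx : 0 ≤ x) :
    g x ≤ intercept g p + marginal g p * x := by
  rcases eq_or_ne x p with rfl | hne
  · exact (eq_tangent g x).le
  · exact (h.lt_tangent hp hx hne).le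

theorem marginal_lt {p x : ℝ} (hp : 0 < p) (hx : p < x) : marginal g x < marginal g p := by
  have h1 := h.lt_tangent hp (hp.le.trans hx.le) hx.ne'
  have h2 := h.lt_tangent (hp.trans hx) hp.le hx.ne
  have h3 := eq_tangent g p
  have h4 := eq_tangent g x
  by_contra! hc
  nlinarith

theorem marginal_le {p x : ℝ} (hp : 0 < p) (hx : p ≤ x) : marginal g x ≤ marginal g p := by
  rcases hx.eq_or_lt with rfl | hx
  · exact le_rfl
  · exact (h.marginal_lt hp hx).le

theorem intercept_lt {p x : ℝ} (hp : 0 < p) (hx : p < x) : intercept g p < intercept g x := by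
  have h2 := h.lt_tangent (hp.trans hx) hp.le hx.ne
  have h3 := eq_tangent g p
  have := h.marginal_lt hp hx
  nlinarith

theorem intercept_le {p x : ℝ} (hp : 0 < p) (hx : p ≤ x) : intercept g p ≤ intercept g x := by
  rcases hx.eq_or_lt with rfl | hx
  · exact le_rfl
  · exact (h.intercept_lt hp hx).le

theorem intercept_pos {p : ℝ} (hp : 0 < p) : 0 < intercept g p := by
  have := h.lt_tangent hp le_rfl hp.ne
  simpa [h.zero] using this

theorem marginal_pos {p : ℝ} (hp : 0 < p) : 0 < marginal g p := by
  have h1 := h.lt_tangent hp (by linarith : (0 : ℝ) ≤ p + 1) (by linarith)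
  have h2 := h.lt_of_lt hp.le (by linarith : p < p + 1)
  have h3 := eq_tangent g p
  linarith

theorem secant_lt {x y z : ℝ} (hx : 0 ≤ x) (hxy : x < y) (hyz : y < z) :
    g x * (z - y) + g z * (y - x) < g y * (z - x) := by
  have := h.concave.slope_anti_adjacent (Set.mem_Ici.2 hx)
    (Set.mem_Ici.2 (by linarith : (0 : ℝ) ≤ z)) hxy hyz
  rw [div_lt_div_iff₀ (by linarith) (by linarith)] at this
  nlinarith

/-! ### Bits as a function of energy and time -/

theorem sent_pos {E T : ℝ} (hE : 0 < E) (hT : 0 < T) : 0 < sent g E T :=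
  mul_pos hT (h.pos (div_pos hE hT))

theorem sent_lt_of_time_lt {E T T' : ℝ} (hE : 0 < E) (hT : 0 < T) (hTT : T < T') :
    sent g E T < sent g E T' := by
  rw [sent_eq g hE.ne', sent_eq g hE.ne']
  have h1 : E / T' < E / T := div_lt_div_of_pos_left hE hT hTT
  exact mul_lt_mul_of_pos_left
    (h.div_anti (Set.mem_Ioi.2 (div_pos hE (hT.trans hTT))) (Set.mem_Ioi.2 (div_pos hE hT)) h1) hE

theorem sent_le_of_time_le {E T T' : ℝ} (hE : 0 < E) (hT : 0 < T) (hTT : T ≤ T') :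
    sent g E T ≤ sent g E T' := by
  rcases hTT.eq_or_lt with rfl | hTT
  · exact le_rfl
  · exact (h.sent_lt_of_time_lt hE hT hTT).le

theorem time_lt_of_sent_lt {E T T' : ℝ} (hE : 0 < E) (hT' : 0 < T')
    (hs : sent g E T < sent g E T') : T < T' := by
  by_contra! hc
  exact absurd (h.sent_le_of_time_le hE hT' hc) (not_le.2 hs)

theorem time_le_of_sent_le {E T T' : ℝ} (hE : 0 < E) (hT' : 0 < T')
    (hs : sent g E T ≤ sent g E T') : T ≤ T' := by
  by_contra! hc
  exact absurd (h.sent_lt_of_time_lt hE hT' hc) (not_lt.2 hs)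

theorem sent_lt_of_energy_lt {E E' T : ℝ} (hE : 0 ≤ E) (hT : 0 < T) (hEE : E < E') :
    sent g E T < sent g E' T :=
  mul_lt_mul_of_pos_left (h.lt_of_lt (div_nonneg hE hT.le) (div_lt_div_of_pos_right hEE hT)) hT

theorem sent_le_of_energy_le {E E' T : ℝ} (hE : 0 ≤ E) (hT : 0 < T) (hEE : E ≤ E') :
    sent g E T ≤ sent g E' T := by
  rcases hEE.eq_or_lt with rfl | hEE
  · exact le_rfl
  · exact (h.sent_lt_of_energy_lt hE hT hEE).le

theorem sent_continuousOn {E : ℝ} (hE : 0 < E) :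
    ContinuousOn (fun T => sent g E T) (Set.Ioi 0) := by
  unfold sent
  refine continuousOn_id.mul (h.continuousOn_Ioi.comp ?_ ?_)
  · exact continuousOn_const.div continuousOn_id fun x hx => (Set.mem_Ioi.1 hx).ne'
  · intro x hx
    exact Set.mem_Ioi.2 (div_pos hE hx)

theorem exists_sent_lt {E ε : ℝ} (hE : 0 < E) (hε : 0 < ε) :
    ∃ T, 0 < T ∧ ∀ T', 0 < T' → T' ≤ T → sent g E T' < ε := by
  have h1 := (h.div_tendsto.eventually_lt_const (div_pos hε hE)).and (eventually_gt_atTop 0)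
  obtain ⟨x, hx1, hx2⟩ := h1.exists
  refine ⟨E / x, div_pos hE hx2, fun T' hT' hle => ?_⟩
  refine (h.sent_le_of_time_le hE hT' hle).trans_lt ?_
  rw [sent_eq g hE.ne', div_div_cancel₀ hE.ne']
  rw [lt_div_iff₀ hE] at hx1
  linarith

/-- Intermediate values: every smaller number of bits can be sent with the same energy in less
time. -/
theorem exists_time {E b T : ℝ} (hE : 0 < E) (hT : 0 < T) (hb : 0 < b) (hle : b ≤ sent g E T) :
    ∃ T', 0 < T' ∧ T' ≤ T ∧ sent g E T' = b := by
  obtain ⟨t, ht, hlt⟩ := h.exists_sent_lt hE hb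
  have htT : min t T ≤ T := min_le_right _ _
  have ht0 : 0 < min t T := lt_min ht hT
  obtain ⟨T', hT', he⟩ := intermediate_value_Icc htT
    ((h.sent_continuousOn hE).mono fun x hx => Set.mem_Ioi.2 (ht0.trans_le hx.1))
    (⟨(hlt _ ht0 (min_le_left _ _)).le, hle⟩ : b ∈ Set.Icc (sent g E (min t T)) (sent g E T))
  exact ⟨T', ht0.trans_le hT'.1, hT'.2, he⟩

/-- Spreading two constant powers `E / a ≤ F / b` further apart, at equal energies and an equal
number of bits, takes more time. The second part may disappear (`b' = 0`). -/
theorem time_lt_of_spread {E F a b a' b' : ℝ} (hE : 0 < E) (hF : 0 < F) (ha : 0 < a) (hb : 0 < b)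
    (hle : E / a ≤ F / b) (ha' : a < a') (hb0 : 0 ≤ b') (hb' : b' < b)
    (hs : sent g E a' + sent g F b' = sent g E a + sent g F b) : a + b < a' + b' := by
  have hx : E / a' < E / a := div_lt_div_of_pos_left hE ha ha'
  have hx0 : 0 < E / a' := div_pos hE (ha.trans ha')
  unfold sent at hs
  rcases hb0.eq_or_lt with rfl | hb0
  · have h1 := h.lt_of_lt hx0.le hx
    have h2 := h.lt_of_lt hx0.le (hx.trans_le hle)
    have h3 := h.pos hx0
    nlinarith
  · have hz : F / b < F / b' := div_lt_div_of_pos_left hF hb0 hb'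
    set x := E / a' with hxd
    set u := E / a with hud
    set v := F / b with hvd
    set z := F / b' with hzd
    have ha0 : 0 < a' := ha.trans ha'
    have e1 : E = a' * x := by rw [hxd]; field_simp
    have e2 : E = a * u := by rw [hud]; field_simp
    have e3 : F = b * v := by rw [hvd]; field_simp
    have e4 : F = b' * z := by rw [hzd]; field_simp
    have h1 := h.secant_lt hx0.le hx (hle.trans_lt hz)
    have h2 := h.secant_lt hx0.le (hx.trans_le hle) hz
    have h3 := h.secant_lt le_rfl hx0 (hx.trans_le hle |>.trans hz)
    rw [h.zero] at h3
    have hu : 0 < u := div_pos hE ha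
    -- multiply the secant inequalities by the durations and compare
    have k1 := mul_lt_mul_of_pos_left h1 ha
    have k2 := mul_lt_mul_of_pos_left h2 hb
    have key : (g x * z - g z * x) * (a + b) < (g x * z - g z * x) * (a' + b') := by
      have : a * g u * (z - x) + b * g v * (z - x) = (a' * g x + b' * g z) * (z - x) := by
        rw [hs]; ring
      have q1 : a * u = a' * x := e2.symm.trans e1
      have q2 : b * v = b' * z := e3.symm.trans e4
      have i1 : a * (g x * (z - u) + g z * (u - x)) + b * (g x * (z - v) + g z * (v - x))
          = (g x * z - g z * x) * (a + b) + (g z - g x) * (a' * x + b' * z) := by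
        rw [← q1, ← q2]; ring
      nlinarith
    have hpos : 0 < g x * z - g z * x := by nlinarith
    exact lt_of_mul_lt_mul_left key hpos.le

end IsRate

/-! ### Harvested energy -/

namespace Problem

variable (Q : Problem)

theorem mem_before {t : ℝ} {i : ℕ} : i ∈ Q.before t ↔ Q.τ i < t := by
  simp only [before, upto, Finset.mem_filter, Set.Finite.mem_toFinset, Set.mem_ofPred_eq]
  exact ⟨fun h => h.2, fun h => ⟨h.le, h⟩⟩

theorem mem_upto {t : ℝ} {i : ℕ} : i ∈ Q.upto t ↔ Q.τ i ≤ t := by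
  simp [upto]

theorem τ_nonneg (i : ℕ) : 0 ≤ Q.τ i := by
  rw [← Q.τ_zero]; exact Q.τ_strictMono.monotone (Nat.zero_le i)

theorem τ_lt {i j : ℕ} : Q.τ i < Q.τ j ↔ i < j := Q.τ_strictMono.lt_iff_lt

theorem τ_le {i j : ℕ} : Q.τ i ≤ Q.τ j ↔ i ≤ j := Q.τ_strictMono.le_iff_le

theorem energyLeft_mono {a b : ℝ} (h : a ≤ b) : Q.energyLeft a ≤ Q.energyLeft b :=
  Finset.sum_le_sum_of_subset_of_nonneg
    (fun _ hi => Q.mem_before.2 ((Q.mem_before.1 hi).trans_le h)) fun i _ _ => (Q.e_pos i).le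

theorem energy_le_energyLeft {a b : ℝ} (h : a < b) : Q.energy a ≤ Q.energyLeft b :=
  Finset.sum_le_sum_of_subset_of_nonneg
    (fun _ hi => Q.mem_before.2 ((Q.mem_upto.1 hi).trans_lt h)) fun i _ _ => (Q.e_pos i).le

theorem energyLeft_le_energy (a : ℝ) : Q.energyLeft a ≤ Q.energy a :=
  Finset.sum_le_sum_of_subset_of_nonneg
    (fun _ hi => Q.mem_upto.2 (Q.mem_before.1 hi).le) fun i _ _ => (Q.e_pos i).le

theorem energyLeft_lt {a b : ℝ} {i : ℕ} (ha : a ≤ Q.τ i) (hb : Q.τ i < b) :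
    Q.energyLeft a < Q.energyLeft b :=
  Finset.sum_lt_sum_of_subset
    (fun _ hj => Q.mem_before.2 (((Q.mem_before.1 hj).trans_le ha).trans hb)) (Q.mem_before.2 hb)
    (fun h => absurd (Q.mem_before.1 h) (not_lt.2 ha)) (Q.e_pos i) fun i _ _ => (Q.e_pos i).le

theorem energyLeft_eq {a b : ℝ} (h : a ≤ b) (hno : ∀ i, a ≤ Q.τ i → b ≤ Q.τ i) :
    Q.energyLeft b = Q.energyLeft a := by
  unfold energyLeft
  congr 1
  ext i
  simp only [mem_before]
  refine ⟨fun hi => ?_, fun hi => hi.trans_le h⟩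
  by_contra! hc
  exact absurd hi (not_lt.2 (hno i hc))

theorem energyLeft_nonneg (a : ℝ) : 0 ≤ Q.energyLeft a :=
  Finset.sum_nonneg fun i _ => (Q.e_pos i).le

theorem energyLeft_of_nonpos {a : ℝ} (h : a ≤ 0) : Q.energyLeft a = 0 := by
  refine Finset.sum_eq_zero fun i hi => ?_
  exact absurd (Q.mem_before.1 hi) (not_lt.2 (h.trans (Q.τ_nonneg i)))

theorem energyLeft_pos {a : ℝ} (h : 0 < a) : 0 < Q.energyLeft a := by
  have := Q.energyLeft_lt (a := 0) (b := a) (i := 0) Q.τ_zero.ge (by rwa [Q.τ_zero])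
  rwa [Q.energyLeft_of_nonpos le_rfl] at this

theorem energyLeft_τ (k : ℕ) : Q.energyLeft (Q.τ k) = ∑ i ∈ Finset.range k, Q.e i := by
  unfold energyLeft
  congr 1
  ext i
  simp [mem_before, τ_lt]

theorem energy_τ (k : ℕ) : Q.energy (Q.τ k) = ∑ i ∈ Finset.range (k + 1), Q.e i := by
  unfold energy
  congr 1
  ext i
  simp [mem_upto, τ_le]

theorem energy_eq_energyLeft_succ (k : ℕ) : Q.energy (Q.τ k) = Q.energyLeft (Q.τ (k + 1)) := by
  rw [energy_τ, energyLeft_τ]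

theorem energy_mono {a b : ℝ} (h : a ≤ b) : Q.energy a ≤ Q.energy b :=
  Finset.sum_le_sum_of_subset_of_nonneg
    (fun _ hi => Q.mem_upto.2 ((Q.mem_upto.1 hi).trans h)) fun i _ _ => (Q.e_pos i).le

theorem energy_nonneg (a : ℝ) : 0 ≤ Q.energy a :=
  Finset.sum_nonneg fun i _ => (Q.e_pos i).le

/-- The next epoch after `t`. -/
theorem exists_next (t : ℝ) : ∃ k, t < Q.τ k ∧ Q.energy t = Q.energyLeft (Q.τ k) ∧
    ∀ i, t < Q.τ i → k ≤ i := by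
  classical
  have hex : ∃ k, t < Q.τ k := (Q.τ_tendsto.eventually_gt_atTop t).exists
  refine ⟨Nat.find hex, Nat.find_spec hex, ?_, fun i hi => Nat.find_min' hex hi⟩
  unfold energy energyLeft
  congr 1
  ext i
  rw [mem_before, mem_upto, τ_lt]
  constructor
  · intro hi
    by_contra! hc
    exact absurd ((Nat.find_spec hex).trans_le (Q.τ_le.2 hc)) (not_lt.2 hi)
  · intro hi
    exact not_lt.1 (Nat.find_min hex hi)

theorem chord_mul {a b : ℝ} (h : a < b) :
    Q.chord a b * (b - a) = Q.energyLeft b - Q.energyLeft a := by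
  unfold chord
  rw [div_mul_cancel₀ _ (by linarith)]

end Problem

/-! ### Sums over the pieces of a policy -/

/-- The sum of `f x a b` over the pieces of a policy with powers `x` on `[a, b]`; the first piece
starts at `a`, and `s` lists the later times. -/
def pieceSum (f : ℝ → ℝ → ℝ → ℝ) : ℝ → List ℝ → List ℝ → ℝ
  | a, x :: p, b :: s => f x a b + pieceSum f b p s
  | _, _, _ => 0

@[simp] theorem pieceSum_nil (f : ℝ → ℝ → ℝ → ℝ) (a : ℝ) (s : List ℝ) :
    pieceSum f a [] s = 0 := by simp [pieceSum]

@[simp] theorem pieceSum_cons (f : ℝ → ℝ → ℝ → ℝ) (a x b : ℝ) (p s : List ℝ) :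
    pieceSum f a (x :: p) (b :: s) = f x a b + pieceSum f b p s := by simp [pieceSum]

theorem pieceSum_append_cons (f : ℝ → ℝ → ℝ → ℝ) (s₁ : List ℝ) (c : ℝ) (s₂ : List ℝ) :
    ∀ (a : ℝ) (p₁ p₂ : List ℝ), p₁.length = s₁.length + 1 →
      pieceSum f a (p₁ ++ p₂) (s₁ ++ c :: s₂)
        = pieceSum f a p₁ (s₁ ++ [c]) + pieceSum f c p₂ s₂ := by
  induction s₁ with
  | nil =>
    intro a p₁ p₂ h
    obtain ⟨x, rfl⟩ := List.length_eq_one_iff.1 h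
    simp
  | cons b s₁ ih =>
    intro a p₁ p₂ h
    cases p₁ with
    | nil => simp at h
    | cons x p₁ =>
      simp only [List.cons_append, pieceSum_cons]
      rw [ih b p₁ p₂ (by simpa using h), add_assoc]

/-- The sum of `c x` times the length of the part before `t`, over all pieces. -/
def flow (c : ℝ → ℝ) (t : ℝ) : ℝ → List ℝ → List ℝ → ℝ :=
  pieceSum fun x a b => c x * (min b t - min a t)

/-- The sum of `c x` times the length, over all pieces. -/
def total (c : ℝ → ℝ) : ℝ → List ℝ → List ℝ → ℝ :=
  pieceSum fun x a b => c x * (b - a)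

@[simp] theorem flow_nil (c : ℝ → ℝ) (t a : ℝ) (s : List ℝ) : flow c t a [] s = 0 :=
  pieceSum_nil _ _ _

@[simp] theorem flow_cons (c : ℝ → ℝ) (t a x b : ℝ) (p s : List ℝ) :
    flow c t a (x :: p) (b :: s) = c x * (min b t - min a t) + flow c t b p s :=
  pieceSum_cons _ _ _ _ _ _

@[simp] theorem total_nil (c : ℝ → ℝ) (a : ℝ) (s : List ℝ) : total c a [] s = 0 :=
  pieceSum_nil _ _ _

@[simp] theorem total_cons (c : ℝ → ℝ) (a x b : ℝ) (p s : List ℝ) :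
    total c a (x :: p) (b :: s) = c x * (b - a) + total c b p s :=
  pieceSum_cons _ _ _ _ _ _

theorem total_append_cons (c : ℝ → ℝ) (s₁ : List ℝ) (m : ℝ) (s₂ : List ℝ) (a : ℝ)
    (p₁ p₂ : List ℝ) (h : p₁.length = s₁.length + 1) :
    total c a (p₁ ++ p₂) (s₁ ++ m :: s₂) = total c a p₁ (s₁ ++ [m]) + total c m p₂ s₂ :=
  pieceSum_append_cons _ _ _ _ _ _ _ h

theorem flow_of_le (c : ℝ → ℝ) {t : ℝ} (s : List ℝ) : ∀ (a : ℝ) (p : List ℝ),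
    (a :: s).Pairwise (· ≤ ·) → t ≤ a → flow c t a p s = 0 := by
  induction s with
  | nil => intro a p _ _; cases p <;> simp [flow, pieceSum]
  | cons b s ih =>
    intro a p hs ht
    cases p with
    | nil => simp
    | cons x p =>
      have hab : a ≤ b := (List.pairwise_cons.1 hs).1 b (by simp)
      rw [flow_cons, ih b p (List.pairwise_cons.1 hs).2 (ht.trans hab), min_eq_right ht,
        min_eq_right (ht.trans hab)]
      ring

theorem flow_of_ge (c : ℝ → ℝ) {t : ℝ} (s : List ℝ) : ∀ (a : ℝ) (p : List ℝ),
    (∀ b ∈ a :: s, b ≤ t) → flow c t a p s = total c a p s := by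
  induction s with
  | nil => intro a p _; cases p <;> simp [flow, total, pieceSum]
  | cons b s ih =>
    intro a p ht
    cases p with
    | nil => simp
    | cons x p =>
      rw [flow_cons, total_cons, ih b p fun d hd => ht d (List.mem_cons_of_mem _ hd),
        min_eq_left (ht a (by simp)), min_eq_left (ht b (by simp))]

namespace Policy

theorem sum_Icc_eq_sum_range (F : ℕ → ℝ) (n : ℕ) :
    ∑ i ∈ Finset.Icc 1 n, F i = ∑ i ∈ Finset.range n, F (i + 1) := by
  induction n with
  | zero => simp
  | succ n ih => rw [Finset.sum_Icc_succ_top (by omega), ih, Finset.sum_range_succ]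

theorem sum_eq_pieceSum (f : ℝ → ℝ → ℝ → ℝ) (s : List ℝ) : ∀ (a : ℝ) (p : List ℝ),
    s.length = p.length →
    ∑ i ∈ Finset.Icc 1 (Policy.mk p (a :: s)).N, f ((Policy.mk p (a :: s)).pow i)
      ((Policy.mk p (a :: s)).time i) ((Policy.mk p (a :: s)).time (i + 1))
      = pieceSum f a p s := by
  simp only [sum_Icc_eq_sum_range, N, pow, time, Nat.add_sub_cancel]
  induction s with
  | nil =>
    intro a p h
    have : p = [] := List.length_eq_zero_iff.1 h.symm
    simp [this]
  | cons b s ih =>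
    intro a p h
    cases p with
    | nil => simp at h
    | cons x p =>
      rw [List.length_cons, Finset.sum_range_succ', pieceSum_cons, ← ih b p (by simpa using h)]
      simp only [List.getD_cons_succ, List.getD_cons_zero]
      rw [add_comm]

theorem used_eq (a : ℝ) (p s : List ℝ) (h : s.length = p.length) (t : ℝ) :
    (Policy.mk p (a :: s)).used t = flow id t a p s :=
  sum_eq_pieceSum (fun x a b => x * (min b t - min a t)) s a p h

theorem bits_eq (g : ℝ → ℝ) (a : ℝ) (p s : List ℝ) (h : s.length = p.length) (t : ℝ) :
    (Policy.mk p (a :: s)).bits g t = flow g t a p s :=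
  sum_eq_pieceSum (fun x a b => g x * (min b t - min a t)) s a p h

theorem totalBits_eq (g : ℝ → ℝ) (a : ℝ) (p s : List ℝ) (h : s.length = p.length) :
    (Policy.mk p (a :: s)).totalBits g = total g a p s :=
  sum_eq_pieceSum (fun x a b => g x * (b - a)) s a p h

theorem onTime_eq (a : ℝ) (p s : List ℝ) (h : s.length = p.length) :
    (Policy.mk p (a :: s)).onTime = total (fun x => if x ≠ 0 then 1 else 0) a p s := by
  rw [total, ← sum_eq_pieceSum _ s a p h, onTime, Finset.sum_filter]
  refine Finset.sum_congr rfl fun i _ => ?_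
  split_ifs <;> simp

theorem finish_eq (a : ℝ) (p s : List ℝ) (h : s.length = p.length) :
    (Policy.mk p (a :: s)).finish = s.getLastD a := by
  simp only [finish, time, N, Nat.add_sub_cancel, ← h]
  clear h
  induction s generalizing a with
  | nil => rfl
  | cons b s ih => rw [List.length_cons, List.getD_cons_succ, ih, List.getLastD_cons]

end Policy

theorem total_one (s : List ℝ) : ∀ (a : ℝ) (p : List ℝ), s.length = p.length →
    total (fun _ => 1) a p s = s.getLastD a - a := by
  induction s with
  | nil =>
    intro a p h
    have : p = [] := List.length_eq_zero_iff.1 h.symm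
    simp [this]
  | cons b s ih =>
    intro a p h
    cases p with
    | nil => simp at h
    | cons x p =>
      rw [total_cons, ih b p (by simpa using h), List.getLastD_cons]
      ring

theorem total_congr {c c' : ℝ → ℝ} (s : List ℝ) : ∀ (a : ℝ) (p : List ℝ),
    (∀ x ∈ p, c x = c' x) → total c a p s = total c' a p s := by
  induction s with
  | nil => intro a p _; cases p <;> simp [total, pieceSum]
  | cons b s ih =>
    intro a p h
    cases p with
    | nil => simp
    | cons x p =>
      rw [total_cons, total_cons, h x (by simp), ih b p fun y hy => h y (by simp [hy])]

theorem total_replicate (c : ℝ → ℝ) (x : ℝ) (s : List ℝ) : ∀ (a : ℝ) (p : List ℝ),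
    s.length = p.length → (∀ y ∈ p, y = x) → total c a p s = c x * (s.getLastD a - a) := by
  intro a p hl h
  rw [← total_one s a p hl]
  rw [total_congr (c' := fun _ => c x) s a p fun y hy => by rw [h y hy]]
  clear hl h
  induction s generalizing a p with
  | nil => cases p <;> simp [total, pieceSum]
  | cons b s ih =>
    cases p with
    | nil => simp
    | cons y p => rw [total_cons, total_cons, ih b p]; ring

/-! ### Paths that touch the harvested energy -/

namespace Problem

variable (Q : Problem)

/-- A piece of a policy: power `x` leads from the energy level `u` at time `a` to the level
`𝓔(b⁻)` at time `b`, and stays below the harvested energy at the epochs in between. The relation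
`r` is `≤` or, if no touching epoch in between is allowed, `<`. A piece of length zero may only
occur at time `0`. -/
def Segment (r : ℝ → ℝ → Prop) (a u b x : ℝ) : Prop :=
  a ≤ b ∧ (a = 0 ∨ a < b) ∧ u + x * (b - a) = Q.energyLeft b ∧
    ∀ i, a < Q.τ i → Q.τ i < b → r (u + x * (Q.τ i - a)) (Q.energyLeft (Q.τ i))

/-- Consecutive pieces, with powers `p` and times `a` and then `s`, that start at the energy level
`u` and meet the energy harvested before, at each of the times in `s`. -/
def Path (r : ℝ → ℝ → Prop) : ℝ → ℝ → List ℝ → List ℝ → Prop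
  | _, _, [], [] => True
  | a, u, b :: s, x :: p => Q.Segment r a u b x ∧ Path r b (Q.energyLeft b) s p
  | _, _, _, _ => False

variable {Q}

@[simp] theorem path_nil {r : ℝ → ℝ → Prop} {a u : ℝ} {p : List ℝ} :
    Q.Path r a u [] p ↔ p = [] := by
  cases p <;> simp [Path]

@[simp] theorem path_cons_nil {r : ℝ → ℝ → Prop} {a u b : ℝ} {s : List ℝ} :
    ¬ Q.Path r a u (b :: s) [] := by
  simp [Path]

@[simp] theorem path_cons {r : ℝ → ℝ → Prop} {a u b x : ℝ} {s p : List ℝ} :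
    Q.Path r a u (b :: s) (x :: p) ↔
      Q.Segment r a u b x ∧ Q.Path r b (Q.energyLeft b) s p := by
  simp [Path]

theorem Path.length_eq {r : ℝ → ℝ → Prop} {s : List ℝ} : ∀ {a u : ℝ} {p : List ℝ},
    Q.Path r a u s p → s.length = p.length := by
  induction s with
  | nil => intro a u p h; simp [path_nil.1 h]
  | cons b s ih =>
    intro a u p h
    cases p with
    | nil => exact absurd h path_cons_nil
    | cons x p => simp [ih (path_cons.1 h).2]

theorem Segment.mono {r r' : ℝ → ℝ → Prop} (hr : ∀ x y, r x y → r' x y) {a u b x : ℝ}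
    (h : Q.Segment r a u b x) : Q.Segment r' a u b x :=
  ⟨h.1, h.2.1, h.2.2.1, fun i hi hb => hr _ _ (h.2.2.2 i hi hb)⟩

theorem Path.mono {r r' : ℝ → ℝ → Prop} (hr : ∀ x y, r x y → r' x y) {s : List ℝ} :
    ∀ {a u : ℝ} {p : List ℝ}, Q.Path r a u s p → Q.Path r' a u s p := by
  induction s with
  | nil => intro a u p h; simpa using h
  | cons b s ih =>
    intro a u p h
    cases p with
    | nil => exact absurd h path_cons_nil
    | cons x p =>
      exact path_cons.2 ⟨(path_cons.1 h).1.mono hr, ih (path_cons.1 h).2⟩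

theorem path_append_cons {r : ℝ → ℝ → Prop} {c : ℝ} {s₂ : List ℝ} {s₁ : List ℝ} :
    ∀ {a u : ℝ} {p₁ p₂ : List ℝ}, p₁.length = s₁.length + 1 →
      (Q.Path r a u (s₁ ++ c :: s₂) (p₁ ++ p₂) ↔
        Q.Path r a u (s₁ ++ [c]) p₁ ∧ Q.Path r c (Q.energyLeft c) s₂ p₂) := by
  induction s₁ with
  | nil =>
    intro a u p₁ p₂ h
    obtain ⟨x, rfl⟩ := List.length_eq_one_iff.1 h
    simp
  | cons b s₁ ih =>
    intro a u p₁ p₂ h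
    cases p₁ with
    | nil => simp at h
    | cons x p₁ =>
      simp only [List.cons_append, path_cons]
      rw [ih (by simpa using h), and_assoc]

theorem Path.pairwise {r : ℝ → ℝ → Prop} {s : List ℝ} : ∀ {a u : ℝ} {p : List ℝ},
    Q.Path r a u s p → (a :: s).Pairwise (· ≤ ·) := by
  induction s with
  | nil => intro a u p h; simp
  | cons b s ih =>
    intro a u p h
    cases p with
    | nil => exact absurd h path_cons_nil
    | cons x p =>
      obtain ⟨h1, h2⟩ := path_cons.1 h
      have := ih h2
      refine List.pairwise_cons.2 ⟨fun d hd => ?_, this⟩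
      rcases List.mem_cons.1 hd with rfl | hd
      · exact h1.1
      · exact h1.1.trans ((List.pairwise_cons.1 this).1 d hd)

theorem Path.pairwise_lt {r : ℝ → ℝ → Prop} {s : List ℝ} : ∀ {a u : ℝ} {p : List ℝ},
    Q.Path r a u s p → 0 < a → (a :: s).Pairwise (· < ·) := by
  induction s with
  | nil => intro a u p h _; simp
  | cons b s ih =>
    intro a u p h ha
    cases p with
    | nil => exact absurd h path_cons_nil
    | cons x p =>
      obtain ⟨h1, h2⟩ := path_cons.1 h
      have hab : a < b := h1.2.1.resolve_left ha.ne'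
      have := ih h2 (ha.trans hab)
      refine List.pairwise_cons.2 ⟨fun d hd => ?_, this⟩
      rcases List.mem_cons.1 hd with rfl | hd
      · exact hab
      · exact hab.trans ((List.pairwise_cons.1 this).1 d hd)

theorem Path.level {r : ℝ → ℝ → Prop} {t : ℝ} {s : List ℝ} : ∀ {a u : ℝ} {p : List ℝ},
    Q.Path r a u s p → t ∈ s → u + flow id t a p s = Q.energyLeft t := by
  induction s with
  | nil => intro a u p _ h; simp at h
  | cons b s ih =>
    intro a u p h ht
    cases p with
    | nil => exact absurd h path_cons_nil
    | cons x p =>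
      have hs := h.pairwise
      obtain ⟨h1, h2⟩ := path_cons.1 h
      have hbt : b ≤ t := by
        rcases List.mem_cons.1 ht with rfl | ht
        · exact le_rfl
        · exact (List.pairwise_cons.1 h2.pairwise).1 t ht
      rw [flow_cons, min_eq_left hbt, min_eq_left (h1.1.trans hbt), ← add_assoc, id, h1.2.2.1]
      rcases List.mem_cons.1 ht with rfl | ht
      · rw [flow_of_le id s t p h2.pairwise le_rfl, add_zero]
      · exact ih h2 ht

/-- Between two touching epochs the energy used stays below the energy harvested, since both are
increasing and the harvested energy is constant between epochs. -/
theorem Segment.le_energy {a u b x t : ℝ} (h : Q.Segment (· ≤ ·) a u b x) (hx : 0 ≤ x)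
    (ha : a ≤ t) (hb : t < b) : u + x * (t - a) ≤ Q.energy t := by
  obtain ⟨k, hk, he, -⟩ := Q.exists_next t
  rw [he]
  rcases lt_or_ge (Q.τ k) b with hkb | hkb
  · refine le_trans ?_ (h.2.2.2 k (ha.trans_lt hk) hkb)
    nlinarith
  · refine le_trans ?_ (Q.energyLeft_mono hkb)
    rw [← h.2.2.1]
    nlinarith

theorem Path.le_energy {t : ℝ} {s : List ℝ} : ∀ {a u : ℝ} {p : List ℝ},
    Q.Path (· ≤ ·) a u s p → (∀ x ∈ p, 0 ≤ x) → u ≤ Q.energyLeft a → a ≤ t →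
      u + flow id t a p s ≤ Q.energy t := by
  induction s with
  | nil =>
    intro a u p h _ hu ht
    rw [path_nil.1 h, flow_nil, add_zero]
    exact hu.trans ((Q.energyLeft_mono ht).trans (Q.energyLeft_le_energy t))
  | cons b s ih =>
    intro a u p h hp hu ht
    cases p with
    | nil => exact absurd h path_cons_nil
    | cons x p =>
      obtain ⟨h1, h2⟩ := path_cons.1 h
      rw [flow_cons, min_eq_left ht]
      rcases lt_or_ge t b with htb | htb
      · rw [min_eq_right htb.le, flow_of_le id s b p h2.pairwise htb.le, add_zero]
        exact h1.le_energy (hp x (by simp)) ht htb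
      · rw [min_eq_left htb, ← add_assoc, id, h1.2.2.1]
        exact ih h2 (fun y hy => hp y (by simp [hy])) le_rfl htb

theorem Path.energyFeasible {a : ℝ} {s p : List ℝ} (h : Q.Path (· ≤ ·) a 0 s p) (ha : 0 ≤ a)
    (hp : ∀ x ∈ p, 0 ≤ x) : Q.EnergyFeasible ⟨p, a :: s⟩ := by
  refine ⟨⟨by simp [Policy.N, h.length_eq], h.pairwise, ha, hp⟩, fun t ht => ?_⟩
  rw [Policy.used_eq a p s h.length_eq]
  rcases le_total a t with hat | hat
  · have := h.le_energy hp (Q.energyLeft_nonneg a) hat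
    rwa [zero_add] at this
  · rw [flow_of_le id s a p h.pairwise hat]
    exact Q.energy_nonneg t

/-- A straight line of slope `x` below the harvested energy, cut at the epochs that it touches, is
a path without further touching epochs. -/
theorem path_of_line {b x : ℝ} (L : List ℕ) : ∀ {a u : ℝ}, L.Pairwise (· < ·) →
    (∀ i ∈ L, a ≤ Q.τ i ∧ (a = 0 ∨ a < Q.τ i) ∧ Q.τ i < b ∧
      u + x * (Q.τ i - a) = Q.energyLeft (Q.τ i)) →
    (∀ i, i ∉ L → a < Q.τ i → Q.τ i < b → u + x * (Q.τ i - a) < Q.energyLeft (Q.τ i)) →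
    a < b → u + x * (b - a) = Q.energyLeft b →
    Q.Path (· < ·) a u (L.map Q.τ ++ [b]) (List.replicate (L.length + 1) x) := by
  induction L with
  | nil =>
    intro a u _ _ hno hab hb
    simp only [List.map_nil, List.nil_append, List.length_nil, zero_add, List.replicate_one,
      path_cons, path_nil, and_true]
    exact ⟨hab.le, Or.inr hab, hb, fun i hi hib => hno i (by simp) hi hib⟩
  | cons k L ih =>
    intro a u hL hin hno hab hb
    obtain ⟨h1, h2, h3, h4⟩ := hin k (by simp)
    rw [List.pairwise_cons] at hL
    rw [List.length_cons, List.replicate_succ, List.map_cons, List.cons_append, path_cons]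
    have shift : ∀ t, Q.energyLeft (Q.τ k) + x * (t - Q.τ k) = u + x * (t - a) := by
      intro t; rw [← h4]; ring
    refine ⟨⟨h1, h2, h4, fun i hi hik => hno i ?_ hi (hik.trans h3)⟩, ih hL.2 ?_ ?_ h3 ?_⟩
    · intro hmem
      rcases List.mem_cons.1 hmem with rfl | hmem
      · exact lt_irrefl _ hik
      · exact absurd (hL.1 i hmem) (not_lt.2 (Q.τ_lt.1 hik).le)
    · intro i hi
      have := Q.τ_lt.2 (hL.1 i hi)
      obtain ⟨-, -, k3, k4⟩ := hin i (by simp [hi])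
      exact ⟨this.le, Or.inr this, k3, by rw [shift, k4]⟩
    · intro i hi hki hib
      rw [shift]
      refine hno i ?_ (h1.trans_lt hki) hib
      intro hmem
      rcases List.mem_cons.1 hmem with rfl | hmem
      · exact lt_irrefl _ hki
      · exact hi hmem
    · rw [shift, hb]

theorem path_of_line_sort {a u b x : ℝ} (A : Finset ℕ)
    (hin : ∀ i ∈ A, a ≤ Q.τ i ∧ (a = 0 ∨ a < Q.τ i) ∧ Q.τ i < b ∧
      u + x * (Q.τ i - a) = Q.energyLeft (Q.τ i))
    (hno : ∀ i, i ∉ A → a < Q.τ i → Q.τ i < b → u + x * (Q.τ i - a) < Q.energyLeft (Q.τ i))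
    (hab : a < b) (hb : u + x * (b - a) = Q.energyLeft b) :
    Q.Path (· < ·) a u ((A.sort (· ≤ ·)).map Q.τ ++ [b])
      (List.replicate (((A.sort (· ≤ ·)).map Q.τ).length + 1) x) := by
  rw [List.length_map]
  refine path_of_line _ A.sortedLT_sort.pairwise ?_ ?_ hab hb
  · intro i hi
    exact hin i ((Finset.mem_sort _).1 hi)
  · intro i hi
    exact hno i fun hc => hi ((Finset.mem_sort _).2 hc)

end Problem

/-! ### Valid states -/

namespace Problem

variable {Q : Problem}

theorem path_concat {r : ℝ → ℝ → Prop} {b x : ℝ} {s : List ℝ} : ∀ {a : ℝ} {p : List ℝ},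
    Q.Path r a (Q.energyLeft a) (s ++ [b]) (p ++ [x]) ↔
      Q.Path r a (Q.energyLeft a) s p ∧
        Q.Segment r (s.getLastD a) (Q.energyLeft (s.getLastD a)) b x := by
  induction s with
  | nil =>
    intro a p
    cases p <;> simp
  | cons c s ih =>
    intro a p
    cases p with
    | nil =>
      cases s <;> simp
    | cons y p =>
      rw [List.cons_append, List.cons_append, path_cons, path_cons, ih, List.getLastD_cons,
        and_assoc]

end Problem

theorem total_concat (c : ℝ → ℝ) (b x : ℝ) (s : List ℝ) : ∀ (a : ℝ) (p : List ℝ),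
    s.length = p.length →
      total c a (p ++ [x]) (s ++ [b]) = total c a p s + c x * (b - s.getLastD a) := by
  induction s with
  | nil =>
    intro a p h
    have : p = [] := List.length_eq_zero_iff.1 h.symm
    simp [this]
  | cons d s ih =>
    intro a p h
    cases p with
    | nil => simp at h
    | cons y p =>
      rw [List.cons_append, List.cons_append, total_cons, total_cons, ih d p (by simpa using h),
        List.getLastD_cons, add_assoc]

namespace Problem

variable (Q : Problem)

/-- The state describes a policy that sends `B₀` bits with positive and increasing powers, changes
its power at epochs only, and has used up the harvested energy at these epochs and at its finish
time; `τ_q` is one of the epochs. If `r` is `<`, then all the epochs at which it has used up the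
harvested energy are recorded. -/
structure Valid (r : ℝ → ℝ → Prop) (S : State) : Prop where
  nonneg : 0 ≤ S.tBegin
  head : ∃ s, S.s = S.tl :: s
  last : ∃ s, S.s = s ++ [S.tr]
  path : Q.Path r S.tBegin 0 (S.s ++ [S.tEnd]) (S.pl :: (S.p ++ [S.pr]))
  pos : 0 < S.pl
  sorted : (S.pl :: (S.p ++ [S.pr])).Pairwise (· ≤ ·)
  epochs : ∀ t ∈ S.s, ∃ j, t = Q.τ j
  q_mem : Q.τ Q.q ∈ S.s
  bits : total Q.g S.tBegin (S.pl :: (S.p ++ [S.pr])) (S.s ++ [S.tEnd]) = Q.B₀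

variable {Q}

theorem Valid.mono {r r' : ℝ → ℝ → Prop} (hr : ∀ x y, r x y → r' x y) {S : State}
    (h : Q.Valid r S) : Q.Valid r' S :=
  { h with path := h.path.mono hr }

theorem Valid.weaken {S : State} (h : Q.Valid (· < ·) S) : Q.Valid (· ≤ ·) S :=
  h.mono fun _ _ => le_of_lt

/-- The three parts of a valid state: before `τ_l`, from `τ_l` to `τ_r`, and after `τ_r`. -/
theorem Valid.parts {r : ℝ → ℝ → Prop} {S : State} (h : Q.Valid r S) :
    ∃ s, S.s = S.tl :: s ∧ s.getLastD S.tl = S.tr ∧ Q.Segment r S.tBegin 0 S.tl S.pl ∧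
      Q.Path r S.tl (Q.energyLeft S.tl) s S.p ∧
      Q.Segment r S.tr (Q.energyLeft S.tr) S.tEnd S.pr ∧
      Q.g S.pl * (S.tl - S.tBegin) + total Q.g S.tl S.p s + Q.g S.pr * (S.tEnd - S.tr)
        = Q.B₀ := by
  obtain ⟨s, hs⟩ := h.head
  obtain ⟨s₀, hs₀⟩ := h.last
  have hl : s.getLastD S.tl = S.tr := by
    have : (S.s).getLastD 0 = S.tr := by rw [hs₀, List.getLastD_concat]
    rwa [hs, List.getLastD_cons] at this
  have hp := h.path
  have hb := h.bits
  rw [hs, List.cons_append] at hp hb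
  rw [path_cons, path_concat, hl] at hp
  rw [total_cons, total_concat _ _ _ _ _ _ hp.2.1.length_eq, hl] at hb
  exact ⟨s, hs, hl, hp.1, hp.2.1, hp.2.2, by linarith⟩

theorem Valid.of_parts {r : ℝ → ℝ → Prop} {S : State} {s : List ℝ} (hs : S.s = S.tl :: s)
    (hl : s.getLastD S.tl = S.tr) (h0 : 0 ≤ S.tBegin) (h1 : Q.Segment r S.tBegin 0 S.tl S.pl)
    (h2 : Q.Path r S.tl (Q.energyLeft S.tl) s S.p)
    (h3 : Q.Segment r S.tr (Q.energyLeft S.tr) S.tEnd S.pr) (pos : 0 < S.pl)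
    (sorted : (S.pl :: (S.p ++ [S.pr])).Pairwise (· ≤ ·))
    (epochs : ∀ t ∈ S.s, ∃ j, t = Q.τ j) (q_mem : Q.τ Q.q ∈ S.s)
    (bits : Q.g S.pl * (S.tl - S.tBegin) + total Q.g S.tl S.p s + Q.g S.pr * (S.tEnd - S.tr)
        = Q.B₀) : Q.Valid r S where
  nonneg := h0
  head := ⟨s, hs⟩
  last := by
    have hne : S.s ≠ [] := by rw [hs]; simp
    refine ⟨S.s.dropLast, ?_⟩
    have : S.s.getLast hne = S.tr := by
      rw [← hl, List.getLast_congr hne (by simp) hs, List.getLast_eq_getLastD]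
    rw [← this, List.dropLast_append_getLast]
  path := by
    rw [hs, List.cons_append, path_cons, path_concat, hl]
    exact ⟨h1, h2, h3⟩
  pos := pos
  sorted := sorted
  epochs := epochs
  q_mem := q_mem
  bits := by
    rw [hs, List.cons_append, total_cons, total_concat _ _ _ _ _ _ h2.length_eq, hl]
    linarith

theorem Valid.powers_pos {r : ℝ → ℝ → Prop} {S : State} (h : Q.Valid r S) :
    ∀ x ∈ S.pl :: (S.p ++ [S.pr]), 0 < x := by
  intro x hx
  rcases List.mem_cons.1 hx with rfl | hx
  · exact h.pos
  · exact h.pos.trans_le ((List.pairwise_cons.1 h.sorted).1 x hx)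

theorem Valid.length_eq {r : ℝ → ℝ → Prop} {S : State} (h : Q.Valid r S) :
    (S.s ++ [S.tEnd]).length = (S.pl :: (S.p ++ [S.pr])).length := h.path.length_eq

theorem _root_.Harvest.State.policy_eq (S : State) :
    S.policy = ⟨S.pl :: (S.p ++ [S.pr]), S.tBegin :: (S.s ++ [S.tEnd])⟩ := rfl

theorem Valid.finish_eq {r : ℝ → ℝ → Prop} {S : State} (h : Q.Valid r S) :
    S.policy.finish = S.tEnd := by
  rw [State.policy_eq, Policy.finish_eq _ _ _ h.length_eq, List.getLastD_concat]

theorem Valid.energyFeasible {S : State} (h : Q.Valid (· ≤ ·) S) :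
    Q.EnergyFeasible S.policy :=
  h.path.energyFeasible h.nonneg fun x hx => (h.powers_pos x hx).le

theorem Valid.feasible {S : State} (h : Q.Valid (· ≤ ·) S) (hd : S.tEnd - S.tBegin ≤ Q.Γ₀) :
    Q.Feasible S.policy := by
  refine ⟨h.energyFeasible, ?_, ?_⟩
  · rw [h.finish_eq, State.policy_eq, Policy.bits_eq _ _ _ _ h.length_eq, flow_of_ge, h.bits]
    intro d hd
    have := h.path.pairwise
    rw [← List.cons_append] at this hd
    rcases List.mem_append.1 hd with hd | hd
    · exact (List.pairwise_append.1 this).2.2 d hd _ (by simp)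
    · simp at hd; exact hd.le
  · rw [State.policy_eq, Policy.onTime_eq _ _ _ h.length_eq, total_congr (c' := fun _ => 1),
      total_one _ _ _ h.length_eq, List.getLastD_concat]
    · exact hd
    · intro x hx
      simp [(h.powers_pos x hx).ne']

end Problem

/-! ### Optimality -/

/-- The tangent line bounds the bits that a policy sends between two times in terms of the energy
and of the receiver time that it spends between them. -/
theorem flow_sub_le {g : ℝ → ℝ} (hg : IsRate g) {P t₁ t₂ : ℝ} (hP : 0 < P) (ht : t₁ ≤ t₂)
    (s : List ℝ) : ∀ (a : ℝ) (p : List ℝ), (a :: s).Pairwise (· ≤ ·) → (∀ x ∈ p, 0 ≤ x) →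
      flow g t₂ a p s - flow g t₁ a p s ≤
        intercept g P * (flow (fun x => if x ≠ 0 then 1 else 0) t₂ a p s
          - flow (fun x => if x ≠ 0 then 1 else 0) t₁ a p s)
        + marginal g P * (flow id t₂ a p s - flow id t₁ a p s) := by
  induction s with
  | nil => intro a p _ _; cases p <;> simp [flow, pieceSum]
  | cons b s ih =>
    intro a p hs hp
    cases p with
    | nil => simp
    | cons x p =>
      have hab : a ≤ b := (List.pairwise_cons.1 hs).1 b (by simp)
      have := ih b p (List.pairwise_cons.1 hs).2 fun y hy => hp y (by simp [hy])
      simp only [flow_cons, id]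
      have hw : 0 ≤ (min b t₂ - min a t₂) - (min b t₁ - min a t₁) := by
        rcases min_cases a t₁ with h1 | h1 <;> rcases min_cases b t₁ with h2 | h2 <;>
          rcases min_cases a t₂ with h3 | h3 <;> rcases min_cases b t₂ with h4 | h4 <;> linarith
      have key : g x ≤ intercept g P * (if x ≠ 0 then 1 else 0) + marginal g P * x := by
        by_cases hx : x = 0
        · simp [hx, hg.zero]
        · have := hg.le_tangent hP (hp x (by simp))
          simpa [hx] using this
      have := mul_le_mul_of_nonneg_right key hw
      linarith

/-- The receiver is on for at most the time that passes before the finish time. -/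
theorem flow_on_sub_le {t₁ t₂ : ℝ} (ht : t₁ ≤ t₂) (s : List ℝ) : ∀ (a : ℝ) (p : List ℝ),
    (a :: s).Pairwise (· ≤ ·) → s.length = p.length →
      flow (fun x => if x ≠ 0 then 1 else 0) t₂ a p s
        - flow (fun x => if x ≠ 0 then 1 else 0) t₁ a p s ≤
      (min (s.getLastD a) t₂ - min a t₂) - (min (s.getLastD a) t₁ - min a t₁) := by
  induction s with
  | nil =>
    intro a p _ h
    have : p = [] := List.length_eq_zero_iff.1 h.symm
    simp [this]
  | cons b s ih =>
    intro a p hs h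
    cases p with
    | nil => simp at h
    | cons x p =>
      have hab : a ≤ b := (List.pairwise_cons.1 hs).1 b (by simp)
      have := ih b p (List.pairwise_cons.1 hs).2 (by simpa using h)
      simp only [flow_cons, List.getLastD_cons]
      have hw : 0 ≤ (min b t₂ - min a t₂) - (min b t₁ - min a t₁) := by
        rcases min_cases a t₁ with h1 | h1 <;> rcases min_cases b t₁ with h2 | h2 <;>
          rcases min_cases a t₂ with h3 | h3 <;> rcases min_cases b t₂ with h4 | h4 <;> linarith
      split_ifs <;> linarith

theorem flow_continuous (c : ℝ → ℝ) (s : List ℝ) : ∀ (a : ℝ) (p : List ℝ),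
    Continuous fun t => flow c t a p s := by
  induction s with
  | nil => intro a p; cases p <;> simpa [flow, pieceSum] using continuous_const
  | cons b s ih =>
    intro a p
    cases p with
    | nil => simpa using continuous_const
    | cons x p =>
      simp only [flow_cons]
      have := ih b p
      fun_prop

namespace Problem

variable (Q : Problem)

/-- What the proof of optimality uses about a feasible policy with finish time `F`: the bits `B`
sent, the energy `U` used and the receiver time `O` spent, as functions of time. -/
structure Rival (B U O : ℝ → ℝ) (F : ℝ) : Prop where
  step : ∀ P, 0 < P → ∀ t₁ t₂, t₁ ≤ t₂ →
    B t₂ - B t₁ ≤ intercept Q.g P * (O t₂ - O t₁) + marginal Q.g P * (U t₂ - U t₁)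
  energy : ∀ t, U t ≤ Q.energyLeft t
  on_sub_le : ∀ t₁ t₂, t₁ ≤ t₂ → O t₂ - O t₁ ≤ min F t₂ - min F t₁
  on_le : ∀ t, F ≤ t → O t ≤ Q.Γ₀
  bits : ∀ t, F ≤ t → B t = Q.B₀
  finish_nonneg : 0 ≤ F
  bits_zero : B 0 = 0
  used_zero : U 0 = 0
  on_zero : O 0 = 0

variable {Q}

theorem _root_.List.Pairwise.le_getLastD {a : ℝ} {s : List ℝ} (h : (a :: s).Pairwise (· ≤ ·)) :
    ∀ d ∈ a :: s, d ≤ s.getLastD a := by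
  intro d hd
  rcases List.eq_nil_or_concat s with rfl | ⟨s', b, hc⟩
  · simp at hd; simp [hd]
  · rw [List.concat_eq_append] at hc
    subst hc
    rw [List.getLastD_concat]
    rw [← List.cons_append] at hd h
    rcases List.mem_append.1 hd with hd | hd
    · exact (List.pairwise_append.1 h).2.2 d hd b (by simp)
    · simp at hd; exact hd.le

/-- The energy used is continuous in time, so that it is bounded by the energy harvested strictly
before. -/
theorem EnergyFeasible.flow_le {a : ℝ} {p s : List ℝ} (h : Q.EnergyFeasible ⟨p, a :: s⟩) (t : ℝ) :
    flow id t a p s ≤ Q.energyLeft t := by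
  obtain ⟨⟨hlen, hpw, hst, -⟩, hE⟩ := h
  have hl : s.length = p.length := by simpa [Policy.N] using hlen
  have ha : 0 ≤ a := hst
  have hend := List.Pairwise.le_getLastD hpw
  rw [Policy.finish_eq a p s hl] at hE
  have hF0 : 0 ≤ s.getLastD a := ha.trans (hend a (by simp))
  have hE' : ∀ t, 0 ≤ t → flow id t a p s ≤ Q.energy t := by
    intro t ht
    rcases le_total t (s.getLastD a) with htF | htF
    · have := hE t ⟨ht, htF⟩
      rwa [Policy.used_eq a p s hl] at this
    · have := hE _ ⟨hF0, le_rfl⟩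
      rw [Policy.used_eq a p s hl, flow_of_ge _ _ _ _ hend] at this
      rw [flow_of_ge _ _ _ _ fun d hd => (hend d hd).trans htF]
      exact this.trans (Q.energy_mono htF)
  rcases le_or_gt t 0 with ht | ht
  · rw [flow_of_le id s a p hpw (ht.trans ha)]
    exact Q.energyLeft_nonneg t
  · have hc : Tendsto (fun t' => flow id t' a p s) (nhdsWithin t (Set.Iio t))
        (nhds (flow id t a p s)) :=
      (flow_continuous id s a p).continuousAt.tendsto.mono_left nhdsWithin_le_nhds
    refine le_of_tendsto hc ?_
    filter_upwards [Ioo_mem_nhdsLT ht] with t' ht'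
    exact (hE' t' ht'.1.le).trans (Q.energy_le_energyLeft ht'.2)

theorem Feasible.exists_rival {Y : Policy} (h : Q.Feasible Y) :
    ∃ B U O, Q.Rival B U O Y.finish := by
  obtain ⟨p, s⟩ := Y
  obtain ⟨hEF, hb, ho⟩ := h
  obtain ⟨hlen, hpw, hst, hp⟩ := hEF.1
  cases s with
  | nil => simp at hlen
  | cons a s =>
    have hl : s.length = p.length := by simpa [Policy.N] using hlen
    have ha : 0 ≤ a := hst
    have hend := List.Pairwise.le_getLastD hpw
    rw [Policy.finish_eq a p s hl] at *
    have hF0 : 0 ≤ s.getLastD a := ha.trans (hend a (by simp))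
    have hcap : ∀ c t, s.getLastD a ≤ t → flow c t a p s = total c a p s := fun c t ht =>
      flow_of_ge c s a p fun d hd => (hend d hd).trans ht
    refine ⟨fun t => flow Q.g t a p s, fun t => flow id t a p s,
      fun t => flow (fun x => if x ≠ 0 then 1 else 0) t a p s, ?_⟩
    have h0 : ∀ c t, t ≤ 0 → flow c t a p s = 0 := fun c t ht =>
      flow_of_le c s a p hpw (ht.trans ha)
    refine ⟨fun P hP t₁ t₂ ht => flow_sub_le Q.rate hP ht s a p hpw hp, hEF.flow_le, ?_, ?_, ?_,
      hF0, h0 _ _ le_rfl, h0 _ _ le_rfl, h0 _ _ le_rfl⟩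
    · intro t₁ t₂ ht
      have := flow_on_sub_le ht s a p hpw hl
      have h2 : min a t₁ ≤ min a t₂ := min_le_min_left _ ht
      linarith
    · intro t ht
      show flow _ t a p s ≤ _
      rw [hcap _ _ ht, ← Policy.onTime_eq a p s hl]
      exact ho
    · intro t ht
      show flow _ t a p s = _
      rw [hcap _ _ ht, ← hb, Policy.bits_eq _ _ _ _ hl, hcap _ _ le_rfl]

/-- Bound on the bits of a rival along a path with increasing powers, when the supporting line is
changed at each touching epoch. Changing it towards higher powers is no loss there, because the
rival has not used more energy, and from then on it spends less receiver time than the policy, by at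
least `δ`. -/
theorem Rival.along_path {B U O : ℝ → ℝ} {F T δ : ℝ} (hR : Q.Rival B U O F) {s : List ℝ} :
    ∀ {a x₀ x₁ C : ℝ} {p : List ℝ}, Q.Path (· ≤ ·) a (Q.energyLeft a) s p → 0 < x₀ → 0 < x₁ →
      (x₁ :: p).Pairwise (· ≤ ·) →
      (∀ t ∈ a :: s, δ ≤ (T - t) - (O T - O t)) →
      B a ≤ C + marginal Q.g x₁ * (U a - Q.energyLeft a)
        + intercept Q.g x₁ * ((T - a) - (O T - O a))
        - (intercept Q.g x₁ - intercept Q.g x₀) * δ →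
      ∀ d, d = s.getLastD a →
      B d ≤ C + total Q.g a p s + marginal Q.g (p.getLastD x₁) * (U d - Q.energyLeft d)
        + intercept Q.g (p.getLastD x₁) * ((T - d) - (O T - O d))
        - (intercept Q.g (p.getLastD x₁) - intercept Q.g x₀) * δ := by
  induction s with
  | nil =>
    intro a x₀ x₁ C p hp _ _ _ _ hB d hd
    rw [path_nil] at hp
    simp only [List.getLastD_nil] at hd
    subst hp hd
    simpa using hB
  | cons b s ih =>
    intro a x₀ x₁ C p hp h0 h1 hs hδ hB d hd
    cases p with
    | nil => exact absurd hp path_cons_nil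
    | cons x p =>
      obtain ⟨hseg, hrest⟩ := path_cons.1 hp
      have hx : x₁ ≤ x := (List.pairwise_cons.1 hs).1 x (by simp)
      have hx0 : 0 < x := h1.trans_le hx
      rw [List.getLastD_cons] at hd ⊢
      rw [total_cons, ← add_assoc]
      refine ih hrest h0 hx0 (List.pairwise_cons.1 hs).2
        (fun t ht => hδ t (List.mem_cons_of_mem _ ht)) ?_ d hd
      have k1 := mul_nonneg (sub_nonneg.2 (Q.rate.marginal_le h1 hx))
        (sub_nonneg.2 (hR.energy a))
      have k2 := mul_nonneg (sub_nonneg.2 (Q.rate.intercept_le h1 hx))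
        (sub_nonneg.2 (hδ a (by simp)))
      have k3 := hR.step x hx0 a b hseg.1
      have k4 := eq_tangent Q.g x
      rw [← hseg.2.2.1, k4]
      linarith

theorem Path.level_of_const {r : ℝ → ℝ → Prop} {x t : ℝ} {s : List ℝ} :
    ∀ {a u : ℝ} {p : List ℝ}, Q.Path r a u s p → (∀ y ∈ p, y = x) → t ∈ s →
      Q.energyLeft t = u + x * (t - a) := by
  induction s with
  | nil => intro a u p _ _ h; simp at h
  | cons b s ih =>
    intro a u p h hx ht
    cases p with
    | nil => exact absurd h path_cons_nil
    | cons y p =>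
      obtain ⟨h1, h2⟩ := path_cons.1 h
      have hb := h1.2.2.1
      rw [hx y (by simp)] at hb
      rcases List.mem_cons.1 ht with rfl | ht
      · exact hb.symm
      · rw [ih h2 (fun z hz => hx z (by simp [hz])) ht, ← hb]
        ring

/-- No rival finishes earlier. If the policy starts at time `0`, or if its power is not constant, a
rival loses bits because it lacks the receiver time at the end. If the power is constant, a strict
loss shows when the supporting line at a slightly higher power is used after `τ_q`, where the rival
spends less receiver time than the policy. -/
theorem Valid.le_finish {S : State} (h : Q.Valid (· ≤ ·) S)
    (hpos : 0 < S.tBegin → S.tEnd - S.tBegin = Q.Γ₀) {B U O : ℝ → ℝ} {F : ℝ}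
    (hR : Q.Rival B U O F) : S.tEnd ≤ F := by
  by_contra! hF
  obtain ⟨s, hs, hlast, hseg1, hpath, hseg3, hbits⟩ := h.parts
  have hg := Q.rate
  have hT0 : 0 < S.tEnd := hR.finish_nonneg.trans_lt hF
  have hpw := h.path.pairwise
  have htr : S.tr < S.tEnd := by
    rcases hseg3.2.1 with h0 | h0
    · rwa [h0]
    · exact h0
  have hle_tr : ∀ t ∈ S.tl :: s, t ≤ S.tr := by
    intro t ht
    rw [← hs] at ht
    obtain ⟨s₀, hs₀⟩ := h.last
    have h2 := (List.pairwise_append.1 (List.pairwise_cons.1 hpw).2).1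
    rw [hs₀] at h2 ht
    rcases List.mem_append.1 ht with ht | ht
    · exact (List.pairwise_append.1 h2).2.2 t ht _ (by simp)
    · simp at ht; exact ht.le
  have htl : S.tl ≤ S.tr := hle_tr _ (by simp)
  have htl0 : 0 ≤ S.tl := h.nonneg.trans hseg1.1
  have hspl : (S.pl :: S.p).Pairwise (· ≤ ·) := by
    have := h.sorted
    rw [← List.cons_append] at this
    exact (List.pairwise_append.1 this).1
  have hpr : ∀ x ∈ S.pl :: S.p, x ≤ S.pr := by
    intro x hx
    have := h.sorted
    rw [← List.cons_append] at this
    exact (List.pairwise_append.1 this).2.2 x hx _ (by simp)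
  have hpr0 : 0 < S.pr := h.pos.trans_le (hpr _ (by simp))
  set T := S.tEnd with hT
  set δ := min (T - F) (T - S.tr) with hδ
  have hδ0 : 0 < δ := lt_min (by linarith) (by linarith)
  have hD : ∀ t, t ≤ S.tr → δ ≤ (T - t) - (O T - O t) := by
    intro t ht
    have h1 := hR.on_sub_le t T (by linarith)
    rw [min_eq_left hF.le] at h1
    rcases min_cases F t with h2 | h2
    · have : δ ≤ T - S.tr := min_le_right _ _
      linarith
    · have : δ ≤ T - F := min_le_left _ _
      linarith
  have hOT : O T ≤ Q.Γ₀ := hR.on_le T hF.le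
  -- the receiver time that a rival can spend in excess of the policy before `τ_l`
  set ε := T - S.tBegin - O T with hε
  have hε0 : 0 ≤ ε ∧ (S.tBegin = 0 → 0 < ε) := by
    have h1 := hR.on_sub_le 0 T hT0.le
    rw [min_eq_left hF.le, min_eq_right hR.finish_nonneg, hR.on_zero] at h1
    have hz : S.tBegin = 0 → 0 < ε := fun h0 => by rw [hε, h0]; linarith
    refine ⟨?_, hz⟩
    rcases h.nonneg.eq_or_lt with h0 | h0
    · exact (hz h0.symm).le
    · have := hpos h0
      linarith
  have hα := hg.intercept_pos h.pos
  have hfirst : B S.tl ≤ (Q.g S.pl * (S.tl - S.tBegin) - intercept Q.g S.pl * ε)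
      + marginal Q.g S.pl * (U S.tl - Q.energyLeft S.tl)
      + intercept Q.g S.pl * ((T - S.tl) - (O T - O S.tl))
      - (intercept Q.g S.pl - intercept Q.g S.pl) * δ := by
    have k := hR.step S.pl h.pos 0 S.tl htl0
    rw [hR.bits_zero, hR.on_zero, hR.used_zero] at k
    rw [← hseg1.2.2.1, eq_tangent Q.g S.pl]
    linarith
  have hmid := hR.along_path hpath h.pos h.pos hspl (fun t ht => hD t (hle_tr t ht)) hfirst
    S.tr hlast.symm
  have hxl : S.p.getLastD S.pl ∈ S.pl :: S.p := List.getLastD_mem_cons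
  have hxl0 : 0 < S.p.getLastD S.pl :=
    h.powers_pos _ (by rw [← List.cons_append]; exact List.mem_append_left _ hxl)
  have k1 := mul_nonneg (sub_nonneg.2 (hg.marginal_le hxl0 (hpr _ hxl)))
    (sub_nonneg.2 (hR.energy S.tr))
  have k2 := mul_nonneg (sub_nonneg.2 (hg.intercept_le hxl0 (hpr _ hxl)))
    (sub_nonneg.2 (hD S.tr le_rfl))
  have k3 := hR.step S.pr hpr0 S.tr T htr.le
  have k4 := eq_tangent Q.g S.pr
  have k5 := hR.bits T hF.le
  have k6 := mul_nonneg (hg.marginal_pos hpr0).le (sub_nonneg.2 (hR.energy T))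
  have k7 := hseg3.2.2.1
  have hend : 0 ≤ -(intercept Q.g S.pl * ε)
      - (intercept Q.g S.pr - intercept Q.g S.pl) * δ := by
    rw [← k7] at k6
    rw [k4] at hbits
    linarith
  have hεα : 0 ≤ intercept Q.g S.pl * ε := mul_nonneg hα.le hε0.1
  rcases h.nonneg.eq_or_lt with hb0 | hb0
  · have := mul_pos hα (hε0.2 hb0.symm)
    have := mul_nonneg (sub_nonneg.2 (hg.intercept_le h.pos (hpr _ (by simp)))) hδ0.le
    linarith
  rcases (hpr S.pl (by simp)).lt_or_eq with hlt | hconst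
  · have := mul_pos (sub_pos.2 (hg.intercept_lt h.pos hlt)) hδ0
    linarith
  -- constant power
  have hall : ∀ x ∈ S.pl :: (S.p ++ [S.pr]), x = S.pl := by
    intro x hx
    rw [← List.cons_append] at hx
    rcases List.mem_append.1 hx with hx | hx
    · refine le_antisymm (hconst ▸ hpr x hx) ?_
      rcases List.mem_cons.1 hx with rfl | hx
      · exact le_rfl
      · exact (List.pairwise_cons.1 hspl).1 x hx
    · simp at hx; rw [hx, hconst]
  have hEq := h.path.level_of_const hall (List.mem_append_left [S.tEnd] h.q_mem)
  have hET := h.path.level_of_const hall (t := S.tEnd) (by simp)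
  have hB0 : Q.B₀ = Q.g S.pl * Q.Γ₀ := by
    rw [← h.bits, total_replicate Q.g S.pl _ _ _ h.length_eq hall, List.getLastD_concat,
      hpos hb0]
  have hq := hle_tr (Q.τ Q.q) (hs ▸ h.q_mem)
  set P := S.pl with hP
  have hP0 : 0 < P := h.pos
  set l := T - Q.τ Q.q with hl
  have hl0 : 0 < l := by linarith
  set o := O T - O (Q.τ Q.q) with ho
  have hol : o < l := by
    have h1 := hR.on_sub_le (Q.τ Q.q) T (by linarith)
    rw [min_eq_left hF.le] at h1
    rcases min_cases F (Q.τ Q.q) with h2 | h2 <;> linarith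
  -- a power slightly above `P`, with which the rival would still be too slow
  set m := max o (l / 2) with hm
  have hm0 : 0 < m := lt_of_lt_of_le (by linarith) (le_max_right _ _)
  have hml : m < l := max_lt hol (by linarith)
  have hP' : P < P * l / m := by
    rw [lt_div_iff₀ hm0]
    exact mul_lt_mul_of_pos_left hml hP0
  set P' := P * l / m with hPd
  have hP'0 : 0 < P' := hP0.trans hP'
  have j1 := hR.step P hP0 0 (Q.τ Q.q) (Q.τ_nonneg _)
  rw [hR.bits_zero, hR.on_zero, hR.used_zero] at j1
  have j2 := hR.step P' hP'0 (Q.τ Q.q) T (by linarith)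
  have j3 := mul_nonneg (sub_nonneg.2 (hg.marginal_le hP0 hP'.le))
    (sub_nonneg.2 (hR.energy (Q.τ Q.q)))
  have j4 := mul_nonneg (hg.marginal_pos hP'0).le (sub_nonneg.2 (hR.energy T))
  have j5 := mul_nonneg (hg.intercept_pos hP0).le (sub_nonneg.2 hOT)
  have j6 := eq_tangent Q.g P
  have j7 := hg.lt_tangent hP0 hP'0.le hP'.ne'
  rw [eq_tangent Q.g P'] at j7
  have hm1 := hg.marginal_lt hP0 hP'
  have hi1 := hg.intercept_lt hP0 hP'
  have hcontra : 0 ≤ (intercept Q.g P' - intercept Q.g P) * o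
      - (marginal Q.g P - marginal Q.g P') * (P * l) := by
    rw [hEq] at j3
    rw [hET] at j4
    have e1 : P * l = P * (T - S.tBegin) - P * (Q.τ Q.q - S.tBegin) := by rw [hl]; ring
    rw [hB0, j6] at k5
    have e2 := hpos hb0
    have e3 : marginal Q.g P * P * Q.Γ₀ = marginal Q.g P * (P * (T - S.tBegin)) := by
      rw [e2]; ring
    rw [e1]
    simp only [ho]
    linarith
  have hPl : 0 < P * l := mul_pos hP0 hl0
  rcases le_or_gt o 0 with ho0 | ho0
  · have := mul_pos (sub_pos.2 hm1) hPl
    have := mul_nonneg (sub_nonneg.2 hi1.le) (neg_nonneg.2 ho0)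
    linarith
  · have e1 : P' * o ≤ P * l := by
      have : P * l = P' * m := by rw [hPd, div_mul_cancel₀ _ hm0.ne']
      rw [this]
      exact mul_le_mul_of_nonneg_left (le_max_left _ _) hP'0.le
    have e2 := mul_le_mul_of_nonneg_left e1 (sub_pos.2 hm1).le
    have e3 : (intercept Q.g P' - intercept Q.g P) * o
        < (marginal Q.g P - marginal Q.g P') * P' * o :=
      mul_lt_mul_of_pos_right (by linarith) ho0
    linarith

theorem Valid.isOptimal {S : State} (h : Q.Valid (· ≤ ·) S)
    (hpos : 0 < S.tBegin → S.tEnd - S.tBegin = Q.Γ₀) (hd : S.tEnd - S.tBegin ≤ Q.Γ₀) :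
    Q.IsOptimal S.policy := by
  refine ⟨h.feasible hd, fun Y hY => ?_⟩
  obtain ⟨B, U, O, hR⟩ := hY.exists_rival
  rw [h.finish_eq]
  exact h.le_finish hpos hR

theorem Valid.sufficientConditions {S : State} (h : Q.Valid (· ≤ ·) S)
    (hpos : 0 < S.tBegin → S.tEnd - S.tBegin = Q.Γ₀) (hd : S.tEnd - S.tBegin ≤ Q.Γ₀) :
    Q.SufficientConditions S.policy := by
  have hlen := h.length_eq
  have hN : S.policy.N = S.p.length + 2 := by simp [State.policy, Policy.N]
  have hsl : S.s.length = S.p.length + 1 := by simpa using hlen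
  have htime : ∀ i, 2 ≤ i → i ≤ S.policy.N + 1 → S.policy.time i ∈ S.s ++ [S.tEnd] := by
    intro i h2 hi
    obtain ⟨k, rfl⟩ := Nat.exists_eq_add_of_le h2
    rw [hN] at hi
    have hk : k < (S.s ++ [S.tEnd]).length := by simp; omega
    have : S.policy.time (2 + k) = (S.s ++ [S.tEnd])[k] := by
      rw [State.policy_eq, Policy.time, show 2 + k - 1 = k + 1 by omega, List.getD_cons_succ,
        List.getD_eq_getElem _ _ hk]
    rw [this]
    exact List.getElem_mem hk
  constructor
  · rw [State.policy_eq, Policy.totalBits_eq _ _ _ _ hlen, h.bits]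
  · intro i j hi hij hj
    rcases hij.eq_or_lt with rfl | hij
    · exact le_rfl
    rw [hN] at hj
    have hj' : j - 1 < (S.pl :: (S.p ++ [S.pr])).length := by simp; omega
    have hi' : i - 1 < (S.pl :: (S.p ++ [S.pr])).length := by omega
    rw [State.policy_eq, Policy.pow, Policy.pow, List.getD_eq_getElem _ _ hi',
      List.getD_eq_getElem _ _ hj']
    exact List.pairwise_iff_getElem.1 h.sorted _ _ hi' hj' (by omega)
  · intro i h2 hi
    obtain ⟨k, rfl⟩ := Nat.exists_eq_add_of_le h2
    rw [hN] at hi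
    have hk : k < S.s.length := by omega
    have : S.policy.time (2 + k) = S.s[k] := by
      rw [State.policy_eq, Policy.time, show 2 + k - 1 = k + 1 by omega, List.getD_cons_succ,
        List.getD_append _ _ _ _ hk, List.getD_eq_getElem _ _ hk]
    rw [this]
    exact h.epochs _ (List.getElem_mem hk)
  · intro i h2 hi
    rw [← h.path.level (htime i h2 hi), zero_add, State.policy_eq, Policy.used_eq _ _ _ hlen]
  · intro h0
    rw [h.finish_eq]
    exact hpos h0
  · intro h0
    rw [h.finish_eq]
    have : S.tBegin = 0 := h0
    linarith
  · obtain ⟨k, hk, he⟩ := List.getElem_of_mem h.q_mem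
    refine ⟨k + 2, by omega, by rw [hN]; omega, ?_⟩
    rw [State.policy_eq, Policy.time, show k + 2 - 1 = k + 1 by omega, List.getD_cons_succ,
        List.getD_append _ _ _ _ hk, List.getD_eq_getElem _ _ hk, he]

end Problem

/-! ### One iteration of PULL_BACK -/

theorem solve_spec {P : ℝ → Prop} (h : ∃ x, P x) : P (solve P) := Classical.epsilon_spec h

theorem total_append (c : ℝ → ℝ) (s₂ p₂ : List ℝ) (s₁ : List ℝ) : ∀ (a : ℝ) (p₁ : List ℝ),
    s₁.length = p₁.length →
      total c a (p₁ ++ p₂) (s₁ ++ s₂) = total c a p₁ s₁ + total c (s₁.getLastD a) p₂ s₂ := by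
  induction s₁ with
  | nil =>
    intro a p₁ h
    have : p₁ = [] := List.length_eq_zero_iff.1 h.symm
    simp [this]
  | cons b s₁ ih =>
    intro a p₁ h
    cases p₁ with
    | nil => simp at h
    | cons x p₁ =>
      rw [List.cons_append, List.cons_append, total_cons, total_cons, ih b p₁ (by simpa using h),
        List.getLastD_cons, add_assoc]

theorem getLastD_append_eq (s₂ : List ℝ) (s₁ : List ℝ) : ∀ a : ℝ,
    (s₁ ++ s₂).getLastD a = s₂.getLastD (s₁.getLastD a) := by
  induction s₁ with
  | nil => intro a; rfl
  | cons b s₁ ih => intro a; rw [List.cons_append, List.getLastD_cons, List.getLastD_cons, ih]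

/-- Jensen's inequality, in the form of a tangent line, for the bits sent by a policy. -/
theorem total_le_tangent {g : ℝ → ℝ} (hg : IsRate g) {P : ℝ} (hP : 0 < P) (s : List ℝ) :
    ∀ (a : ℝ) (p : List ℝ), s.length = p.length → (a :: s).Pairwise (· ≤ ·) → (∀ x ∈ p, 0 ≤ x) →
      total g a p s ≤ intercept g P * (s.getLastD a - a) + marginal g P * total id a p s := by
  induction s with
  | nil =>
    intro a p h _ _
    have : p = [] := List.length_eq_zero_iff.1 h.symm
    simp [this]
  | cons b s ih =>
    intro a p h hs hp
    cases p with
    | nil => simp at h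
    | cons x p =>
      have hab : a ≤ b := (List.pairwise_cons.1 hs).1 b (by simp)
      have := ih b p (by simpa using h) (List.pairwise_cons.1 hs).2 fun y hy => hp y (by simp [hy])
      rw [total_cons, total_cons, List.getLastD_cons, id]
      have := mul_le_mul_of_nonneg_right (hg.le_tangent hP (hp x (by simp))) (sub_nonneg.2 hab)
      linarith

namespace Problem

variable {Q : Problem}

theorem path_append {r : ℝ → ℝ → Prop} {s₂ p₂ : List ℝ} {s₁ : List ℝ} :
    ∀ {a : ℝ} {p₁ : List ℝ}, s₁.length = p₁.length →
      (Q.Path r a (Q.energyLeft a) (s₁ ++ s₂) (p₁ ++ p₂) ↔ Q.Path r a (Q.energyLeft a) s₁ p₁ ∧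
        Q.Path r (s₁.getLastD a) (Q.energyLeft (s₁.getLastD a)) s₂ p₂) := by
  induction s₁ with
  | nil =>
    intro a p₁ h
    have : p₁ = [] := List.length_eq_zero_iff.1 h.symm
    simp [this]
  | cons b s₁ ih =>
    intro a p₁ h
    cases p₁ with
    | nil => simp at h
    | cons x p₁ =>
      rw [List.cons_append, List.cons_append, path_cons, path_cons, ih (by simpa using h),
        List.getLastD_cons, and_assoc]

/-- A valid state is assembled from a constant power `x` before the epoch `c`, with the touching
epochs `K`, and a path from `c` on. -/
theorem Valid.of_left {r : ℝ → ℝ → Prop} {S : State} {K s p : List ℝ} {c x : ℝ}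
    (hs : S.s = K ++ c :: s) (hp : S.p = List.replicate K.length x ++ p) (hpl : S.pl = x)
    (htl : S.tl = K.headD c) (htr : S.tr = s.getLastD c) (h0 : 0 ≤ S.tBegin) (hx : 0 < x)
    (hleft : Q.Path r S.tBegin 0 (K ++ [c]) (List.replicate (K.length + 1) x))
    (hright : Q.Path r c (Q.energyLeft c) (s ++ [S.tEnd]) (p ++ [S.pr]))
    (hsorted : (p ++ [S.pr]).Pairwise (· ≤ ·)) (hxp : ∀ y ∈ p ++ [S.pr], x ≤ y)
    (hK : ∀ t ∈ K, ∃ j, t = Q.τ j) (hcs : ∀ t ∈ c :: s, ∃ j, t = Q.τ j)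
    (hq : Q.τ Q.q ∈ c :: s)
    (hbits : Q.g x * (c - S.tBegin) + total Q.g c (p ++ [S.pr]) (s ++ [S.tEnd]) = Q.B₀) :
    Q.Valid r S := by
  have e1 : S.pl :: (S.p ++ [S.pr]) = List.replicate (K.length + 1) x ++ (p ++ [S.pr]) := by
    rw [hpl, hp, List.replicate_succ, List.cons_append, List.append_assoc]
  have e2 : S.s ++ [S.tEnd] = K ++ c :: (s ++ [S.tEnd]) := by
    rw [hs, List.append_assoc, List.cons_append]
  refine ⟨h0, ?_, ?_, ?_, by rwa [hpl], ?_, ?_, ?_, ?_⟩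
  · cases K with
    | nil => exact ⟨s, by rw [hs, htl]; rfl⟩
    | cons k K => exact ⟨K ++ c :: s, by rw [hs, htl]; rfl⟩
  · rcases List.eq_nil_or_concat s with rfl | ⟨s', b, hc⟩
    · exact ⟨K, by rw [hs, htr]; rfl⟩
    · rw [List.concat_eq_append] at hc
      subst hc
      exact ⟨K ++ c :: s', by rw [hs, htr, List.getLastD_concat]; simp⟩
  · rw [e1, e2, path_append_cons (by simp)]
    exact ⟨hleft, hright⟩
  · rw [e1, List.pairwise_append]
    refine ⟨List.pairwise_replicate.2 (Or.inr le_rfl), hsorted, fun y hy z hz => ?_⟩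
    rw [List.eq_of_mem_replicate hy]
    exact hxp z hz
  · intro t ht
    rw [hs] at ht
    rcases List.mem_append.1 ht with ht | ht
    · exact hK t ht
    · exact hcs t ht
  · rw [hs]
    exact List.mem_append_right _ hq
  · rw [e1, e2, total_append_cons _ _ _ _ _ _ _ (by simp),
      total_replicate Q.g x _ _ _ (by simp) fun y hy => List.eq_of_mem_replicate hy,
      List.getLastD_concat, hbits]

variable (Q)

theorem mem_rightArrivals {S : State} {i : ℕ} :
    i ∈ Q.rightArrivals S ↔ S.tr < Q.τ i ∧ Q.τ i < S.tEnd := by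
  simp [rightArrivals, mem_before, and_comm]

theorem mem_leftArrivals {S : State} {i : ℕ} :
    i ∈ Q.leftArrivals S ↔
      Q.τ i < S.tl ∧ ((∃ x, Q.IsLeftPower S x) → max (Q.leftStart S) (Q.τ 0) ≤ Q.τ i) := by
  simp only [leftArrivals, Finset.mem_filter, mem_before]

end Problem

theorem exists_min_image {A : Finset ℕ} (hA : A.Nonempty) (f : ℕ → ℝ) :
    (∃ i ∈ A, f i = sInf (f '' (A : Set ℕ))) ∧ ∀ i ∈ A, sInf (f '' (A : Set ℕ)) ≤ f i := by
  have hfin : (f '' (A : Set ℕ)).Finite := A.finite_toSet.image f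
  obtain ⟨i, hi, he⟩ := Set.Nonempty.csInf_mem (Set.Nonempty.image f hA) hfin
  exact ⟨⟨i, hi, he⟩, fun i hi => csInf_le hfin.bddBelow ⟨i, hi, rfl⟩⟩

theorem exists_max_image {A : Finset ℕ} (hA : A.Nonempty) (f : ℕ → ℝ) :
    (∃ i ∈ A, f i = sSup (f '' (A : Set ℕ))) ∧ ∀ i ∈ A, f i ≤ sSup (f '' (A : Set ℕ)) := by
  have hfin : (f '' (A : Set ℕ)).Finite := A.finite_toSet.image f
  obtain ⟨i, hi, he⟩ := Set.Nonempty.csSup_mem (Set.Nonempty.image f hA) hfin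
  exact ⟨⟨i, hi, he⟩, fun i hi => le_csSup hfin.bddAbove ⟨i, hi, rfl⟩⟩

namespace Problem

variable (Q : Problem)

open Classical in
/-- The shortest time in which the energy after `τ_r` can be spent feasibly: down to zero, if no
arrival follows `τ_r`, and otherwise by the power that touches the next epoch. -/
noncomputable def minRightTime (S : State) : ℝ :=
  if Q.rightArrivals S = ∅ then 0 else Q.rightEnergy S / Q.rightPower S

/-- How the policy before an iteration of PULL_BACK relates to the start and finish times after it:
the energies before `τ_l` and after `τ_r` can be spent at constant powers within the new times,
these powers are energy-feasible, and they send the same number of bits. -/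
structure Step (S S' : State) : Prop where
  begin_nonneg : 0 ≤ S'.tBegin
  begin_lt : S'.tBegin < S.tBegin
  le_end : S.tr ≤ S'.tEnd
  end_lt : S'.tEnd < S.tEnd
  left : ∀ i, Q.τ i < S.tl →
    Q.energyLeft S.tl * (Q.τ i - S'.tBegin) ≤ Q.energyLeft (Q.τ i) * (S.tl - S'.tBegin)
  right : ∀ i, S.tr < Q.τ i → Q.τ i < S.tEnd →
    Q.rightEnergy S * (Q.τ i - S.tr)
      ≤ (Q.energyLeft (Q.τ i) - Q.energyLeft S.tr) * (S'.tEnd - S.tr)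
  bits : sent Q.g (Q.energyLeft S.tl) (S.tl - S'.tBegin)
    + sent Q.g (Q.rightEnergy S) (S'.tEnd - S.tr) = Q.outerBits S

variable {Q}

/-- Basic facts about a valid state that starts after time `0`. -/
theorem Valid.basic {r : ℝ → ℝ → Prop} {S : State} (h : Q.Valid r S) (h0 : 0 < S.tBegin) :
    S.tBegin < S.tl ∧ S.tl ≤ S.tr ∧ S.tr < S.tEnd ∧ 0 < Q.energyLeft S.tl ∧ 0 < Q.rightEnergy S ∧
      S.pl * (S.tl - S.tBegin) = Q.energyLeft S.tl ∧ S.pr * (S.tEnd - S.tr) = Q.rightEnergy S ∧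
      S.pl ≤ S.pr ∧ Q.outerBits S = sent Q.g (Q.energyLeft S.tl) (S.tl - S.tBegin)
        + sent Q.g (Q.rightEnergy S) (S.tEnd - S.tr) := by
  obtain ⟨s, hs, hlast, h1, h2, h3, -⟩ := h.parts
  have htl : S.tBegin < S.tl := h1.2.1.resolve_left h0.ne'
  have hlr : S.tl ≤ S.tr := hlast ▸ h2.pairwise.le_getLastD _ (by simp)
  have htr : S.tr < S.tEnd := h3.2.1.resolve_left (h0.trans (htl.trans_le hlr)).ne'
  have e1 : S.pl * (S.tl - S.tBegin) = Q.energyLeft S.tl := by rw [← h1.2.2.1, zero_add]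
  have e2 : S.pr * (S.tEnd - S.tr) = Q.rightEnergy S := by
    rw [rightEnergy, ← h3.2.2.1]; ring
  have hpr : S.pl ≤ S.pr := (List.pairwise_cons.1 h.sorted).1 _ (by simp)
  refine ⟨htl, hlr, htr, Q.energyLeft_pos (h0.trans htl), ?_, e1, e2, hpr, ?_⟩
  · rw [← e2]
    exact mul_pos (h.pos.trans_le hpr) (by linarith)
  · rw [sent, sent, ← e1, ← e2, mul_div_cancel_right₀ _ (by linarith),
      mul_div_cancel_right₀ _ (by linarith), outerBits]
    ring

/-- The transmission time increases in an iteration. -/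
theorem Step.duration_lt {S S' : State} (hs : Q.Step S S') (h : Q.Valid (· < ·) S)
    (h0 : 0 < S.tBegin) : S.tEnd - S.tBegin < S'.tEnd - S'.tBegin := by
  obtain ⟨h1, h2, h3, h4, h5, h6, h7, h8, h9⟩ := h.basic h0
  have := Q.rate.time_lt_of_spread (a := S.tl - S.tBegin) (b := S.tEnd - S.tr)
    (a' := S.tl - S'.tBegin) (b' := S'.tEnd - S.tr) h4 h5 (by linarith) (by linarith)
    (by rwa [← h6, ← h7, mul_div_cancel_right₀ _ (by linarith),
      mul_div_cancel_right₀ _ (by linarith)])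
    (by linarith [hs.begin_lt]) (by linarith [hs.le_end]) (by linarith [hs.end_lt])
    (by rw [hs.bits, h9])
  linarith

/-- Spending the energy after `τ_r` in less time, but still feasibly, includes all the arrivals
before `T_stop`. -/
theorem energyLeft_of_right {S : State} {b : ℝ} (hb : 0 < b) (hle : S.tr + b ≤ S.tEnd)
    (hright : ∀ i, S.tr < Q.τ i → Q.τ i < S.tEnd →
      Q.rightEnergy S * (Q.τ i - S.tr) ≤ (Q.energyLeft (Q.τ i) - Q.energyLeft S.tr) * b) :
    Q.energyLeft (S.tr + b) = Q.energyLeft S.tEnd := by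
  refine (Q.energyLeft_eq hle fun i hi => ?_).symm
  by_contra! hc
  have h1 := hright i (by linarith) hc
  have h2 : Q.energyLeft (Q.τ i) - Q.energyLeft S.tr < Q.rightEnergy S := by
    have := Q.energyLeft_lt le_rfl hc
    unfold rightEnergy
    linarith
  have h3 := Q.energyLeft_mono (a := S.tr) (b := Q.τ i) (by linarith)
  nlinarith

theorem Valid.rightPower_spec {S : State} (h : Q.Valid (· < ·) S)
    (hA : Q.rightArrivals S ≠ ∅) :
    S.pr < Q.rightPower S ∧ ∀ i, S.tr < Q.τ i → Q.τ i < S.tEnd →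
      Q.rightPower S ≤ Q.chord S.tr (Q.τ i) := by
  obtain ⟨s, hs, hlast, h1, h2, h3, -⟩ := h.parts
  obtain ⟨⟨i, hi, he⟩, hmin⟩ := exists_min_image (Finset.nonempty_iff_ne_empty.2 hA)
    fun i => Q.chord S.tr (Q.τ i)
  constructor
  · rw [rightPower, ← he]
    obtain ⟨k1, k2⟩ := Q.mem_rightArrivals.1 hi
    have := h3.2.2.2 i k1 k2
    rw [chord, lt_div_iff₀ (by linarith)]
    linarith
  · intro i hi1 hi2
    exact hmin i (Q.mem_rightArrivals.2 ⟨hi1, hi2⟩)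

theorem Valid.minRightTime_spec {S : State} (h : Q.Valid (· < ·) S) (h0 : 0 < S.tBegin) :
    0 ≤ Q.minRightTime S ∧ Q.minRightTime S < S.tEnd - S.tr ∧
      (∀ i, S.tr < Q.τ i → Q.τ i < S.tEnd → Q.rightEnergy S * (Q.τ i - S.tr)
        ≤ (Q.energyLeft (Q.τ i) - Q.energyLeft S.tr) * Q.minRightTime S) ∧
      Q.leftBits S = Q.outerBits S - sent Q.g (Q.rightEnergy S) (Q.minRightTime S) := by
  obtain ⟨h1, h2, h3, h4, h5, h6, h7, h8, h9⟩ := h.basic h0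
  unfold minRightTime leftBits
  split_ifs with hA
  · refine ⟨le_rfl, by linarith, fun i hi1 hi2 => ?_, by simp [sent]⟩
    exact absurd (Q.mem_rightArrivals.2 ⟨hi1, hi2⟩) (by simp [hA])
  · obtain ⟨k1, k2⟩ := h.rightPower_spec hA
    have hpr : 0 < S.pr := h.pos.trans_le h8
    have hrp : 0 < Q.rightPower S := hpr.trans k1
    refine ⟨(div_pos h5 hrp).le, ?_, fun i hi1 hi2 => ?_, ?_⟩
    · rw [div_lt_iff₀ hrp, ← h7]
      nlinarith
    · rw [← Q.chord_mul hi1, mul_div_assoc', le_div_iff₀ hrp]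
      have := mul_le_mul_of_nonneg_left (k2 i hi1 hi2)
        (mul_nonneg h5.le (sub_nonneg.2 hi1.le))
      linarith
    · rw [sent, div_div_cancel₀ h5.ne', mul_comm (Q.g _)]

theorem isLeftPower_iff {S : State} (hE : 0 < Q.energyLeft S.tl) {x : ℝ} :
    Q.IsLeftPower S x ↔ 0 < x ∧ x < S.pl ∧
      sent Q.g (Q.energyLeft S.tl) (Q.energyLeft S.tl / x) = Q.leftBits S := by
  rw [IsLeftPower, sent, div_div_cancel₀ hE.ne']

/-- A straight line from time `t_l - E / x`, for the energy `E` harvested before `t_l`. -/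
theorem segment_of_line {t x : ℝ} (hE : 0 < Q.energyLeft t) (hx : 0 < x)
    (hle : ∀ i, t - Q.energyLeft t / x < Q.τ i → Q.τ i < t →
      x * (Q.τ i - (t - Q.energyLeft t / x)) ≤ Q.energyLeft (Q.τ i)) :
    Q.Path (· ≤ ·) (t - Q.energyLeft t / x) 0 [t] [x] := by
  have h1 := div_pos hE hx
  rw [path_cons, path_nil]
  refine ⟨⟨by linarith, Or.inr (by linarith), ?_, fun i hi hit => ?_⟩, rfl⟩
  · rw [zero_add, sub_sub_cancel, mul_div_cancel₀ _ hx.ne']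
  · rw [zero_add]; exact hle i hi hit

theorem EnergyFeasible.line_le {σ t x : ℝ} (h : Q.EnergyFeasible ⟨[x], [σ, t]⟩) :
    0 ≤ σ ∧ ∀ i, σ < Q.τ i → Q.τ i < t → x * (Q.τ i - σ) ≤ Q.energyLeft (Q.τ i) := by
  refine ⟨h.1.2.2.1, fun i hi hit => ?_⟩
  have := h.flow_le (Q.τ i)
  simpa [flow_cons, min_eq_right hit.le, min_eq_left hi.le] using this

/-- The new data of PULL_BACK on the left: the power `x` before `τ_l` starts at a time `≥ 0`, is
lower than before and energy-feasible, and leaves not more bits to the right part than it can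
send. -/
structure LeftChange (Q : Problem) (S : State) (x : ℝ) : Prop where
  pos : 0 < x
  lt : x < S.pl
  nonneg : 0 ≤ S.tl - Q.energyLeft S.tl / x
  line : ∀ i, S.tl - Q.energyLeft S.tl / x < Q.τ i → Q.τ i < S.tl →
    x * (Q.τ i - (S.tl - Q.energyLeft S.tl / x)) ≤ Q.energyLeft (Q.τ i)

theorem LeftChange.begin_lt {S : State} {x : ℝ} (hx : LeftChange Q S x) (h : Q.Valid (· < ·) S)
    (h0 : 0 < S.tBegin) : S.tl - Q.energyLeft S.tl / x < S.tBegin := by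
  obtain ⟨h1, h2, h3, h4, h5, h6, -⟩ := h.basic h0
  have : S.tl - S.tBegin < Q.energyLeft S.tl / x := by
    rw [lt_div_iff₀ hx.pos, ← h6]
    have := mul_lt_mul_of_pos_left hx.lt (sub_pos.2 h1)
    linarith
  linarith

theorem LeftChange.step {S S' : State} {x b : ℝ} (hx : LeftChange Q S x) (h : Q.Valid (· < ·) S)
    (h0 : 0 < S.tBegin) (hB : S'.tBegin = S.tl - Q.energyLeft S.tl / x) (hT : S'.tEnd = S.tr + b)
    (hb : Q.minRightTime S ≤ b) (hb' : b < S.tEnd - S.tr)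
    (hbits : sent Q.g (Q.energyLeft S.tl) (Q.energyLeft S.tl / x)
      + sent Q.g (Q.rightEnergy S) b = Q.outerBits S) : Q.Step S S' := by
  obtain ⟨h1, h2, h3, h4, h5, h6, h7, h8, h9⟩ := h.basic h0
  obtain ⟨m1, m2, m3, m4⟩ := h.minRightTime_spec h0
  have hdiv := div_pos h4 hx.pos
  refine ⟨hB ▸ hx.nonneg, hB ▸ hx.begin_lt h h0, by linarith, by linarith, fun i hi => ?_,
    fun i hi1 hi2 => ?_, ?_⟩
  · rw [hB, sub_sub_cancel]
    rcases le_or_gt (Q.τ i) (S.tl - Q.energyLeft S.tl / x) with hc | hc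
    · have := mul_nonneg (Q.energyLeft_nonneg (Q.τ i)) hdiv.le
      nlinarith
    · rw [mul_div_assoc', le_div_iff₀ hx.pos]
      have := mul_le_mul_of_nonneg_left (hx.line i hc hi) h4.le
      linarith
  · rw [hT, add_sub_cancel_left]
    refine (m3 i hi1 hi2).trans (mul_le_mul_of_nonneg_left hb ?_)
    exact sub_nonneg.2 (Q.energyLeft_mono hi1.le)
  · rw [hB, hT, sub_sub_cancel, add_sub_cancel_left, hbits]

theorem Accepts.leftChange {S : State} (h : Q.Accepts S) :
    LeftChange Q S (Q.leftPower S) := by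
  obtain ⟨hex, hf⟩ := h
  have hx : Q.IsLeftPower S (Q.leftPower S) := solve_spec hex
  have := hf.line_le
  exact ⟨hx.1, hx.2.1, this.1, this.2⟩

/-- The smallest feasible power before `τ_l` exists; it is lower than the current power, but higher
than `p̃`, so that the part before `τ_l` sends less bits than with `p̃`. -/
theorem Valid.minLeftPower_spec {S : State} (h : Q.Valid (· < ·) S) (h0 : 0 < S.tBegin)
    (hrej : ¬ Q.Accepts S) :
    LeftChange Q S (Q.minLeftPower S) ∧
      (∃ i ∈ Q.leftArrivals S, Q.chord (Q.τ i) S.tl = Q.minLeftPower S) ∧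
      (∀ i, Q.τ i < S.tl → S.tl - Q.energyLeft S.tl / Q.minLeftPower S ≤ Q.τ i →
        i ∈ Q.leftArrivals S ∧ Q.chord (Q.τ i) S.tl ≤ Q.minLeftPower S) ∧
      sent Q.g (Q.energyLeft S.tl) (Q.energyLeft S.tl / Q.minLeftPower S) < Q.leftBits S := by
  obtain ⟨h1, h2, h3, h4, h5, h6, h7, h8, h9⟩ := h.basic h0
  obtain ⟨m1, m2, m3, m4⟩ := h.minRightTime_spec h0
  have htl0 : 0 < S.tl := h0.trans h1
  -- the left power, if it exists, is below one of the chords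
  have hviol : (∃ x, Q.IsLeftPower S x) → ∃ i ∈ Q.leftArrivals S,
      Q.leftPower S < Q.chord (Q.τ i) S.tl := by
    intro hex
    have hx : Q.IsLeftPower S (Q.leftPower S) := solve_spec hex
    have hlen : Q.leftPower S * (S.tl - Q.leftStart S) = Q.energyLeft S.tl := by
      rw [leftStart, sub_sub_cancel, mul_div_cancel₀ _ hx.1.ne']
    rcases lt_or_ge (Q.leftStart S) 0 with hneg | hpos
    · refine ⟨0, Q.mem_leftArrivals.2 ⟨by rwa [Q.τ_zero], fun _ => ?_⟩, ?_⟩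
      · rw [Q.τ_zero]; exact max_le hneg.le le_rfl
      · rw [Q.τ_zero, chord, Q.energyLeft_of_nonpos le_rfl, lt_div_iff₀ (by linarith), ← hlen]
        have := hx.1
        nlinarith
    · by_contra! hno
      refine hrej ⟨hex, ?_⟩
      refine (segment_of_line h4 hx.1 fun i hi hit => ?_).energyFeasible hpos
        (by simp [hx.1.le])
      have := hno i (Q.mem_leftArrivals.2 ⟨hit, fun _ => max_le hi.le (Q.τ_le.2 (Nat.zero_le i))⟩)
      rw [chord, div_le_iff₀ (by linarith), ← hlen] at this
      unfold leftStart at this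
      linarith
  have hzero : ¬ (∃ x, Q.IsLeftPower S x) → 0 ∈ Q.leftArrivals S := fun hex =>
    Q.mem_leftArrivals.2 ⟨by rwa [Q.τ_zero], fun hc => absurd hc hex⟩
  have hne : (Q.leftArrivals S).Nonempty := by
    by_cases hex : ∃ x, Q.IsLeftPower S x
    · obtain ⟨i, hi, -⟩ := hviol hex
      exact ⟨i, hi⟩
    · exact ⟨0, hzero hex⟩
  obtain ⟨⟨i₀, hi₀, he⟩, hmax⟩ := exists_max_image hne fun i => Q.chord (Q.τ i) S.tl
  change Q.chord (Q.τ i₀) S.tl = Q.minLeftPower S at he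
  change ∀ i ∈ Q.leftArrivals S, Q.chord (Q.τ i) S.tl ≤ Q.minLeftPower S at hmax
  set x := Q.minLeftPower S with hxd
  have hi₀t := (Q.mem_leftArrivals.1 hi₀).1
  have hx0 : 0 < x := by
    rw [← he, chord]
    exact div_pos (sub_pos.2 (Q.energyLeft_lt le_rfl hi₀t)) (by linarith)
  have hxlt : x < S.pl := by
    rw [← he, chord, div_lt_iff₀ (by linarith)]
    rcases lt_trichotomy (Q.τ i₀) S.tBegin with hc | hc | hc
    · have := Q.energyLeft_nonneg (Q.τ i₀)
      have := mul_lt_mul_of_pos_left hc h.pos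
      linarith
    · rw [hc, h6]
      have := Q.energyLeft_pos h0
      linarith
    · obtain ⟨s, -, -, hseg, -⟩ := h.parts
      have := hseg.2.2.2 i₀ hc hi₀t
      linarith
  have hdiv := div_pos h4 hx0
  have hlt : (∃ x, Q.IsLeftPower S x) → Q.leftStart S < S.tl - Q.energyLeft S.tl / x := by
    intro hex
    obtain ⟨i, hi, hlt⟩ := hviol hex
    have hp : 0 < Q.leftPower S := (solve_spec hex : Q.IsLeftPower S (Q.leftPower S)).1
    have := div_lt_div_of_pos_left h4 hp (hlt.trans_le (hmax i hi))
    unfold leftStart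
    linarith
  have hmem : ∀ i, Q.τ i < S.tl → S.tl - Q.energyLeft S.tl / x ≤ Q.τ i →
      i ∈ Q.leftArrivals S ∧ Q.chord (Q.τ i) S.tl ≤ x := by
    intro i hi hxi
    have : i ∈ Q.leftArrivals S := Q.mem_leftArrivals.2 ⟨hi, fun hex =>
      max_le ((hlt hex).le.trans hxi) (Q.τ_le.2 (Nat.zero_le i))⟩
    exact ⟨this, hmax i this⟩
  refine ⟨⟨hx0, hxlt, ?_, fun i hi hit => ?_⟩, ⟨i₀, hi₀, he⟩, hmem, ?_⟩
  · have hz : 0 ∈ Q.leftArrivals S → 0 ≤ S.tl - Q.energyLeft S.tl / x := by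
      intro hz
      have := hmax 0 hz
      rw [Q.τ_zero, chord, Q.energyLeft_of_nonpos le_rfl, sub_zero, sub_zero,
        div_le_iff₀ htl0] at this
      have : Q.energyLeft S.tl / x ≤ S.tl := by
        rw [div_le_iff₀ hx0]; linarith
      linarith
    by_cases hex : ∃ x, Q.IsLeftPower S x
    · rcases lt_or_ge (Q.leftStart S) 0 with hneg | hpos
      · refine hz (Q.mem_leftArrivals.2 ⟨by rwa [Q.τ_zero], fun _ => ?_⟩)
        rw [Q.τ_zero]; exact max_le hneg.le le_rfl
      · exact hpos.trans (hlt hex).le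
    · exact hz (hzero hex)
  · have := (hmem i hit hi.le).2
    rw [chord, div_le_iff₀ (by linarith)] at this
    have e : x * (Q.energyLeft S.tl / x) = Q.energyLeft S.tl := mul_div_cancel₀ _ hx0.ne'
    linarith
  · by_cases hex : ∃ x, Q.IsLeftPower S x
    · obtain ⟨i, hi, hlt'⟩ := hviol hex
      obtain ⟨hp, -, hb⟩ :=
        (isLeftPower_iff h4).1 (solve_spec hex : Q.IsLeftPower S (Q.leftPower S))
      rw [← hb]
      exact Q.rate.sent_lt_of_time_lt h4 hdiv
        (div_lt_div_of_pos_left h4 hp (hlt'.trans_le (hmax i hi)))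
    · by_contra! hc
      have ha : 0 < S.tl - S.tBegin := by linarith
      have hlb : sent Q.g (Q.energyLeft S.tl) (S.tl - S.tBegin) < Q.leftBits S := by
        rw [m4, h9]
        have : sent Q.g (Q.rightEnergy S) (Q.minRightTime S)
            < sent Q.g (Q.rightEnergy S) (S.tEnd - S.tr) := by
          rcases m1.eq_or_lt with hz | hz
          · rw [← hz, sent, zero_mul]
            exact Q.rate.sent_pos h5 (by linarith)
          · exact Q.rate.sent_lt_of_time_lt h5 hz m2
        linarith
      obtain ⟨T, hT0, hTle, hTs⟩ := Q.rate.exists_time h4 hdiv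
        ((Q.rate.sent_pos h4 ha).trans hlb) hc
      have haT : S.tl - S.tBegin < T := by
        rw [← hTs] at hlb
        exact Q.rate.time_lt_of_sent_lt h4 hT0 hlb
      refine hex ⟨Q.energyLeft S.tl / T, (isLeftPower_iff h4).2 ⟨div_pos h4 hT0, ?_, ?_⟩⟩
      · rw [div_lt_iff₀ hT0, ← h6]
        exact mul_lt_mul_of_pos_left haT h.pos
      · rw [div_div_cancel₀ h4.ne', hTs]

end Problem

/-! ### Progress of PULL_BACK -/

namespace Problem

variable {Q : Problem}

theorem Path.total_id {r : ℝ → ℝ → Prop} {s : List ℝ} : ∀ {a u : ℝ} {p : List ℝ},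
    Q.Path r a u s p → u = Q.energyLeft a →
      total id a p s = Q.energyLeft (s.getLastD a) - Q.energyLeft a := by
  induction s with
  | nil => intro a u p h _; rw [path_nil.1 h]; simp
  | cons b s ih =>
    intro a u p h hu
    cases p with
    | nil => exact absurd h path_cons_nil
    | cons x p =>
      obtain ⟨h1, h2⟩ := path_cons.1 h
      have := h1.2.2.1
      rw [total_cons, ih h2 rfl, List.getLastD_cons, id]
      linarith

/-- `n` is the first arrival with which `B₀` bits can be sent in time `Γ₀`. -/
theorem sent_lt_of_le_n {k : ℕ} (hk : 0 < k) (hkn : k ≤ Q.n) :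
    sent Q.g (Q.energyLeft (Q.τ k)) Q.Γ₀ < Q.B₀ := by
  obtain ⟨j, rfl⟩ := Nat.exists_eq_succ_of_ne_zero hk.ne'
  have := Nat.notMem_of_lt_sInf (show j < sInf _ from hkn)
  rw [← Q.energy_eq_energyLeft_succ]
  exact not_le.1 this

theorem LeftChange.path {S : State} {x : ℝ} (hx : LeftChange Q S x)
    (hE : 0 < Q.energyLeft S.tl) (A : Finset ℕ)
    (hin : ∀ i ∈ A, S.tl - Q.energyLeft S.tl / x ≤ Q.τ i ∧ Q.τ i < S.tl ∧
      x * (Q.τ i - (S.tl - Q.energyLeft S.tl / x)) = Q.energyLeft (Q.τ i))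
    (hno : ∀ i, i ∉ A → S.tl - Q.energyLeft S.tl / x < Q.τ i → Q.τ i < S.tl →
      x * (Q.τ i - (S.tl - Q.energyLeft S.tl / x)) ≠ Q.energyLeft (Q.τ i)) :
    Q.Path (· < ·) (S.tl - Q.energyLeft S.tl / x) 0 ((A.sort (· ≤ ·)).map Q.τ ++ [S.tl])
      (List.replicate (((A.sort (· ≤ ·)).map Q.τ).length + 1) x) := by
  have hdiv := div_pos hE hx.pos
  refine path_of_line_sort A (fun i hi => ?_) (fun i hi h1 h2 => ?_) (by linarith) ?_
  · obtain ⟨k1, k2, k3⟩ := hin i hi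
    refine ⟨k1, ?_, k2, by rw [zero_add, k3]⟩
    rcases k1.eq_or_lt with he | hlt
    · left
      rw [he, sub_self, mul_zero] at k3
      rw [he]
      by_contra hne
      exact (Q.energyLeft_pos (lt_of_le_of_ne (Q.τ_nonneg i) (Ne.symm hne))).ne k3
    · exact Or.inr hlt
  · rw [zero_add]
    exact lt_of_le_of_ne (hx.line i h1 h2) (hno i hi h1 h2)
  · rw [zero_add, sub_sub_cancel, mul_div_cancel₀ _ hx.pos.ne']

theorem mem_epochs_of_map {A : List ℕ} {t : ℝ} (ht : t ∈ A.map Q.τ) : ∃ j, t = Q.τ j := by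
  obtain ⟨j, -, rfl⟩ := List.mem_map.1 ht
  exact ⟨j, rfl⟩

theorem Accepts.path {S : State} (h : Q.Accepts S) (hE : 0 < Q.energyLeft S.tl) :
    Q.Path (· < ·) (Q.leftStart S) 0 (Q.leftTouches S ++ [S.tl])
      (List.replicate ((Q.leftTouches S).length + 1) (Q.leftPower S)) := by
  classical
  refine h.leftChange.path hE _ (fun i hi => ?_) (fun i hi h1 h2 h3 => hi ?_)
  · obtain ⟨h1, h2, h3⟩ := Finset.mem_filter.1 hi
    exact ⟨h2.le, Q.mem_before.1 h1, h3⟩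
  · exact Finset.mem_filter.2 ⟨Q.mem_before.2 h2, h1, h3⟩

theorem Valid.reject_path {S : State} (h : Q.Valid (· < ·) S) (h0 : 0 < S.tBegin)
    (hrej : ¬ Q.Accepts S) :
    Q.Path (· < ·) (S.tl - Q.energyLeft S.tl / Q.minLeftPower S) 0 (Q.leftEpochs S ++ [S.tl])
      (List.replicate ((Q.leftEpochs S).length + 1) (Q.minLeftPower S)) := by
  classical
  obtain ⟨hx, -, hmem, -⟩ := h.minLeftPower_spec h0 hrej
  obtain ⟨h1, h2, h3, h4, -⟩ := h.basic h0
  have e : Q.minLeftPower S * (Q.energyLeft S.tl / Q.minLeftPower S) = Q.energyLeft S.tl :=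
    mul_div_cancel₀ _ hx.pos.ne'
  refine hx.path h4 _ (fun i hi => ?_) (fun i hi h1 h2 h3 => hi ?_)
  · obtain ⟨k1, k2⟩ := Finset.mem_filter.1 hi
    have k3 := (Q.mem_leftArrivals.1 k1).1
    rw [chord, div_eq_iff (by linarith)] at k2
    have k4 : Q.minLeftPower S * (Q.τ i - (S.tl - Q.energyLeft S.tl / Q.minLeftPower S))
        = Q.energyLeft (Q.τ i) := by linarith
    refine ⟨?_, k3, k4⟩
    by_contra! hc
    have := mul_neg_of_pos_of_neg hx.pos (sub_neg.2 hc)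
    have := Q.energyLeft_nonneg (Q.τ i)
    linarith
  · refine Finset.mem_filter.2 ⟨(hmem i h2 h1.le).1, ?_⟩
    rw [chord, div_eq_iff (by linarith)]
    linarith

theorem Valid.leftEpochs_length_pos {S : State} (h : Q.Valid (· < ·) S) (h0 : 0 < S.tBegin)
    (hrej : ¬ Q.Accepts S) : 0 < (Q.leftEpochs S).length := by
  classical
  obtain ⟨-, ⟨i, hi, he⟩, -⟩ := h.minLeftPower_spec h0 hrej
  rw [leftEpochs, List.length_map, Finset.length_sort, Finset.card_pos]
  exact ⟨i, Finset.mem_filter.2 ⟨hi, he⟩⟩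

theorem Valid.rightEpochs_length_pos {S : State} (hA : Q.rightArrivals S ≠ ∅) :
    0 < (Q.rightEpochs S).length := by
  classical
  obtain ⟨⟨i, hi, he⟩, -⟩ := exists_min_image (Finset.nonempty_iff_ne_empty.2 hA)
    fun i => Q.chord S.tr (Q.τ i)
  rw [rightEpochs, List.length_map, Finset.length_sort, Finset.card_pos]
  exact ⟨i, Finset.mem_filter.2 ⟨hi, he⟩⟩

theorem Valid.right_path {S : State} (h : Q.Valid (· < ·) S) (h0 : 0 < S.tBegin)
    (hA : Q.rightArrivals S ≠ ∅) :
    Q.Path (· < ·) S.tr (Q.energyLeft S.tr)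
      (Q.rightEpochs S ++ [S.tr + Q.rightEnergy S / Q.rightPower S])
      (List.replicate ((Q.rightEpochs S).length + 1) (Q.rightPower S)) := by
  classical
  obtain ⟨h1, h2, h3, h4, h5, h6, h7, h8, h9⟩ := h.basic h0
  obtain ⟨m1, m2, m3, m4⟩ := h.minRightTime_spec h0
  obtain ⟨k1, k2⟩ := h.rightPower_spec hA
  have hrp : 0 < Q.rightPower S := (h.pos.trans_le h8).trans k1
  have hdiv := div_pos h5 hrp
  rw [minRightTime, if_neg hA] at m1 m2 m3
  have hE := energyLeft_of_right hdiv (by linarith) m3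
  have e : Q.rightPower S * (Q.rightEnergy S / Q.rightPower S) = Q.rightEnergy S :=
    mul_div_cancel₀ _ hrp.ne'
  refine path_of_line_sort _ (fun i hi => ?_) (fun i hi hi1 hi2 => ?_) (by linarith) ?_
  · obtain ⟨j1, j2⟩ := Finset.mem_filter.1 hi
    obtain ⟨j3, j4⟩ := Q.mem_rightArrivals.1 j1
    rw [chord, div_eq_iff (by linarith)] at j2
    refine ⟨j3.le, Or.inr j3, ?_, by linarith⟩
    have := m3 i j3 j4
    have h10 : Q.energyLeft (Q.τ i) - Q.energyLeft S.tr < Q.rightEnergy S := by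
      have := Q.energyLeft_lt le_rfl j4
      unfold rightEnergy
      linarith
    have := mul_lt_mul_of_pos_right h10 hdiv
    nlinarith
  · have hi3 : Q.τ i < S.tEnd := by linarith
    have hmin := k2 i hi1 hi3
    have hne : Q.rightPower S ≠ Q.chord S.tr (Q.τ i) := fun he =>
      hi (Finset.mem_filter.2 ⟨Q.mem_rightArrivals.2 ⟨hi1, hi3⟩, he.symm⟩)
    have hlt := lt_of_le_of_ne hmin hne
    rw [chord, lt_div_iff₀ (by linarith)] at hlt
    linarith
  · rw [add_sub_cancel_left, e, hE, rightEnergy]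
    ring

/-- If the part after `τ_r = τ_q` is dropped, then only the energy harvested before `τ_q` is left,
which is too little to send `B₀` bits within the receiver time `Γ₀`. -/
theorem Valid.duration_of_drop {S : State} {x : ℝ} (h : Q.Valid (· < ·) S) (h0 : 0 < S.tBegin)
    (hq : Q.q ≤ Q.n) (htr : S.tr = Q.τ Q.q) (hx : 0 < x)
    (hbits : sent Q.g (Q.energyLeft S.tl) (Q.energyLeft S.tl / x) = Q.outerBits S) :
    Q.Γ₀ < S.tr - (S.tl - Q.energyLeft S.tl / x) := by
  obtain ⟨h1, h2, h3, h4, h5, h6, h7, h8, h9⟩ := h.basic h0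
  obtain ⟨s, hs, hlast, hseg1, hpath, hseg3, htot⟩ := h.parts
  by_contra! hc
  have hq0 : 0 < Q.q := by
    rw [← Q.τ_lt, Q.τ_zero, ← htr]
    linarith
  have hlt := sent_lt_of_le_n hq0 hq
  have hEq : 0 < Q.energyLeft (Q.τ Q.q) := Q.energyLeft_pos (by rw [← htr]; linarith)
  set P := Q.energyLeft (Q.τ Q.q) / Q.Γ₀ with hPd
  have hP : 0 < P := div_pos hEq Q.Γ₀_pos
  have j1 := total_le_tangent Q.rate hP s S.tl S.p hpath.length_eq hpath.pairwise
    fun y hy => (h.powers_pos y (by simp [hy])).le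
  rw [hpath.total_id rfl, hlast, htr] at j1
  have j2 := mul_le_mul_of_nonneg_right (Q.rate.le_tangent hP hx.le) (div_pos h4 hx).le
  rw [sent, div_div_cancel₀ h4.ne', mul_comm] at hbits
  rw [sent, ← hPd, eq_tangent Q.g P, mul_comm] at hlt
  have e1 : x * (Q.energyLeft S.tl / x) = Q.energyLeft S.tl := mul_div_cancel₀ _ hx.ne'
  have e2 : P * Q.Γ₀ = Q.energyLeft (Q.τ Q.q) := div_mul_cancel₀ _ Q.Γ₀_pos.ne'
  have j3 := mul_le_mul_of_nonneg_left hc (Q.rate.intercept_pos hP).le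
  have e3 : (intercept Q.g P + marginal Q.g P * x) * (Q.energyLeft S.tl / x)
      = intercept Q.g P * (Q.energyLeft S.tl / x) + marginal Q.g P * Q.energyLeft S.tl := by
    rw [add_mul, mul_assoc, e1]
  have e4 : (intercept Q.g P + marginal Q.g P * P) * Q.Γ₀
      = intercept Q.g P * Q.Γ₀ + marginal Q.g P * Q.energyLeft (Q.τ Q.q) := by
    rw [add_mul, mul_assoc, e2]
  rw [e3] at j2
  rw [e4] at hlt
  rw [htr] at j3
  unfold outerBits at hbits
  rw [htr] at hbits htot
  linarith

theorem Valid.sorted_right {r : ℝ → ℝ → Prop} {S : State} (h : Q.Valid r S) :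
    S.p.Pairwise (· ≤ ·) ∧ (∀ y ∈ S.p, y ≤ S.pr) ∧ (∀ y ∈ S.p, S.pl ≤ y) ∧ S.pl ≤ S.pr := by
  have h1 := List.pairwise_cons.1 h.sorted
  have h2 := List.pairwise_append.1 h1.2
  exact ⟨h2.1, fun y hy => h2.2.2 y hy _ (by simp), fun y hy => h1.1 y (by simp [hy]),
    h1.1 _ (by simp)⟩

theorem card_before_mono {a b : ℝ} (h : a ≤ b) : (Q.before a).card ≤ (Q.before b).card :=
  Finset.card_le_card fun _ hi => Q.mem_before.2 ((Q.mem_before.1 hi).trans_le h)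

theorem card_before_lt {a b : ℝ} {j : ℕ} (ha : a ≤ Q.τ j) (hb : Q.τ j < b) :
    (Q.before a).card < (Q.before b).card := by
  refine Finset.card_lt_card ⟨fun i hi => Q.mem_before.2
    (((Q.mem_before.1 hi).trans_le ha).trans hb), fun hsub => ?_⟩
  exact absurd (Q.mem_before.1 (hsub (Q.mem_before.2 hb))) (not_lt.2 ha)

/-- `S'` is a valid state, and `2 |{arrivals before T_stop}| - |s|` is smaller for `S'` than for
`S`. This quantity bounds the number of iterations: an arrival counts twice until it is recorded as
a touching epoch, and once until it is dropped. -/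
def Progress (Q : Problem) (S S' : State) : Prop :=
  Q.Valid (· < ·) S' ∧
    2 * (Q.before S'.tEnd).card + S.s.length + 1 ≤ 2 * (Q.before S.tEnd).card + S'.s.length

/-- An iteration that drops the part after `τ_r`. -/
theorem Valid.drop_spec {S : State} (h : Q.Valid (· < ·) S) (h0 : 0 < S.tBegin)
    (hq : Q.q ≤ Q.n) (hacc : Q.Accepts S) (hA : Q.rightArrivals S = ∅) :
    Q.Step S (Q.acceptStep S) ∧ (Progress Q S (Q.acceptStep S) ∨
      Q.Γ₀ < (Q.acceptStep S).tEnd - (Q.acceptStep S).tBegin) := by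
  obtain ⟨h1, h2, h3, h4, h5, h6, h7, h8, h9⟩ := h.basic h0
  obtain ⟨m1, m2, m3, m4⟩ := h.minRightTime_spec h0
  have hx := hacc.leftChange
  have hleft := hacc.path h4
  obtain ⟨-, -, hbits⟩ := (isLeftPower_iff h4).1 (solve_spec hacc.1 : Q.IsLeftPower S _)
  change sent Q.g (Q.energyLeft S.tl) (Q.energyLeft S.tl / Q.leftPower S) = _ at hbits
  have hB : (Q.acceptStep S).tBegin = S.tl - Q.energyLeft S.tl / Q.leftPower S := by
    unfold acceptStep leftStart; rw [if_pos hA]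
  have hT : (Q.acceptStep S).tEnd = S.tr := by
    unfold acceptStep; rw [if_pos hA]
  rw [minRightTime, if_pos hA] at m2 m4
  have hs0 : sent Q.g (Q.rightEnergy S) 0 = 0 := by simp [sent]
  rw [hs0, sub_zero] at m4
  rw [m4] at hbits
  refine ⟨hx.step h h0 hB (b := 0) (by rw [hT, add_zero])
    (by rw [minRightTime, if_pos hA]) m2 (by rw [hs0, hbits, add_zero]), ?_⟩
  by_cases htrq : S.tr = Q.τ Q.q
  · right
    rw [hB, hT]
    exact h.duration_of_drop h0 hq htrq hx.pos hbits
  left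
  obtain ⟨s, hs, hlast, hseg1, hpath, hseg3, htot⟩ := h.parts
  obtain ⟨q1, q2, q3, q4⟩ := h.sorted_right
  rcases List.eq_nil_or_concat s with rfl | ⟨s₀, b, hsc⟩
  · -- then `τ_q = τ_l = τ_r`
    have := h.q_mem
    rw [hs, List.mem_singleton] at this
    exact absurd (hlast.symm.trans this.symm) htrq
  rw [List.concat_eq_append] at hsc
  subst hsc
  rw [List.getLastD_concat] at hlast
  subst hlast
  rcases List.eq_nil_or_concat S.p with hp | ⟨p₀, y, hp⟩
  · have := hpath.length_eq
    simp [hp] at this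
  rw [List.concat_eq_append] at hp
  have hpne : S.p ≠ [] := by rw [hp]; simp
  have hS' : Q.acceptStep S =
      { tl := (Q.leftTouches S).headD S.tl
        tr := s₀.getLastD S.tl
        tBegin := Q.leftStart S
        tEnd := S.tr
        pl := Q.leftPower S
        pr := y
        p := List.replicate (Q.leftTouches S).length (Q.leftPower S) ++ p₀
        s := Q.leftTouches S ++ S.tl :: s₀ } := by
    unfold acceptStep
    have e1 : S.s.dropLast = S.tl :: s₀ := by rw [hs, ← List.cons_append, List.dropLast_concat]
    have e2 : S.p.dropLast = p₀ := by rw [hp, List.dropLast_concat]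
    have e3 : S.p.getLastD S.pr = y := by rw [hp, List.getLastD_concat]
    rw [if_pos hA, if_neg hpne, if_neg hpne, e1, e2, e3, List.getLastD_cons]
  obtain ⟨j, hj⟩ := h.epochs S.tr (by rw [hs]; simp)
  rw [hp] at hpath q1 q2 q3 htot
  rw [hS']
  refine ⟨Valid.of_left rfl rfl rfl rfl rfl hx.nonneg hx.pos hleft hpath q1
    (fun z hz => hx.lt.le.trans (q3 z hz)) (fun t ht => mem_epochs_of_map ht)
    (fun t ht => h.epochs t ?_) ?_ ?_, ?_⟩
  · rw [hs, ← List.cons_append]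
    exact List.mem_append_left _ ht
  · have := h.q_mem
    rw [hs, ← List.cons_append] at this
    rcases List.mem_append.1 this with hmem | hmem
    · exact hmem
    · rw [List.mem_singleton] at hmem
      exact absurd hmem.symm htrq
  · rw [sent, div_div_cancel₀ h4.ne', outerBits] at hbits
    simp only [leftStart, sub_sub_cancel]
    linarith
  · have hcard := card_before_lt (Q := Q) (a := S.tr) hj.le (hj ▸ h3)
    have : S.s.length = s₀.length + 2 := by rw [hs]; simp
    simp only [List.length_append, List.length_cons]
    omega

/-- An iteration that raises the power after `τ_r` until it touches an epoch. -/
theorem Valid.raise_spec {S : State} (h : Q.Valid (· < ·) S) (h0 : 0 < S.tBegin)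
    (hacc : Q.Accepts S) (hA : Q.rightArrivals S ≠ ∅) :
    Q.Step S (Q.acceptStep S) ∧ Progress Q S (Q.acceptStep S) := by
  obtain ⟨h1, h2, h3, h4, h5, h6, h7, h8, h9⟩ := h.basic h0
  obtain ⟨m1, m2, m3, m4⟩ := h.minRightTime_spec h0
  obtain ⟨k1, k2⟩ := h.rightPower_spec hA
  have hx := hacc.leftChange
  have hleft := hacc.path h4
  obtain ⟨-, -, hbits⟩ := (isLeftPower_iff h4).1 (solve_spec hacc.1 : Q.IsLeftPower S _)
  change sent Q.g (Q.energyLeft S.tl) (Q.energyLeft S.tl / Q.leftPower S) = _ at hbits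
  have hS' : Q.acceptStep S =
      { tl := (Q.leftTouches S).headD S.tl
        tr := (Q.rightEpochs S).getLastD S.tr
        tBegin := Q.leftStart S
        tEnd := S.tr + Q.rightEnergy S / Q.rightPower S
        pl := Q.leftPower S
        pr := Q.rightPower S
        p := List.replicate (Q.leftTouches S).length (Q.leftPower S) ++ S.p ++
          List.replicate (Q.rightEpochs S).length (Q.rightPower S)
        s := Q.leftTouches S ++ S.s ++ Q.rightEpochs S } := by
    unfold acceptStep; rw [if_neg hA]
  have hmin : Q.minRightTime S = Q.rightEnergy S / Q.rightPower S := by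
    rw [minRightTime, if_neg hA]
  rw [m4] at hbits
  refine ⟨hx.step h h0 (by rw [hS']; rfl) (b := Q.minRightTime S) (by rw [hS', hmin])
    le_rfl m2 (by rw [hbits]; ring), ?_⟩
  obtain ⟨s, hs, hlast, hseg1, hpath, hseg3, htot⟩ := h.parts
  obtain ⟨q1, q2, q3, q4⟩ := h.sorted_right
  have hright := h.right_path h0 hA
  have hxr : Q.leftPower S ≤ Q.rightPower S := by linarith [hx.lt]
  have hrep : (S.p ++ List.replicate (Q.rightEpochs S).length (Q.rightPower S)) ++ [Q.rightPower S]
      = S.p ++ List.replicate ((Q.rightEpochs S).length + 1) (Q.rightPower S) := by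
    rw [List.append_assoc, List.replicate_succ']
  rw [hS']
  refine ⟨Valid.of_left (K := Q.leftTouches S) (c := S.tl) (s := s ++ Q.rightEpochs S)
    (p := S.p ++ List.replicate (Q.rightEpochs S).length (Q.rightPower S))
    (by simp [hs]) (by simp) rfl rfl ?_ hx.nonneg hx.pos hleft ?_ ?_ ?_
    (fun t ht => mem_epochs_of_map ht) ?_ ?_ ?_, ?_⟩
  · rw [getLastD_append_eq, hlast]
  · simp only [hrep]
    rw [List.append_assoc, path_append hpath.length_eq, hlast]
    exact ⟨hpath, hright⟩
  · simp only [hrep]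
    refine List.pairwise_append.2 ⟨q1, List.pairwise_replicate.2 (Or.inr le_rfl), ?_⟩
    intro y hy z hz
    rw [List.eq_of_mem_replicate hz]
    exact (q2 y hy).trans k1.le
  · simp only [hrep]
    intro y hy
    rcases List.mem_append.1 hy with hy | hy
    · exact hx.lt.le.trans (q3 y hy)
    · rw [List.eq_of_mem_replicate hy]
      exact hxr
  · intro t ht
    rw [← List.cons_append, ← hs] at ht
    rcases List.mem_append.1 ht with ht | ht
    · exact h.epochs t ht
    · exact mem_epochs_of_map ht
  · rw [← List.cons_append, ← hs]
    exact List.mem_append_left _ h.q_mem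
  · simp only [hrep]
    rw [List.append_assoc, total_append _ _ _ _ _ _ hpath.length_eq, hlast,
      total_replicate Q.g (Q.rightPower S) _ _ _ (by simp)
        (fun y hy => List.eq_of_mem_replicate hy), List.getLastD_concat, add_sub_cancel_left]
    rw [hmin, sent, sent, div_div_cancel₀ h4.ne', div_div_cancel₀ h5.ne', outerBits] at hbits
    simp only [leftStart, sub_sub_cancel]
    linarith
  · have hcard := card_before_mono (Q := Q)
      (show S.tr + Q.rightEnergy S / Q.rightPower S ≤ S.tEnd by rw [← hmin]; linarith)
    have := Valid.rightEpochs_length_pos hA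
    simp only [List.length_append]
    omega

/-- An iteration that is limited by the energy before `τ_l`. -/
theorem Valid.reject_spec {S : State} (h : Q.Valid (· < ·) S) (h0 : 0 < S.tBegin)
    (hrej : ¬ Q.Accepts S) :
    Q.Step S (Q.rejectStep S) ∧ Progress Q S (Q.rejectStep S) := by
  obtain ⟨h1, h2, h3, h4, h5, h6, h7, h8, h9⟩ := h.basic h0
  obtain ⟨m1, m2, m3, m4⟩ := h.minRightTime_spec h0
  obtain ⟨hx, -, -, hlt⟩ := h.minLeftPower_spec h0 hrej
  have hleft := h.reject_path h0 hrej
  set x := Q.minLeftPower S with hxd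
  have hdiv := div_pos h4 hx.pos
  set Br := Q.outerBits S - Q.g x * (Q.energyLeft S.tl / x) with hBr
  have hsx : sent Q.g (Q.energyLeft S.tl) (Q.energyLeft S.tl / x)
      = Q.g x * (Q.energyLeft S.tl / x) := by
    rw [sent, div_div_cancel₀ h4.ne', mul_comm]
  have hb : 0 < S.tEnd - S.tr := by linarith
  have hBr1 : sent Q.g (Q.rightEnergy S) (Q.minRightTime S) < Br := by
    rw [hBr, ← hsx]; linarith
  have hBr0 : 0 < Br := by
    refine lt_of_le_of_lt ?_ hBr1
    rcases m1.eq_or_lt with hz | hz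
    · rw [← hz, sent, zero_mul]
    · exact (Q.rate.sent_pos h5 hz).le
  have hBr2 : Br < sent Q.g (Q.rightEnergy S) (S.tEnd - S.tr) := by
    have := Q.rate.sent_lt_of_time_lt h4 (sub_pos.2 h1)
      (show S.tl - S.tBegin < Q.energyLeft S.tl / x by linarith [hx.begin_lt h h0])
    rw [hBr, ← hsx]; linarith
  have hex : ∃ y, 0 < y ∧ Q.rightEnergy S / y * Q.g y = Br := by
    obtain ⟨T, hT0, -, hTs⟩ := Q.rate.exists_time h5 hb hBr0 hBr2.le
    refine ⟨Q.rightEnergy S / T, div_pos h5 hT0, ?_⟩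
    rw [div_div_cancel₀ h5.ne']
    exact hTs
  obtain ⟨hy0, hy⟩ := solve_spec hex
  have hS' : Q.rejectStep S =
      { tl := (Q.leftEpochs S).headD S.tl
        tr := S.tr
        tBegin := S.tl - Q.energyLeft S.tl / x
        tEnd := S.tr + Q.rightEnergy S / solve fun y => 0 < y ∧ Q.rightEnergy S / y * Q.g y = Br
        pl := x
        pr := solve fun y => 0 < y ∧ Q.rightEnergy S / y * Q.g y = Br
        p := List.replicate (Q.leftEpochs S).length x ++ S.p
        s := Q.leftEpochs S ++ S.s } := rfl
  set y := solve fun y => 0 < y ∧ Q.rightEnergy S / y * Q.g y = Br with hyd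
  have hsy : sent Q.g (Q.rightEnergy S) (Q.rightEnergy S / y) = Br := by
    rw [sent, div_div_cancel₀ h5.ne', hy]
  have hydiv := div_pos h5 hy0
  have hby : Q.rightEnergy S / y < S.tEnd - S.tr :=
    Q.rate.time_lt_of_sent_lt h5 hb (by rw [hsy]; exact hBr2)
  have hby' : Q.minRightTime S < Q.rightEnergy S / y :=
    Q.rate.time_lt_of_sent_lt h5 hydiv (by rw [hsy]; exact hBr1)
  have hstep : Q.Step S (Q.rejectStep S) :=
    hx.step h h0 (by rw [hS']) (b := Q.rightEnergy S / y) (by rw [hS'])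
      hby'.le hby (by rw [hsy, hsx, hBr]; ring)
  refine ⟨hstep, ?_⟩
  obtain ⟨s, hs, hlast, hseg1, hpath, hseg3, htot⟩ := h.parts
  obtain ⟨q1, q2, q3, q4⟩ := h.sorted_right
  have hpry : S.pr < y := by
    rw [div_lt_iff₀ hy0, ← h7] at hby
    have : 0 < S.tEnd - S.tr := hb
    nlinarith
  have hE := energyLeft_of_right (Q := Q) (S := S) hydiv (by linarith)
    (fun i hi1 hi2 => (m3 i hi1 hi2).trans (mul_le_mul_of_nonneg_left hby'.le
      (sub_nonneg.2 (Q.energyLeft_mono hi1.le))))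
  have hey : y * (Q.rightEnergy S / y) = Q.rightEnergy S := mul_div_cancel₀ _ hy0.ne'
  have hseg : Q.Segment (· < ·) S.tr (Q.energyLeft S.tr) (S.tr + Q.rightEnergy S / y) y := by
    refine ⟨by linarith, Or.inr (by linarith), ?_, fun i hi1 hi2 => ?_⟩
    · rw [add_sub_cancel_left, hey, hE, rightEnergy]; ring
    · have hi3 : Q.τ i < S.tEnd := by linarith
      have j1 := m3 i hi1 hi3
      have j2 : 0 < Q.energyLeft (Q.τ i) - Q.energyLeft S.tr := by
        obtain ⟨j, hj⟩ := h.epochs S.tr (by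
          obtain ⟨s₀, hs₀⟩ := h.last
          rw [hs₀]; simp)
        exact sub_pos.2 (Q.energyLeft_lt hj.le (hj ▸ hi1))
      have j3 := mul_lt_mul_of_pos_left hby' j2
      have j4 : (Q.energyLeft (Q.τ i) - Q.energyLeft S.tr) * (Q.rightEnergy S / y) * y
          = (Q.energyLeft (Q.τ i) - Q.energyLeft S.tr) * Q.rightEnergy S := by
        rw [mul_assoc, mul_comm _ y, hey]
      have j5 := mul_lt_mul_of_pos_right (j1.trans_lt j3) hy0
      rw [j4] at j5
      have j6 : y * (Q.τ i - S.tr) < Q.energyLeft (Q.τ i) - Q.energyLeft S.tr := by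
        by_contra! hc
        have := mul_le_mul_of_nonneg_left hc h5.le
        linarith
      linarith
  rw [hS']
  refine ⟨Valid.of_left (K := Q.leftEpochs S) (c := S.tl) (s := s) (p := S.p)
    (by rw [hs]) rfl rfl rfl hlast.symm hx.nonneg hx.pos hleft ?_ ?_ ?_
    (fun t ht => mem_epochs_of_map ht) ?_ ?_ ?_, ?_⟩
  · rw [path_concat, hlast]
    exact ⟨hpath, hseg⟩
  · refine List.pairwise_append.2 ⟨q1, by simp, fun z hz w hw => ?_⟩
    rw [List.mem_singleton.1 hw]
    exact (q2 z hz).trans hpry.le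
  · intro z hz
    rcases List.mem_append.1 hz with hz | hz
    · exact hx.lt.le.trans (q3 z hz)
    · rw [List.mem_singleton.1 hz]
      exact hx.lt.le.trans (q4.trans hpry.le)
  · intro t ht
    exact h.epochs t (hs ▸ ht)
  · exact hs ▸ h.q_mem
  · rw [total_concat _ _ _ _ _ _ hpath.length_eq, hlast, add_sub_cancel_left, sub_sub_cancel]
    have hy' : Q.g y * (Q.rightEnergy S / y) = Br := by rw [mul_comm]; exact hy
    rw [hy', hBr, outerBits]
    linarith
  · have hcard := card_before_mono (Q := Q)
      (show S.tr + Q.rightEnergy S / y ≤ S.tEnd by linarith)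
    have := h.leftEpochs_length_pos h0 hrej
    simp only [List.length_append]
    omega

/-- An iteration leads to a state that is valid and makes progress, or that lasts too long, so that
it is the last one. Only dropping the part after `τ_q` can lead to the second case. -/
theorem Valid.pullBackStep_spec {S : State} (h : Q.Valid (· < ·) S) (h0 : 0 < S.tBegin)
    (hq : Q.q ≤ Q.n) :
    Q.Step S (Q.pullBackStep S) ∧ (Progress Q S (Q.pullBackStep S) ∨
      Q.Γ₀ < (Q.pullBackStep S).tEnd - (Q.pullBackStep S).tBegin) := by
  unfold pullBackStep
  split_ifs with hacc
  · by_cases hA : Q.rightArrivals S = ∅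
    · exact h.drop_spec h0 hq hacc hA
    · exact ⟨(h.raise_spec h0 hacc hA).1, Or.inl (h.raise_spec h0 hacc hA).2⟩
  · exact ⟨(h.reject_spec h0 hacc).1, Or.inl (h.reject_spec h0 hacc).2⟩

end Problem

/-! ### QUIT -/

/-- If the durations `a, b` and `a', b'` of two parts with energies `E` and `F` send the same number
of bits, `a < a'` and `b' < b`, then so do suitable durations in between, for every total duration
in between. -/
theorem IsRate.exists_split {g : ℝ → ℝ} (hg : IsRate g) {E F a b a' b' T : ℝ} (hE : 0 < E)
    (hF : 0 < F) (ha : 0 < a) (hb0 : 0 ≤ b') (hb' : b' < b)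
    (hs : sent g E a' + sent g F b' = sent g E a + sent g F b) (h1 : a + b < T)
    (h2 : T < a' + b') :
    ∃ x, a ≤ x ∧ x ≤ a' ∧ b' ≤ T - x ∧ T - x ≤ b ∧ 0 < T - x ∧
      sent g E x + sent g F (T - x) = sent g E a + sent g F b := by
  have hbpos : 0 < b := hb0.trans_lt hb'
  obtain ⟨c, hc1, hc2, hc0, hc⟩ : ∃ c, b' ≤ c ∧ c < b ∧ 0 < c ∧
      sent g E (T - c) + sent g F c ≤ sent g E a + sent g F b := by
    rcases hb0.eq_or_lt with hz | hpos
    · -- near zero, the second part sends few bits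
      rw [← hz, show sent g F 0 = 0 by simp [sent], add_zero] at hs
      have hlt := hg.sent_lt_of_time_lt hE (show 0 < T by linarith) (show T < a' by linarith)
      obtain ⟨t, ht0, ht⟩ := hg.exists_sent_lt hF (sub_pos.2 hlt)
      have hm0 : 0 < min t (b / 2) := lt_min ht0 (by linarith)
      have hmb : min t (b / 2) ≤ b / 2 := min_le_right _ _
      refine ⟨min t (b / 2), hz ▸ hm0.le, by linarith, hm0, ?_⟩
      have k1 := ht _ hm0 (min_le_left _ _)
      have k2 := hg.sent_le_of_time_le hE (show 0 < T - min t (b / 2) by linarith)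
        (show T - min t (b / 2) ≤ T by linarith)
      linarith
    · refine ⟨b', le_rfl, hb', hpos, ?_⟩
      have := hg.sent_lt_of_time_lt hE (show 0 < T - b' by linarith)
        (show T - b' < a' by linarith)
      linarith
  have hcont : ContinuousOn (fun x => sent g E x + sent g F (T - x)) (Set.Icc (T - b) (T - c)) := by
    refine ContinuousOn.add ((hg.sent_continuousOn hE).mono fun x hx => ?_)
      ((hg.sent_continuousOn hF).comp (continuousOn_const.sub continuousOn_id) fun x hx => ?_)
    · have := hx.1
      exact Set.mem_Ioi.2 (by linarith)
    · have := hx.2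
      exact Set.mem_Ioi.2 (show 0 < T - x by linarith)
  have hup : sent g E a + sent g F b ≤ sent g E (T - b) + sent g F (T - (T - b)) := by
    rw [sub_sub_cancel]
    have := hg.sent_lt_of_time_lt hE ha (show a < T - b by linarith)
    linarith
  obtain ⟨x, hx, he⟩ := intermediate_value_Icc' (by linarith : T - b ≤ T - c) hcont
    (⟨by simpa only [sub_sub_cancel] using hc, hup⟩ :
      sent g E a + sent g F b ∈ Set.Icc _ _)
  have := hx.1
  have := hx.2
  exact ⟨x, by linarith, by linarith, by linarith, by linarith, by linarith, he⟩

namespace Problem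

variable {Q : Problem}

theorem Valid.outerBits_eq {r : ℝ → ℝ → Prop} {S : State} (h : Q.Valid r S) :
    Q.B₀ - (Policy.mk S.p S.s).totalBits Q.g = Q.outerBits S := by
  obtain ⟨s, hs, -, -, hpath, -, htot⟩ := h.parts
  rw [hs, Policy.totalBits_eq _ _ _ _ hpath.length_eq, outerBits]
  linarith

theorem Step.exists_quitLength {S' S : State} (hst : Q.Step S' S) (h : Q.Valid (· < ·) S')
    (h0 : 0 < S'.tBegin) (hd' : S'.tEnd - S'.tBegin < Q.Γ₀) (hd : Q.Γ₀ < S.tEnd - S.tBegin) :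
    ∃ x, Q.IsQuitLength S' S x := by
  obtain ⟨h1, h2, h3, h4, h5, h6, h7, h8, h9⟩ := h.basic h0
  obtain ⟨x, k1, k2, k3, k4, k5, k6⟩ := Q.rate.exists_split (T := Q.Γ₀ - (S'.tr - S'.tl)) h4 h5
    (show 0 < S'.tl - S'.tBegin by linarith) (sub_nonneg.2 hst.le_end)
    (show S.tEnd - S'.tr < S'.tEnd - S'.tr by linarith [hst.end_lt])
    (by rw [hst.bits, h9]) (by linarith)
    (show _ < S'.tl - S.tBegin + (S.tEnd - S'.tr) by linarith)
  refine ⟨x, by linarith, by linarith, ⟨by linarith, by linarith⟩, ⟨by linarith, by linarith⟩, ?_⟩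
  rw [h.outerBits_eq, h9]
  exact k6

/-- The policy that QUIT returns is valid. Its outer powers lie between those of the last two
states, so that it is feasible and its powers are increasing. -/
theorem Step.valid_quit {S' S : State} (hst : Q.Step S' S) (h : Q.Valid (· < ·) S')
    (h0 : 0 < S'.tBegin) {x : ℝ} (hx : Q.IsQuitLength S' S x) :
    Q.Valid (· ≤ ·)
      { tl := S'.tl
        tr := S'.tr
        tBegin := S'.tl - x
        tEnd := S'.tr + (Q.Γ₀ - (S'.tr - S'.tl) - x)
        pl := Q.energyLeft S'.tl / x
        pr := Q.rightEnergy S' / (Q.Γ₀ - (S'.tr - S'.tl) - x)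
        p := S'.p
        s := S'.s } := by
  obtain ⟨h1, h2, h3, h4, h5, h6, h7, h8, h9⟩ := h.basic h0
  obtain ⟨hx0, hxT, ⟨hx1, hx2⟩, ⟨hx3, hx4⟩, hxb⟩ := hx
  obtain ⟨s, hs, hlast, hseg1, hpath, hseg3, htot⟩ := h.parts
  obtain ⟨q1, q2, q3, q4⟩ := h.sorted_right
  have hy0 : 0 < Q.Γ₀ - (S'.tr - S'.tl) - x := by linarith
  set y := Q.Γ₀ - (S'.tr - S'.tl) - x with hy
  have hpl : Q.energyLeft S'.tl / x ≤ S'.pl := by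
    rw [div_le_iff₀ hx0, ← h6]
    exact mul_le_mul_of_nonneg_left (by linarith) h.pos.le
  have hpr : S'.pr ≤ Q.rightEnergy S' / y := by
    rw [le_div_iff₀ hy0, ← h7]
    exact mul_le_mul_of_nonneg_left (by linarith) (h.pos.le.trans h8)
  have hright : ∀ i, S'.tr < Q.τ i → Q.τ i < S'.tEnd → Q.rightEnergy S' * (Q.τ i - S'.tr)
      ≤ (Q.energyLeft (Q.τ i) - Q.energyLeft S'.tr) * y := fun i hi1 hi2 =>
    (hst.right i hi1 hi2).trans (mul_le_mul_of_nonneg_left (by linarith)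
      (sub_nonneg.2 (Q.energyLeft_mono hi1.le)))
  have hE := energyLeft_of_right hy0 hx4 hright
  refine Valid.of_parts hs hlast (hst.begin_nonneg.trans hx1) ?_ (hpath.mono fun _ _ => le_of_lt)
    ?_ (div_pos h4 hx0) ?_ h.epochs h.q_mem ?_
  · refine ⟨by simp [hx0.le], Or.inr (by simp [hx0]), ?_, fun i hi1 hi2 => ?_⟩
    · simp only [sub_sub_cancel, zero_add]
      exact div_mul_cancel₀ _ hx0.ne'
    · have k1 := hst.left i hi2
      have k2 := mul_nonneg (sub_nonneg.2 (Q.energyLeft_mono hi2.le))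
        (show 0 ≤ S'.tl - S.tBegin - x by linarith)
      simp only [zero_add]
      rw [div_mul_eq_mul_div, div_le_iff₀ hx0]
      linarith
  · refine ⟨by simp [hy0.le], Or.inr (by simp [hy0]), ?_, fun i hi1 hi2 => ?_⟩
    · simp only [add_sub_cancel_left]
      rw [div_mul_cancel₀ _ hy0.ne', hE, rightEnergy]
      ring
    · have k1 := hright i hi1 (hi2.trans_le hx4)
      show Q.energyLeft S'.tr + Q.rightEnergy S' / y * (Q.τ i - S'.tr) ≤ Q.energyLeft (Q.τ i)
      rw [div_mul_eq_mul_div, ← le_sub_iff_add_le', div_le_iff₀ hy0]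
      exact k1
  · refine List.pairwise_cons.2 ⟨fun z hz => ?_, List.pairwise_append.2 ⟨q1, by simp, ?_⟩⟩
    · rcases List.mem_append.1 hz with hz | hz
      · exact hpl.trans (q3 z hz)
      · rw [List.mem_singleton.1 hz]
        exact hpl.trans (q4.trans hpr)
    · intro z hz w hw
      rw [List.mem_singleton.1 hw]
      exact (q2 z hz).trans hpr
  · rw [h.outerBits_eq, outerBits] at hxb
    simp only [sub_sub_cancel, add_sub_cancel_left]
    linarith

/-! ### The run of PULL_BACK -/

theorem pullBackState_succ (k : ℕ) :
    Q.pullBackState (k + 1) = Q.pullBackStep (Q.pullBackState k) :=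
  Function.iterate_succ_apply' _ _ _

/-- The touching epochs are distinct arrivals before the finish time. -/
theorem Valid.length_le_card {r : ℝ → ℝ → Prop} {S : State} (h : Q.Valid r S)
    (h0 : 0 < S.tBegin) : S.s.length ≤ (Q.before S.tEnd).card := by
  classical
  have hpw := List.pairwise_append.1 (List.pairwise_cons.1 (h.path.pairwise_lt h0)).2
  have hnd : S.s.Nodup := hpw.1.imp fun hab => hab.ne
  rw [← List.toFinset_card_of_nodup hnd,
    ← Finset.card_image_of_injective (Q.before S.tEnd) Q.τ_strictMono.injective]
  refine Finset.card_le_card fun t ht => ?_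
  rw [List.mem_toFinset] at ht
  obtain ⟨j, rfl⟩ := h.epochs t ht
  exact Finset.mem_image_of_mem _ (Q.mem_before.2 (hpw.2.2 _ ht _ (by simp)))

/-- As long as the guard has not failed, the states are valid, except for a last state that lasts
longer than `Γ₀`. -/
theorem valid_pullBackState (hinit : Q.Valid (· < ·) Q.pullBackInit) (hq : Q.q ≤ Q.n) (k : ℕ)
    (hk : ∀ j < k, Q.pullBackGuard (Q.pullBackState j)) :
    (Q.Valid (· < ·) (Q.pullBackState k) ∧
      2 * (Q.before (Q.pullBackState k).tEnd).card + Q.pullBackInit.s.length + k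
        ≤ 2 * (Q.before Q.pullBackInit.tEnd).card + (Q.pullBackState k).s.length) ∨
      Q.Γ₀ < (Q.pullBackState k).tEnd - (Q.pullBackState k).tBegin := by
  induction k with
  | zero => exact Or.inl ⟨hinit, le_rfl⟩
  | succ k ih =>
    have hg := hk k (by omega)
    rcases ih fun j hj => hk j (by omega) with ⟨hv, hc⟩ | hd
    · rw [pullBackState_succ]
      rcases (hv.pullBackStep_spec hg.2 hq).2 with ⟨hv', hc'⟩ | hd
      · exact Or.inl ⟨hv', by omega⟩
      · exact Or.inr hd
    · exact absurd hg.1 (not_lt.2 hd.le)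

theorem valid_of_guard (hinit : Q.Valid (· < ·) Q.pullBackInit) (hq : Q.q ≤ Q.n) {k : ℕ}
    (hk : ∀ j ≤ k, Q.pullBackGuard (Q.pullBackState j)) :
    Q.Valid (· < ·) (Q.pullBackState k) ∧ k < 2 * (Q.before Q.pullBackInit.tEnd).card := by
  have hg := hk k le_rfl
  rcases valid_pullBackState hinit hq k fun j hj => hk j hj.le with ⟨hv, hc⟩ | hd
  · refine ⟨hv, ?_⟩
    have h1 := hv.length_le_card hg.2
    obtain ⟨s, hs⟩ := hv.head
    have h2 : 0 < (Q.pullBackState k).s.length := by rw [hs]; simp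
    omega
  · exact absurd hg.1 (not_lt.2 hd.le)

theorem pullBackCount_spec (hinit : Q.Valid (· < ·) Q.pullBackInit) (hq : Q.q ≤ Q.n) :
    ¬ Q.pullBackGuard (Q.pullBackState Q.pullBackCount) ∧
      Q.pullBackCount ≤ 2 * (Q.before Q.pullBackInit.tEnd).card ∧
      ∀ j < Q.pullBackCount, Q.pullBackGuard (Q.pullBackState j) := by
  have hex : ∃ k ≤ 2 * (Q.before Q.pullBackInit.tEnd).card,
      ¬ Q.pullBackGuard (Q.pullBackState k) := by
    by_contra! hall
    exact lt_irrefl _ (valid_of_guard hinit hq hall).2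
  obtain ⟨k, hk, hkg⟩ := hex
  refine ⟨Nat.sInf_mem (s := {k | ¬ Q.pullBackGuard (Q.pullBackState k)}) ⟨k, hkg⟩,
    (Nat.sInf_le (s := {k | ¬ Q.pullBackGuard (Q.pullBackState k)}) hkg).trans hk, fun j hj => ?_⟩
  by_contra hc
  exact Nat.notMem_of_lt_sInf (s := {k | ¬ Q.pullBackGuard (Q.pullBackState k)}) hj hc

/-- The output of OFF is the policy of a valid state with the right duration. -/
theorem exists_valid_OFF (hinit : Q.Valid (· < ·) Q.pullBackInit) (hq : Q.q ≤ Q.n)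
    (hdur : Q.pullBackInit.tEnd - Q.pullBackInit.tBegin ≤ Q.Γ₀) :
    ∃ S, Q.OFF = S.policy ∧ Q.Valid (· ≤ ·) S ∧ S.tEnd - S.tBegin ≤ Q.Γ₀ ∧
      (0 < S.tBegin → S.tEnd - S.tBegin = Q.Γ₀) := by
  obtain ⟨hend, -, hbefore⟩ := pullBackCount_spec hinit hq
  unfold OFF quit
  split_ifs with hlong
  · -- the guard held before the last iteration
    obtain ⟨k, hk⟩ : ∃ k, Q.pullBackCount = k + 1 := by
      refine Nat.exists_eq_succ_of_ne_zero fun hz => ?_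
      rw [hz] at hlong
      exact absurd hdur (not_le.2 hlong)
    rw [hk] at hlong hbefore ⊢
    rw [Nat.add_sub_cancel]
    have hg := hbefore k (by omega)
    have hv := (valid_of_guard hinit hq (k := k) fun j hj => hbefore j (by omega)).1
    have hst := (hv.pullBackStep_spec hg.2 hq).1
    rw [← pullBackState_succ] at hst
    have hx := solve_spec (hst.exists_quitLength hv hg.2 hg.1 hlong)
    refine ⟨_, rfl, hst.valid_quit hv hg.2 hx, ?_, fun _ => ?_⟩
    · apply le_of_eq
      ring
    · ring
  · rcases valid_pullBackState hinit hq _ hbefore with ⟨hv, -⟩ | hd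
    · refine ⟨_, rfl, hv.weaken, not_lt.1 hlong, fun hpos => ?_⟩
      by_contra hne
      exact hend ⟨lt_of_le_of_ne (not_lt.1 hlong) hne, hpos⟩
    · exact absurd hd hlong

theorem duration_lt (hinit : Q.Valid (· < ·) Q.pullBackInit) (hq : Q.q ≤ Q.n) {k : ℕ}
    (hk : k < Q.pullBackCount) :
    (Q.pullBackState k).tEnd - (Q.pullBackState k).tBegin <
      (Q.pullBackState (k + 1)).tEnd - (Q.pullBackState (k + 1)).tBegin := by
  obtain ⟨-, -, hbefore⟩ := pullBackCount_spec hinit hq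
  have hv := (valid_of_guard hinit hq fun j hj => hbefore j (hj.trans_lt hk)).1
  have hst := (hv.pullBackStep_spec (hbefore k hk).2 hq).1
  rw [← pullBackState_succ] at hst
  exact hst.duration_lt hv (hbefore k hk).2

end Problem

/-! ### The constant power policy of INIT_POLICY -/

theorem sent_div (g : ℝ → ℝ) {E : ℝ} (hE : E ≠ 0) (x : ℝ) : sent g E (E / x) = E / x * g x := by
  rw [sent, div_div_cancel₀ hE]

namespace Problem

variable {Q : Problem}

/-- By Jensen's inequality, a feasible policy sends at most the bits that its energy sends at
constant power in time `Γ₀`; hence `n` exists. -/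
theorem le_sent_n (hQ : ∃ Y, Q.Feasible Y) : Q.B₀ ≤ sent Q.g (Q.energy (Q.τ Q.n)) Q.Γ₀ := by
  obtain ⟨Y, hY⟩ := hQ
  obtain ⟨B, U, O, hR⟩ := hY.exists_rival
  set F := Y.finish
  have hF : 0 < F := by
    rcases hR.finish_nonneg.eq_or_lt with h0 | h0
    · have := hR.bits 0 h0.ge
      rw [hR.bits_zero] at this
      exact absurd this Q.B₀_pos.ne
    · exact h0
  have hE := Q.energyLeft_pos hF
  obtain ⟨k, -, hk, -⟩ := Q.exists_next F
  have hle : Q.B₀ ≤ sent Q.g (Q.energyLeft F) Q.Γ₀ := by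
    have hP : 0 < Q.energyLeft F / Q.Γ₀ := div_pos hE Q.Γ₀_pos
    have h1 := hR.step _ hP 0 F hF.le
    rw [hR.bits_zero, hR.on_zero, hR.used_zero, hR.bits F le_rfl] at h1
    have h2 := mul_le_mul_of_nonneg_left (hR.on_le F le_rfl) (Q.rate.intercept_pos hP).le
    have h3 := mul_le_mul_of_nonneg_left (hR.energy F) (Q.rate.marginal_pos hP).le
    rw [sent, eq_tangent Q.g (Q.energyLeft F / Q.Γ₀)]
    have h4 : Q.Γ₀ * (intercept Q.g (Q.energyLeft F / Q.Γ₀)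
        + marginal Q.g (Q.energyLeft F / Q.Γ₀) * (Q.energyLeft F / Q.Γ₀))
        = intercept Q.g (Q.energyLeft F / Q.Γ₀) * Q.Γ₀
          + marginal Q.g (Q.energyLeft F / Q.Γ₀) * Q.energyLeft F := by
      have := Q.Γ₀_pos
      field_simp
    linarith
  have hmem : k ∈ {k | Q.B₀ ≤ Q.Γ₀ * Q.g (Q.energy (Q.τ k) / Q.Γ₀)} := by
    refine hle.trans (Q.rate.sent_le_of_energy_le hE.le Q.Γ₀_pos ?_)
    exact (Q.energyLeft_le_energy F).trans (hk.le.trans (Q.energyLeft_le_energy _))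
  exact Nat.sInf_mem (s := {k | Q.B₀ ≤ Q.Γ₀ * Q.g (Q.energy (Q.τ k) / Q.Γ₀)}) ⟨k, hmem⟩

theorem energy_pos (k : ℕ) : 0 < Q.energy (Q.τ k) := by
  rw [energy_eq_energyLeft_succ]
  exact Q.energyLeft_pos ((Q.τ_nonneg k).trans_lt (Q.τ_lt.2 k.lt_succ_self))

theorem initTime_spec (hQ : ∃ Y, Q.Feasible Y) : 0 < Q.initTime ∧ Q.initTime ≤ Q.Γ₀ ∧
    sent Q.g (Q.energy (Q.τ Q.n)) Q.initTime = Q.B₀ := by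
  have hE := Q.energy_pos Q.n
  have hex : ∃ T, 0 < T ∧ T * Q.g (Q.energy (Q.τ Q.n) / T) = Q.B₀ := by
    obtain ⟨T, h1, -, h2⟩ := Q.rate.exists_time hE Q.Γ₀_pos Q.B₀_pos (le_sent_n hQ)
    exact ⟨T, h1, h2⟩
  obtain ⟨h1, h2⟩ := solve_spec hex
  change 0 < Q.initTime at h1
  change sent Q.g (Q.energy (Q.τ Q.n)) Q.initTime = Q.B₀ at h2
  refine ⟨h1, ?_, h2⟩
  exact Q.rate.time_le_of_sent_le hE Q.Γ₀_pos (h2.le.trans (le_sent_n hQ))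

theorem pc_pos (hQ : ∃ Y, Q.Feasible Y) : 0 < Q.pc :=
  div_pos (Q.energy_pos _) (initTime_spec hQ).1

theorem pc_mul_initTime (hQ : ∃ Y, Q.Feasible Y) : Q.pc * Q.initTime = Q.energy (Q.τ Q.n) :=
  div_mul_cancel₀ _ (initTime_spec hQ).1.ne'

variable (Q)

/-- The start time of the constant power policy through the corner at `τ_k`. -/
noncomputable def constStart (k : ℕ) : ℝ := Q.τ k - Q.energyLeft (Q.τ k) / Q.pc

/-- The line of slope `p_c` through the corner of the energy curve at `τ_k` supports the corners
with index at most `n`. -/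
def Supports (k : ℕ) : Prop :=
  ∀ j ≤ Q.n, Q.pc * (Q.τ j - Q.constStart k) ≤ Q.energyLeft (Q.τ j)

variable {Q}

theorem pc_mul_sub_constStart (hQ : ∃ Y, Q.Feasible Y) (k : ℕ) :
    Q.pc * (Q.τ k - Q.constStart k) = Q.energyLeft (Q.τ k) := by
  rw [constStart, sub_sub_cancel, mul_div_cancel₀ _ (pc_pos hQ).ne']

theorem constPolicy_eq (hQ : ∃ Y, Q.Feasible Y) (k : ℕ) :
    Q.constPolicy k = ⟨[Q.pc, Q.pc], [Q.constStart k, Q.τ k, Q.constStart k + Q.initTime]⟩ := by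
  have h := pc_pos hQ
  unfold constPolicy constStart
  congr 4
  rw [← pc_mul_initTime hQ]
  field_simp
  ring

theorem constPolicy_flow (k : ℕ) (t : ℝ) :
    flow id t (Q.constStart k) [Q.pc, Q.pc] [Q.τ k, Q.constStart k + Q.initTime]
      = Q.pc * (min (Q.constStart k + Q.initTime) t - min (Q.constStart k) t) := by
  simp only [flow_cons, flow_nil, id]
  ring

theorem energyLeft_lt_energy_n {j : ℕ} (hj : j ≤ Q.n) :
    Q.energyLeft (Q.τ j) < Q.energy (Q.τ Q.n) := by
  rw [energy_eq_energyLeft_succ]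
  exact Q.energyLeft_lt le_rfl (Q.τ_lt.2 (Nat.lt_succ_of_le hj))

theorem energy_n_le {t : ℝ} (h : Q.τ Q.n < t) : Q.energy (Q.τ Q.n) ≤ Q.energyLeft t :=
  Q.energy_le_energyLeft h

theorem Supports.nonneg (hQ : ∃ Y, Q.Feasible Y) {k : ℕ} (h : Q.Supports k) :
    0 ≤ Q.constStart k := by
  have := h 0 (Nat.zero_le _)
  rw [Q.τ_zero, Q.energyLeft_of_nonpos le_rfl] at this
  have := pc_pos hQ
  by_contra! hc
  nlinarith

theorem energyFeasible_constPolicy_iff (hQ : ∃ Y, Q.Feasible Y) {k : ℕ} (hk : k ≤ Q.n) :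
    Q.EnergyFeasible (Q.constPolicy k) ↔ Q.Supports k := by
  have hpc := pc_pos hQ
  have hT := (initTime_spec hQ).1
  have hEn := pc_mul_initTime hQ
  rw [constPolicy_eq hQ]
  constructor
  · intro h j hj
    have h1 := h.flow_le (Q.τ j)
    rw [constPolicy_flow] at h1
    have h2 := Q.energyLeft_nonneg (Q.τ j)
    by_contra! hc
    have hst : Q.constStart k < Q.τ j := by
      by_contra! hc'
      nlinarith
    rw [min_eq_left hst.le] at h1
    rcases le_total (Q.τ j) (Q.constStart k + Q.initTime) with hle | hle
    · rw [min_eq_right hle] at h1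
      linarith
    · rw [min_eq_left hle, add_sub_cancel_left, hEn] at h1
      exact absurd h1 (not_le.2 (energyLeft_lt_energy_n hj))
  · intro h
    have h0 := h.nonneg hQ
    have hk1 : Q.constStart k ≤ Q.τ k := by
      have := div_nonneg (Q.energyLeft_nonneg (Q.τ k)) hpc.le
      unfold constStart
      linarith
    have hk2 : Q.τ k ≤ Q.constStart k + Q.initTime := by
      have h1 := pc_mul_sub_constStart hQ k
      have h2 := energyLeft_lt_energy_n hk
      rw [← h1, ← hEn] at h2
      have := lt_of_mul_lt_mul_left h2 hpc.le
      linarith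
    refine ⟨⟨rfl, ?_, h0, by simp [hpc.le]⟩, fun t ht => ?_⟩
    · simp only [List.pairwise_cons, List.mem_cons, List.not_mem_nil, or_false]
      refine ⟨?_, ?_, by simp, List.Pairwise.nil⟩
      · rintro a (rfl | rfl)
        · exact hk1
        · exact hk1.trans hk2
      · rintro a rfl
        exact hk2
    · rw [Policy.used_eq _ _ _ (by rfl), constPolicy_flow]
      rw [Policy.finish_eq _ _ _ (by rfl)] at ht
      have ht2 : t ≤ Q.constStart k + Q.initTime := ht.2
      rw [min_eq_right ht2]
      rcases le_total t (Q.constStart k) with hc | hc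
      · rw [min_eq_right hc, sub_self, mul_zero]
        exact Q.energy_nonneg t
      · rw [min_eq_left hc]
        obtain ⟨j, hj, he, -⟩ := Q.exists_next t
        rw [he]
        rcases le_or_gt j Q.n with hjn | hjn
        · refine le_trans ?_ (h j hjn)
          exact mul_le_mul_of_nonneg_left (by linarith) hpc.le
        · refine le_trans ?_ (energy_n_le (Q.τ_lt.2 hjn))
          rw [← hEn]
          exact mul_le_mul_of_nonneg_left (by linarith) hpc.le

/-- `q` is the first corner with the supporting property. -/
theorem q_spec (hQ : ∃ Y, Q.Feasible Y) : Q.q ≤ Q.n ∧ Q.Supports Q.q ∧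
    ∀ j < Q.q, Q.pc * (Q.τ j - Q.constStart Q.q) < Q.energyLeft (Q.τ j) := by
  have hpc := pc_pos hQ
  have hex : ∃ k, k ≤ Q.n ∧ Q.EnergyFeasible (Q.constPolicy k) := by
    obtain ⟨k, hk, hmin⟩ := Finset.exists_min_image (Finset.range (Q.n + 1))
      (fun k => Q.energyLeft (Q.τ k) - Q.pc * Q.τ k) ⟨0, by simp⟩
    have hkn : k ≤ Q.n := Nat.lt_succ_iff.1 (Finset.mem_range.1 hk)
    refine ⟨k, hkn, (energyFeasible_constPolicy_iff hQ hkn).2 fun j hj => ?_⟩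
    have h1 := hmin j (Finset.mem_range.2 (Nat.lt_succ_of_le hj))
    have h2 := pc_mul_sub_constStart hQ k
    linarith
  obtain ⟨h1, h2⟩ : Q.q ≤ Q.n ∧ Q.EnergyFeasible (Q.constPolicy Q.q) := Nat.sInf_mem hex
  have h3 := (energyFeasible_constPolicy_iff hQ h1).1 h2
  refine ⟨h1, h3, fun j hj => lt_of_le_of_ne (h3 j (hj.le.trans h1)) fun he => ?_⟩
  refine Nat.notMem_of_lt_sInf (show j < sInf _ from hj) ⟨hj.le.trans h1, ?_⟩
  refine (energyFeasible_constPolicy_iff hQ (hj.le.trans h1)).2 fun i hi => ?_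
  have h4 := pc_mul_sub_constStart hQ j
  have h5 := h3 i hi
  linarith

/-- The constant power policy ends after `τ_n`, and it is feasible up to its end. -/
theorem constLine_spec (hQ : ∃ Y, Q.Feasible Y) :
    Q.τ Q.n < Q.constStart Q.q + Q.initTime ∧
      ∀ j, Q.τ j < Q.constStart Q.q + Q.initTime →
        Q.pc * (Q.τ j - Q.constStart Q.q) ≤ Q.energyLeft (Q.τ j) := by
  have hpc := pc_pos hQ
  have hEn := pc_mul_initTime hQ
  obtain ⟨h1, h2, h3⟩ := q_spec hQ
  constructor
  · have k1 := (h2 Q.n le_rfl).trans_lt (energyLeft_lt_energy_n le_rfl)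
    rw [← hEn] at k1
    have := lt_of_mul_lt_mul_left k1 hpc.le
    linarith
  · intro j hj
    rcases le_or_gt j Q.n with hjn | hjn
    · exact h2 j hjn
    · refine le_trans ?_ (energy_n_le (Q.τ_lt.2 hjn))
      rw [← hEn]
      exact mul_le_mul_of_nonneg_left (by linarith) hpc.le

theorem constStart_le (hQ : ∃ Y, Q.Feasible Y) : Q.constStart Q.q ≤ Q.τ Q.q := by
  have := div_nonneg (Q.energyLeft_nonneg (Q.τ Q.q)) (pc_pos hQ).le
  unfold constStart
  linarith

/-- A point of the energy curve on a line that starts at energy zero: the line starts before it, or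
both are at time zero. -/
theorem eq_zero_or_lt_of_level {a x : ℝ} {i : ℕ} (h : a ≤ Q.τ i)
    (he : x * (Q.τ i - a) = Q.energyLeft (Q.τ i)) : a = 0 ∨ a < Q.τ i := by
  rcases h.eq_or_lt with h | h
  · left
    rw [h, sub_self, mul_zero] at he
    rw [h]
    by_contra hne
    exact (Q.energyLeft_pos (lt_of_le_of_ne (Q.τ_nonneg i) (Ne.symm hne))).ne he
  · exact Or.inr h

theorem pullBackInit_eq {r : ℝ → ℝ → Prop} {S : State} (h : Q.initPolicy = S.policy)
    (hv : Q.Valid r S) : Q.pullBackInit = S := by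
  obtain ⟨s, hs⟩ := hv.head
  obtain ⟨s₀, hs₀⟩ := hv.last
  have hlen := hv.length_eq
  have hfin := hv.finish_eq
  have hl : s₀.length = S.p.length := by
    rw [hs₀] at hlen; simpa using hlen
  unfold pullBackInit
  rw [h]
  simp only [hfin]
  cases S with
  | mk tl tr tBegin tEnd pl pr p s' =>
    simp only at hs hs₀ hl
    simp only [State.policy, Policy.start, Policy.time, Policy.pow, Policy.N]
    congr 1
    · subst hs
      rfl
    · subst hs₀
      simp [List.getD_eq_getElem?_getD, ← hl]
    · simp [List.getD_eq_getElem?_getD]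
    · simp
    · simp

/-- The case in which the constant power policy uses up the energy harvested before its end. -/
theorem exists_valid_init_of_const (hQ : ∃ Y, Q.Feasible Y)
    (hcase : ¬ (Q.constPolicy Q.q).used (Q.constPolicy Q.q).finish
      < Q.energyLeft (Q.constPolicy Q.q).finish) :
    ∃ S, Q.initPolicy = S.policy ∧ Q.Valid (· < ·) S ∧ S.tEnd - S.tBegin ≤ Q.Γ₀ := by
  classical
  have hpc := pc_pos hQ
  obtain ⟨hT0, hTΓ, hTB⟩ := initTime_spec hQ
  have hEn := pc_mul_initTime hQ
  obtain ⟨hqn, hsup, hlt⟩ := q_spec hQ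
  obtain ⟨hend, hline⟩ := constLine_spec hQ
  have hfin : (Q.constPolicy Q.q).finish = Q.constStart Q.q + Q.initTime := by
    rw [constPolicy_eq hQ, Policy.finish_eq _ _ _ (by rfl)]; rfl
  have hused : ∀ t, (Q.constPolicy Q.q).used t
      = Q.pc * (min (Q.constStart Q.q + Q.initTime) t - min (Q.constStart Q.q) t) := fun t => by
    rw [constPolicy_eq hQ, Policy.used_eq _ _ _ (by rfl), constPolicy_flow]
  have hstart : (Q.constPolicy Q.q).start = Q.constStart Q.q := by
    rw [constPolicy_eq hQ]; rfl
  have hmem : ∀ i, i ∈ (Q.before (Q.constPolicy Q.q).finish).filter (fun i =>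
      Q.q ≤ i ∧ (Q.constPolicy Q.q).used (Q.τ i) = Q.energyLeft (Q.τ i)) ↔
      Q.τ i < Q.constStart Q.q + Q.initTime ∧ Q.q ≤ i ∧
        Q.pc * (Q.τ i - Q.constStart Q.q) = Q.energyLeft (Q.τ i) := by
    intro i
    rw [Finset.mem_filter, mem_before, hfin, hused]
    refine and_congr_right fun h1 => and_congr_right fun h2 => ?_
    rw [min_eq_right h1.le, min_eq_left ((constStart_le hQ).trans (Q.τ_le.2 h2))]
  have hq_mem : Q.τ Q.q ∈ Q.initEpochs := by
    refine List.mem_map.2 ⟨Q.q, (Finset.mem_sort _).2 ((hmem _).2 ⟨?_, le_rfl, ?_⟩), rfl⟩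
    · exact (Q.τ_le.2 hqn).trans_lt hend
    · exact pc_mul_sub_constStart hQ _
  have hpath : Q.Path (· < ·) (Q.constStart Q.q) 0
      (Q.initEpochs ++ [Q.constStart Q.q + Q.initTime])
      (List.replicate (Q.initEpochs.length + 1) Q.pc) := by
    refine path_of_line_sort _ (fun i hi => ?_) (fun i hi h1 h2 => ?_) (by linarith) ?_
    · obtain ⟨h1, h2, h3⟩ := (hmem i).1 hi
      have h4 := (constStart_le hQ).trans (Q.τ_le.2 h2)
      exact ⟨h4, eq_zero_or_lt_of_level h4 h3, h1, by rw [zero_add, h3]⟩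
    · rw [zero_add]
      rcases lt_or_ge i Q.q with hiq | hiq
      · exact hlt i hiq
      · exact lt_of_le_of_ne (hline i h2) fun he => hi ((hmem i).2 ⟨h2, hiq, he⟩)
    · rw [zero_add, add_sub_cancel_left, hEn]
      refine le_antisymm (energy_n_le hend) ?_
      rw [hused, hfin, min_self, min_eq_left (by linarith), add_sub_cancel_left, hEn] at hcase
      exact not_lt.1 hcase
  obtain ⟨l₀, L, hL⟩ : ∃ l₀ L, Q.initEpochs = l₀ :: L :=
    List.exists_cons_of_ne_nil (List.ne_nil_of_mem hq_mem)
  have hrep : Q.pc :: (List.replicate L.length Q.pc ++ [Q.pc])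
      = List.replicate (Q.initEpochs.length + 1) Q.pc := by
    rw [hL, List.length_cons, List.replicate_succ, List.replicate_succ']
  refine ⟨{ tl := l₀, tr := L.getLastD l₀, tBegin := Q.constStart Q.q
            tEnd := Q.constStart Q.q + Q.initTime, pl := Q.pc, pr := Q.pc
            p := List.replicate L.length Q.pc, s := Q.initEpochs }, ?_,
    ⟨hsup.nonneg hQ, ⟨L, hL⟩, ?_, ?_, hpc, ?_, fun t ht => mem_epochs_of_map ht, hq_mem, ?_⟩, ?_⟩
  · rw [State.policy_eq]
    simp only [initPolicy]
    rw [if_neg hcase, hrep, hstart, hfin]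
    rfl
  · rcases List.eq_nil_or_concat L with rfl | ⟨L', b, hc⟩
    · exact ⟨[], hL⟩
    · rw [List.concat_eq_append] at hc
      subst hc
      exact ⟨l₀ :: L', by simp [hL]⟩
  · simp only [hrep]
    exact hpath
  · simp only [hrep]
    exact List.pairwise_replicate.2 (Or.inr le_rfl)
  · simp only [hrep]
    rw [total_replicate Q.g Q.pc _ _ _ (by simp) fun y hy => List.eq_of_mem_replicate hy,
      List.getLastD_concat, add_sub_cancel_left, ← hTB, sent, mul_comm]
    rfl
  · simp only [add_sub_cancel_left]
    exact hTΓ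

end Problem

/-! ### The transmitter-only algorithm -/

/-- An invariant of a loop that terminates holds for its final value, where the guard fails. -/
theorem whileLoop_spec {σ : Type} {guard : σ → Prop} {body : σ → σ} {I : σ → Prop} {x : σ}
    (h0 : I x) (hstep : ∀ y, I y → guard y → I (body y))
    (hterm : ∃ k, ¬ guard (body^[k] x)) :
    I (whileLoop guard body x) ∧ ¬ guard (whileLoop guard body x) := by
  refine ⟨?_, Nat.sInf_mem (s := {k | ¬ guard (body^[k] x)}) hterm⟩
  have key : ∀ k ≤ loopCount guard body x, I (body^[k] x) := by
    intro k
    induction k with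
    | zero => intro _; exact h0
    | succ k ih =>
      intro hk
      rw [Function.iterate_succ_apply']
      refine hstep _ (ih (by omega)) ?_
      by_contra hc
      exact Nat.notMem_of_lt_sInf (s := {k | ¬ guard (body^[k] x)}) (show k < sInf _ from hk) hc
  exact key _ le_rfl

theorem total_ge {g : ℝ → ℝ} {c : ℝ} (s : List ℝ) : ∀ (a : ℝ) (p : List ℝ),
    s.length = p.length → (a :: s).Pairwise (· ≤ ·) → (∀ x ∈ p, c ≤ g x) →
      c * (s.getLastD a - a) ≤ total g a p s := by
  induction s with
  | nil =>
    intro a p h _ _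
    have : p = [] := List.length_eq_zero_iff.1 h.symm
    simp [this]
  | cons b s ih =>
    intro a p h hs hp
    cases p with
    | nil => simp at h
    | cons x p =>
      have hab : a ≤ b := (List.pairwise_cons.1 hs).1 b (by simp)
      have := ih b p (by simpa using h) (List.pairwise_cons.1 hs).2 fun y hy => hp y (by simp [hy])
      rw [total_cons, List.getLastD_cons]
      have := mul_le_mul_of_nonneg_right (hp x (by simp)) (sub_nonneg.2 hab)
      linarith

namespace Problem

variable (Q : Problem)

/-- The energy harvested in `[τ_m, τ_k)`. -/
noncomputable def between (m k : ℕ) : ℝ := Q.energyLeft (Q.τ k) - Q.energyLeft (Q.τ m)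

/-- The `b` bits can be sent at constant power from `τ_m` to some epoch `τ_k`. -/
def HasHorizon (m : ℕ) (b : ℝ) : Prop :=
  ∃ k, m < k ∧ b ≤ sent Q.g (Q.between m k) (Q.τ k - Q.τ m)

variable {Q}

theorem between_pos {m k : ℕ} (h : m < k) : 0 < Q.between m k :=
  sub_pos.2 (Q.energyLeft_lt le_rfl (Q.τ_lt.2 h))

theorem between_mono {m k l : ℕ} (h : k ≤ l) : Q.between m k ≤ Q.between m l :=
  sub_le_sub_right (Q.energyLeft_mono (Q.τ_le.2 h)) _

theorem chord_eq (m k : ℕ) : Q.chord (Q.τ m) (Q.τ k) = Q.between m k / (Q.τ k - Q.τ m) := rfl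

theorem chord_pos {m k : ℕ} (h : m < k) : 0 < Q.chord (Q.τ m) (Q.τ k) :=
  div_pos (between_pos h) (sub_pos.2 (Q.τ_lt.2 h))

/-- The horizon `h`, and the power that sends the `b` bits with the energy harvested up to it. -/
theorem HasHorizon.spec {m : ℕ} {b : ℝ} (h : Q.HasHorizon m b) (hb : 0 < b) :
    m < Q.txHorizon m b ∧
      (∀ i, m < i → i < Q.txHorizon m b →
        sent Q.g (Q.between m i) (Q.τ i - Q.τ m) < b) ∧
      0 < Q.txTime m b ∧ Q.txTime m b ≤ Q.τ (Q.txHorizon m b) - Q.τ m ∧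
      sent Q.g (Q.between m (Q.txHorizon m b)) (Q.txTime m b) = b ∧ 0 < Q.txPower m b ∧
      Q.txPower m b * Q.txTime m b = Q.between m (Q.txHorizon m b) := by
  obtain ⟨h1, h2⟩ : m < Q.txHorizon m b ∧ b ≤ sent Q.g (Q.between m (Q.txHorizon m b))
      (Q.τ (Q.txHorizon m b) - Q.τ m) := Nat.sInf_mem h
  have hH := between_pos (Q := Q) h1
  have hτ := sub_pos.2 (Q.τ_lt.2 h1)
  have hex : ∃ T, 0 < T ∧ T * Q.g (Q.txEnergy m b / T) = b := by
    obtain ⟨T, k1, -, k2⟩ := Q.rate.exists_time hH hτ hb h2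
    exact ⟨T, k1, k2⟩
  obtain ⟨k1, k2⟩ := solve_spec hex
  change 0 < Q.txTime m b at k1
  change sent Q.g (Q.between m (Q.txHorizon m b)) (Q.txTime m b) = b at k2
  refine ⟨h1, fun i hi hih => ?_, k1, ?_, k2, div_pos hH k1, div_mul_cancel₀ _ k1.ne'⟩
  · by_contra! hc
    exact Nat.notMem_of_lt_sInf (show i < sInf _ from hih) ⟨hi, hc⟩
  · exact Q.rate.time_le_of_sent_le hH hτ (k2.le.trans h2)

theorem HasHorizon.chord_le_txPower {m : ℕ} {b : ℝ} (h : Q.HasHorizon m b) (hb : 0 < b) :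
    Q.chord (Q.τ m) (Q.τ (Q.txHorizon m b)) ≤ Q.txPower m b := by
  obtain ⟨h1, -, h3, h4, -, h6, h7⟩ := h.spec hb
  rw [chord_eq, div_le_iff₀ (sub_pos.2 (Q.τ_lt.2 h1)), ← h7]
  exact mul_le_mul_of_nonneg_left h4 h6.le

/-- The power that the algorithm uses if it has to be reduced: the smallest chord, up to the first
epoch that attains it. -/
theorem txNext_spec {S : TxState} (hg : Q.txGuard S) :
    S.m < Q.txNext S.m S.b ∧ Q.txNext S.m S.b < Q.txHorizon S.m S.b ∧
      (∀ k, S.m < k → k < Q.txHorizon S.m S.b →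
        Q.chord (Q.τ S.m) (Q.τ (Q.txNext S.m S.b)) ≤ Q.chord (Q.τ S.m) (Q.τ k)) ∧
      (∀ k, S.m < k → k < Q.txNext S.m S.b →
        Q.chord (Q.τ S.m) (Q.τ (Q.txNext S.m S.b)) < Q.chord (Q.τ S.m) (Q.τ k)) ∧
      Q.chord (Q.τ S.m) (Q.τ (Q.txNext S.m S.b)) ≤ Q.txPower S.m S.b := by
  unfold txGuard at hg
  push Not at hg
  obtain ⟨i₀, h1, h2, h3⟩ := hg
  have hex : ∃ i, S.m < i ∧ i < Q.txHorizon S.m S.b ∧ ∀ i', S.m < i' →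
      i' < Q.txHorizon S.m S.b → Q.chord (Q.τ S.m) (Q.τ i) ≤ Q.chord (Q.τ S.m) (Q.τ i') := by
    obtain ⟨i, hi, hmin⟩ := Finset.exists_min_image (Finset.Ioo S.m (Q.txHorizon S.m S.b))
      (fun i => Q.chord (Q.τ S.m) (Q.τ i)) ⟨i₀, Finset.mem_Ioo.2 ⟨h1, h2⟩⟩
    obtain ⟨k1, k2⟩ := Finset.mem_Ioo.1 hi
    exact ⟨i, k1, k2, fun i' hi1 hi2 => hmin i' (Finset.mem_Ioo.2 ⟨hi1, hi2⟩)⟩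
  obtain ⟨k1, k2, k3⟩ : S.m < Q.txNext S.m S.b ∧ Q.txNext S.m S.b < Q.txHorizon S.m S.b ∧
      ∀ i', S.m < i' → i' < Q.txHorizon S.m S.b →
        Q.chord (Q.τ S.m) (Q.τ (Q.txNext S.m S.b)) ≤ Q.chord (Q.τ S.m) (Q.τ i') :=
    Nat.sInf_mem hex
  refine ⟨k1, k2, k3, fun k hk1 hk2 => ?_, (k3 i₀ h1 h2).trans h3⟩
  by_contra! hc
  exact Nat.notMem_of_lt_sInf (show k < sInf _ from hk2)
    ⟨hk1, hk2.trans k2, fun i' hi1 hi2 => hc.trans (k3 i' hi1 hi2)⟩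

variable (Q)

/-- Loop invariant of the transmitter-only algorithm for `b₀` bits from `τ_q` on, when all powers
are at least `p_c`. The number `lo` is the last power used. -/
structure TxInv (b₀ : ℝ) (S : TxState) : Prop where
  path : ∃ s, S.s = Q.τ Q.q :: s ∧ s.getLastD (Q.τ Q.q) = Q.τ S.m ∧
    Q.Path (· < ·) (Q.τ Q.q) (Q.energyLeft (Q.τ Q.q)) s S.p ∧ total Q.g (Q.τ Q.q) S.p s + S.b = b₀
  epochs : ∀ t ∈ S.s, ∃ j, t = Q.τ j
  bits_pos : 0 < S.b
  horizon : Q.HasHorizon S.m S.b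
  sorted : S.p.Pairwise (· ≤ ·)
  ge_pc : ∀ x ∈ S.p, Q.pc ≤ x
  lower : ∃ lo, Q.pc ≤ lo ∧ (∀ x ∈ S.p, x ≤ lo) ∧ lo ≤ Q.txPower S.m S.b ∧
    ∀ i, S.m < i → i < Q.txHorizon S.m S.b → lo ≤ Q.chord (Q.τ S.m) (Q.τ i)

variable {Q}

/-- If the smallest chord `x` is used up to its epoch, then the remaining bits can still be sent with
powers at least `x`: up to the old horizon the later chords are at least `x`, and beyond it the
energy is more than enough for the old power, which is at least `x`. -/
theorem TxInv.step {b₀ : ℝ} {S : TxState} (h : Q.TxInv b₀ S) (hg : Q.txGuard S) :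
    Q.TxInv b₀ (Q.txStep S) := by
  obtain ⟨k1, k2, k3, k4, k5, k6, k7⟩ := h.horizon.spec h.bits_pos
  obtain ⟨j1, j2, j3, j4, j5⟩ := txNext_spec hg
  obtain ⟨lo, l1, l2, l3, l4⟩ := h.lower
  set m := S.m
  set b := S.b
  set i := Q.txNext m b with hi
  set H := Q.txHorizon m b with hH
  set x := Q.chord (Q.τ m) (Q.τ i) with hx
  set P := Q.txPower m b with hP
  have hx0 : 0 < x := chord_pos j1
  have hxi : x * (Q.τ i - Q.τ m) = Q.between m i := Q.chord_mul (Q.τ_lt.2 j1)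
  have hτi : 0 < Q.τ i - Q.τ m := sub_pos.2 (Q.τ_lt.2 j1)
  set b' := b - Q.g x * (Q.τ i - Q.τ m) with hb'
  have hlox : lo ≤ x := l4 i j1 j2
  have hb'0 : 0 < b' := by
    have : (Q.τ i - Q.τ m) * Q.g x < b := k2 i j1 j2
    rw [hb']
    linarith
  have hsplit : Q.between m H = Q.between m i + Q.between i H := by unfold between; ring
  have hiH := between_pos (Q := Q) j2
  set T := Q.between i H / P with hT
  have hT0 : 0 < T := div_pos hiH k6
  have hPT : P * T = Q.between i H := mul_div_cancel₀ _ k6.ne'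
  -- the remaining energy up to the old horizon sends the remaining bits at the old power
  have hrem : b' ≤ T * Q.g P := by
    have e1 : b = Q.txTime m b * Q.g P := by
      conv_lhs => rw [← k5]
      rw [sent, ← k7, mul_div_cancel_right₀ _ k3.ne']
    have e2 : Q.txTime m b = (x * (Q.τ i - Q.τ m)) / P + T := by
      rw [hxi, hT, ← add_div, ← hsplit, ← k7, mul_div_cancel_left₀ _ k6.ne']
    have e3 : x * (Q.τ i - Q.τ m) / P * Q.g P ≤ Q.g x * (Q.τ i - Q.τ m) := by
      have e4 : Q.g P / P ≤ Q.g x / x :=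
        Q.rate.div_anti.antitoneOn (Set.mem_Ioi.2 hx0) (Set.mem_Ioi.2 k6) j5
      rw [le_div_iff₀ hx0] at e4
      have := mul_le_mul_of_nonneg_right e4 hτi.le
      calc x * (Q.τ i - Q.τ m) / P * Q.g P = Q.g P / P * x * (Q.τ i - Q.τ m) := by ring
        _ ≤ _ := this
    rw [hb', e1, e2]
    linarith
  have hsentT : sent Q.g (Q.between i H) T = T * Q.g P := by
    rw [hT, sent_div _ hiH.ne']
  have hor : Q.HasHorizon i b' := by
    obtain ⟨k, hk⟩ := ((Q.τ_tendsto.eventually_ge_atTop (Q.τ i + T)).and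
      (eventually_ge_atTop H)).exists
    have hik : i < k := j2.trans_le hk.2
    refine ⟨k, hik, hrem.trans ?_⟩
    rw [← hsentT]
    refine (Q.rate.sent_le_of_time_le hiH hT0 (show T ≤ Q.τ k - Q.τ i by linarith)).trans ?_
    exact Q.rate.sent_le_of_energy_le hiH.le (sub_pos.2 (Q.τ_lt.2 hik)) (between_mono hk.2)
  obtain ⟨k1', k2', k3', k4', k5', k6', k7'⟩ := hor.spec hb'0
  set H' := Q.txHorizon i b' with hH'
  have hchord : ∀ j, i < j → j < H → x ≤ Q.chord (Q.τ i) (Q.τ j) := by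
    intro j hij hj
    have := j3 j (j1.trans hij) hj
    rw [chord_eq, le_div_iff₀ (sub_pos.2 (Q.τ_lt.2 (j1.trans hij)))] at this
    rw [chord_eq, le_div_iff₀ (sub_pos.2 (Q.τ_lt.2 hij))]
    have e : Q.between m j = Q.between m i + Q.between i j := by unfold between; ring
    rw [e, ← hxi] at this
    linarith
  have hlow : ∀ j, i < j → j < H' → x ≤ Q.chord (Q.τ i) (Q.τ j) := by
    intro j hij hj
    rcases lt_or_ge j H with hjH | hjH
    · exact hchord j hij hjH
    · have e1 := between_mono (Q := Q) (m := i) hjH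
      have hij' := sub_pos.2 (Q.τ_lt.2 hij)
      have e2 : Q.τ j - Q.τ i < T := by
        refine Q.rate.time_lt_of_sent_lt (between_pos hij) hT0 ((k2' j hij hj).trans_le ?_)
        rw [← hsentT] at hrem
        exact hrem.trans (Q.rate.sent_le_of_energy_le hiH.le hT0 e1)
      refine j5.trans ?_
      rw [chord_eq, le_div_iff₀ hij']
      have := mul_le_mul_of_nonneg_left e2.le k6.le
      linarith
  have hpow : x ≤ Q.txPower i b' := by
    rcases lt_or_ge H' H with hlt | hge
    · exact (hchord H' k1' hlt).trans (hor.chord_le_txPower hb'0)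
    · refine j5.trans ?_
      by_contra! hc
      have e1 : Q.between i H ≤ Q.between i H' := between_mono hge
      have hpos := between_pos (Q := Q) k1'
      have e2 : Q.between i H' / P < Q.txTime i b' := by
        rw [div_lt_iff₀ k6, ← k7']
        have := mul_lt_mul_of_pos_left hc k3'
        linarith
      have e3 := Q.rate.sent_lt_of_time_lt hpos (div_pos hpos k6) e2
      rw [k5', sent_div _ hpos.ne'] at e3
      have e4 : T * Q.g P ≤ Q.between i H' / P * Q.g P :=
        mul_le_mul_of_nonneg_right (div_le_div_of_nonneg_right e1 k6.le) (Q.rate.pos k6).le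
      linarith
  obtain ⟨s, hs1, hs2, hs3, hs4⟩ := h.path
  refine ⟨⟨s ++ [Q.τ i], ?_, ?_, ?_, ?_⟩, ?_, hb'0, hor, ?_, ?_, x, l1.trans hlox, ?_, hpow, hlow⟩
  · show S.s ++ [Q.τ i] = _
    rw [hs1]
    rfl
  · exact List.getLastD_concat
  · show Q.Path _ _ _ (s ++ [Q.τ i]) (S.p ++ [x])
    rw [path_concat, hs2]
    refine ⟨hs3, (Q.τ_lt.2 j1).le, Or.inr (Q.τ_lt.2 j1), ?_, fun k hk1 hk2 => ?_⟩
    · rw [hxi]; unfold between; ring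
    · have e1 := Q.τ_lt.1 hk1
      have := j4 k e1 (Q.τ_lt.1 hk2)
      rw [chord_eq, lt_div_iff₀ (sub_pos.2 hk1)] at this
      unfold between at this
      linarith
  · show total Q.g _ (S.p ++ [x]) (s ++ [Q.τ i]) + b' = _
    rw [total_concat _ _ _ _ _ _ hs3.length_eq, hs2, hb']
    linarith
  · intro t ht
    rcases List.mem_append.1 (show t ∈ S.s ++ [Q.τ i] from ht) with ht | ht
    · exact h.epochs t ht
    · exact ⟨i, List.mem_singleton.1 ht⟩
  · show (S.p ++ [x]).Pairwise _
    refine List.pairwise_append.2 ⟨h.sorted, by simp, fun y hy z hz => ?_⟩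
    rw [List.mem_singleton.1 hz]
    exact (l2 y hy).trans hlox
  · intro y hy
    rcases List.mem_append.1 (show y ∈ S.p ++ [x] from hy) with hy | hy
    · exact h.ge_pc y hy
    · rw [List.mem_singleton.1 hy]
      exact l1.trans hlox
  · intro y hy
    rcases List.mem_append.1 (show y ∈ S.p ++ [x] from hy) with hy | hy
    · exact (l2 y hy).trans hlox
    · exact (List.mem_singleton.1 hy).le

/-- Since all powers are at least `p_c`, the bits bound the time. -/
theorem TxInv.time_le {b₀ : ℝ} {S : TxState} (h : Q.TxInv b₀ S) (hpc : 0 < Q.pc) :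
    Q.g Q.pc * (Q.τ S.m - Q.τ Q.q) + S.b ≤ b₀ := by
  obtain ⟨s, hs1, hs2, hs3, hs4⟩ := h.path
  have := total_ge (g := Q.g) (c := Q.g Q.pc) s _ _ hs3.length_eq hs3.pairwise fun x hx =>
    Q.rate.mono.monotoneOn (Set.mem_Ici.2 hpc.le) (Set.mem_Ici.2 (hpc.le.trans (h.ge_pc x hx)))
      (h.ge_pc x hx)
  rw [hs2] at this
  linarith

/-- Every iteration moves on to a later epoch, while the bits bound the time. -/
theorem tx_terminates {b₀ : ℝ} {S : TxState} (h : Q.TxInv b₀ S) (hpc : 0 < Q.pc) :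
    ∃ k, ¬ Q.txGuard (Q.txStep^[k] S) := by
  by_contra! hall
  have key : ∀ k, Q.TxInv b₀ (Q.txStep^[k] S) ∧ k ≤ (Q.txStep^[k] S).m := by
    intro k
    induction k with
    | zero => exact ⟨h, Nat.zero_le _⟩
    | succ k ih =>
      rw [Function.iterate_succ_apply']
      refine ⟨ih.1.step (hall k), ?_⟩
      have := (txNext_spec (hall k)).1
      exact lt_of_le_of_lt ih.2 this
  obtain ⟨k, hk⟩ := (Q.τ_tendsto.eventually_gt_atTop (Q.τ Q.q + b₀ / Q.g Q.pc)).exists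
  have h1 := (key k).1.time_le hpc
  have h2 := (key k).1.bits_pos
  have h3 := Q.τ_le.2 (key k).2
  have hg := Q.rate.pos hpc
  have h4 : b₀ / Q.g Q.pc < Q.τ (Q.txStep^[k] S).m - Q.τ Q.q := by linarith
  rw [div_lt_iff₀ hg] at h4
  linarith

theorem txInv_init (hQ : ∃ Y, Q.Feasible Y) :
    Q.TxInv (Q.g Q.pc * (Q.constStart Q.q + Q.initTime - Q.τ Q.q))
      ⟨Q.q, Q.g Q.pc * (Q.constStart Q.q + Q.initTime - Q.τ Q.q), [], [Q.τ Q.q]⟩ := by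
  have hpc := pc_pos hQ
  obtain ⟨hqn, hsup, hlt⟩ := q_spec hQ
  obtain ⟨hend, hline⟩ := constLine_spec hQ
  have hEn := pc_mul_initTime hQ
  have hEq := pc_mul_sub_constStart hQ Q.q
  set φ := Q.constStart Q.q + Q.initTime with hφ
  have hq : Q.τ Q.q < φ := (Q.τ_le.2 hqn).trans_lt hend
  set D := φ - Q.τ Q.q with hD
  have hD0 : 0 < D := sub_pos.2 hq
  -- the energy that the constant power policy spends after `τ_q`
  have hH0 : ∀ k, φ ≤ Q.τ k → Q.pc * D ≤ Q.between Q.q k := by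
    intro k hk
    have h1 := energy_n_le (hend.trans_le hk)
    have h2 : Q.pc * D = Q.pc * Q.initTime - Q.pc * (Q.τ Q.q - Q.constStart Q.q) := by
      rw [hD, hφ]; ring
    rw [h2, hEn, hEq]
    exact sub_le_sub_right h1 _
  have hpcD : 0 < Q.pc * D := mul_pos hpc hD0
  have hb0 : sent Q.g (Q.pc * D) D = Q.g Q.pc * D := by
    rw [sent, mul_div_cancel_right₀ _ hD0.ne', mul_comm]
  have hreach : ∀ k, φ ≤ Q.τ k →
      Q.g Q.pc * D ≤ sent Q.g (Q.between Q.q k) (Q.τ k - Q.τ Q.q) := by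
    intro k hk
    rw [← hb0]
    refine (Q.rate.sent_le_of_energy_le hpcD.le hD0 (hH0 k hk)).trans ?_
    exact Q.rate.sent_le_of_time_le (hpcD.trans_le (hH0 k hk)) hD0 (by linarith)
  have hb : 0 < Q.g Q.pc * D := mul_pos (Q.rate.pos hpc) hD0
  have hor : Q.HasHorizon Q.q (Q.g Q.pc * D) := by
    obtain ⟨k, hk⟩ := (Q.τ_tendsto.eventually_ge_atTop φ).exists
    exact ⟨k, Q.τ_lt.1 (hq.trans_le hk), hreach k hk⟩
  have hchord : ∀ i, Q.q < i → Q.τ i < φ → Q.pc ≤ Q.chord (Q.τ Q.q) (Q.τ i) := by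
    intro i hi hiφ
    rw [chord_eq, le_div_iff₀ (sub_pos.2 (Q.τ_lt.2 hi))]
    have := hline i hiφ
    unfold between
    linarith
  obtain ⟨k1, k2, k3, k4, k5, k6, k7⟩ := hor.spec hb
  refine ⟨⟨[], rfl, rfl, by simp, by simp⟩, by simp, hb, hor, by simp, by simp, Q.pc, le_rfl,
    by simp, ?_, fun i hi hih => hchord i hi ?_⟩
  · show Q.pc ≤ Q.txPower Q.q (Q.g Q.pc * D)
    rcases lt_or_ge (Q.τ (Q.txHorizon Q.q (Q.g Q.pc * D))) φ with hc | hc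
    · exact (hchord _ k1 hc).trans (hor.chord_le_txPower hb)
    · by_contra! hlt'
      have e1 := hH0 _ hc
      have hpos := between_pos (Q := Q) k1
      have e2 : Q.between Q.q (Q.txHorizon Q.q (Q.g Q.pc * D)) / Q.pc
          < Q.txTime Q.q (Q.g Q.pc * D) := by
        rw [div_lt_iff₀ hpc, ← k7]
        have := mul_lt_mul_of_pos_left hlt' k3
        linarith
      have e3 := Q.rate.sent_lt_of_time_lt hpos (div_pos hpos hpc) e2
      rw [k5, sent_div _ hpos.ne'] at e3
      have e4 : D ≤ Q.between Q.q (Q.txHorizon Q.q (Q.g Q.pc * D)) / Q.pc := by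
        rw [le_div_iff₀ hpc]; linarith
      have e5 := mul_le_mul_of_nonneg_right e4 (Q.rate.pos hpc).le
      linarith
  · by_contra! hc
    exact absurd (hreach i hc) (not_le.2 (k2 i hi hih))

/-- The case in which INIT_POLICY continues with the transmitter-only algorithm. -/
theorem exists_valid_init_of_tx (hQ : ∃ Y, Q.Feasible Y)
    (hcase : (Q.constPolicy Q.q).used (Q.constPolicy Q.q).finish
      < Q.energyLeft (Q.constPolicy Q.q).finish) :
    ∃ S, Q.initPolicy = S.policy ∧ Q.Valid (· < ·) S ∧ S.tEnd - S.tBegin ≤ Q.Γ₀ := by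
  have hpc := pc_pos hQ
  obtain ⟨hT0, hTΓ, hTB⟩ := initTime_spec hQ
  obtain ⟨hqn, hsup, hlt⟩ := q_spec hQ
  have hEq := pc_mul_sub_constStart hQ Q.q
  have hfin : (Q.constPolicy Q.q).finish = Q.constStart Q.q + Q.initTime := by
    rw [constPolicy_eq hQ, Policy.finish_eq _ _ _ (by rfl)]; rfl
  have hstart : (Q.constPolicy Q.q).start = Q.constStart Q.q := by
    rw [constPolicy_eq hQ]; rfl
  have h0 := txInv_init hQ
  set b₀ := Q.g Q.pc * (Q.constStart Q.q + Q.initTime - Q.τ Q.q) with hb₀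
  obtain ⟨hI, hG⟩ := whileLoop_spec h0 (fun S h hg => h.step hg) (tx_terminates h0 hpc)
  set S := whileLoop Q.txGuard Q.txStep ⟨Q.q, b₀, [], [Q.τ Q.q]⟩ with hS
  have hpol : Q.initPolicy = ⟨Q.pc :: (S.p ++ [Q.txPower S.m S.b]),
      Q.constStart Q.q :: (S.s ++ [Q.τ S.m + Q.txTime S.m S.b])⟩ := by
    simp only [initPolicy]
    rw [if_pos hcase, hstart, hfin]
    rfl
  have hguard : ∀ i, S.m < i → i < Q.txHorizon S.m S.b →
      Q.txPower S.m S.b < Q.chord (Q.τ S.m) (Q.τ i) := by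
    unfold txGuard at hG
    exact not_not.1 hG
  obtain ⟨k1, k2, k3, k4, k5, k6, k7⟩ := hI.horizon.spec hI.bits_pos
  obtain ⟨lo, l1, l2, l3, l4⟩ := hI.lower
  obtain ⟨s, hs1, hs2, hs3, hs4⟩ := hI.path
  have htime := hI.time_le hpc
  set P := Q.txPower S.m S.b
  set T := Q.txTime S.m S.b
  have hPb : Q.g P * T = S.b := by
    conv_rhs => rw [← k5]
    rw [sent, ← k7, mul_div_cancel_right₀ _ k3.ne', mul_comm]
  have hEend : Q.energyLeft (Q.τ S.m + T) = Q.energyLeft (Q.τ (Q.txHorizon S.m S.b)) := by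
    refine (Q.energyLeft_eq (by linarith) fun i hi => ?_).symm
    by_contra! hc
    have hmi : S.m < i := Q.τ_lt.1 (by linarith)
    have hiH := Q.τ_lt.1 hc
    have e1 := hguard i hmi hiH
    rw [chord_eq, lt_div_iff₀ (sub_pos.2 (Q.τ_lt.2 hmi))] at e1
    have e2 := mul_le_mul_of_nonneg_left (show T ≤ Q.τ i - Q.τ S.m by linarith) k6.le
    have e3 := between_mono (Q := Q) (m := S.m) hiH.le
    linarith
  have hσ := constStart_le hQ
  refine ⟨{ tl := Q.τ Q.q, tr := Q.τ S.m, tBegin := Q.constStart Q.q, tEnd := Q.τ S.m + T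
            pl := Q.pc, pr := P, p := S.p, s := S.s }, hpol,
    Valid.of_parts hs1 hs2 (hsup.nonneg hQ) ?_ hs3 ?_ hpc ?_ hI.epochs ?_ ?_, ?_⟩
  · refine ⟨hσ, eq_zero_or_lt_of_level hσ hEq, by rw [zero_add]; exact hEq, fun i _ hi2 => ?_⟩
    rw [zero_add]
    exact hlt i (Q.τ_lt.1 hi2)
  · refine ⟨by simp [k3.le], Or.inr (by simp [k3]), ?_, fun i hi1 hi2 => ?_⟩
    · simp only [add_sub_cancel_left]
      rw [hEend, k7]
      unfold between
      ring
    · have hi3 : Q.τ i < Q.τ (Q.txHorizon S.m S.b) :=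
        lt_of_lt_of_le hi2 (show Q.τ S.m + T ≤ _ by linarith)
      have e1 := hguard i (Q.τ_lt.1 hi1) (Q.τ_lt.1 hi3)
      rw [chord_eq, lt_div_iff₀ (sub_pos.2 hi1)] at e1
      unfold between at e1
      show Q.energyLeft (Q.τ S.m) + P * (Q.τ i - Q.τ S.m) < Q.energyLeft (Q.τ i)
      linarith
  · refine List.pairwise_cons.2 ⟨fun y hy => ?_, List.pairwise_append.2 ⟨hI.sorted, by simp, ?_⟩⟩
    · rcases List.mem_append.1 hy with hy | hy
      · exact hI.ge_pc y hy
      · rw [List.mem_singleton.1 hy]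
        exact l1.trans l3
    · intro y hy z hz
      rw [List.mem_singleton.1 hz]
      exact (l2 y hy).trans l3
  · show Q.τ Q.q ∈ S.s
    rw [hs1]
    simp
  · simp only [add_sub_cancel_left]
    rw [hPb, ← hTB, sent]
    change _ = Q.initTime * Q.g Q.pc
    have : Q.g Q.pc * (Q.τ Q.q - Q.constStart Q.q) + b₀ = Q.initTime * Q.g Q.pc := by
      rw [hb₀]; ring
    linarith
  · have hg := Q.rate.pos hpc
    have e1 : Q.g Q.pc ≤ Q.g P := Q.rate.mono.monotoneOn (Set.mem_Ici.2 hpc.le)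
      (Set.mem_Ici.2 k6.le) (l1.trans l3)
    have e2 := mul_le_mul_of_nonneg_right e1 k3.le
    have e3 : Q.g Q.pc * (Q.τ S.m + T - Q.τ Q.q)
        ≤ Q.g Q.pc * (Q.constStart Q.q + Q.initTime - Q.τ Q.q) := by
      rw [← hb₀]; linarith
    have e4 := le_of_mul_le_mul_left e3 hg
    show Q.τ S.m + T - Q.constStart Q.q ≤ Q.Γ₀
    linarith

theorem pullBackInit_spec (hQ : ∃ Y, Q.Feasible Y) :
    Q.Valid (· < ·) Q.pullBackInit ∧ Q.pullBackInit.tEnd - Q.pullBackInit.tBegin ≤ Q.Γ₀ ∧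
      Q.initPolicy.finish = Q.pullBackInit.tEnd := by
  obtain ⟨S, h1, h2, h3⟩ : ∃ S, Q.initPolicy = S.policy ∧ Q.Valid (· < ·) S ∧
      S.tEnd - S.tBegin ≤ Q.Γ₀ := by
    by_cases hcase : (Q.constPolicy Q.q).used (Q.constPolicy Q.q).finish
        < Q.energyLeft (Q.constPolicy Q.q).finish
    · exact exists_valid_init_of_tx hQ hcase
    · exact exists_valid_init_of_const hQ hcase
  rw [pullBackInit_eq h1 h2, h1, h2.finish_eq]
  exact ⟨h2, h3, rfl⟩

end Problem

end Harvest

theorem theorem2 (Q : Harvest.Problem) (hQ : ∃ Y, Q.Feasible Y) :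
    -- OFF returns an optimal policy, and this policy has no breaks
    (Q.IsOptimal Q.OFF ∧ ∀ x ∈ Q.OFF.p, 0 < x) ∧
    -- it meets every sufficient condition
    Q.SufficientConditions Q.OFF ∧
    -- PULL_BACK terminates, in a number of iterations that is linear in the number of arrivals
    -- before the finish time of the policy of INIT_POLICY
    (¬ Q.pullBackGuard (Q.pullBackState Q.pullBackCount) ∧
      Q.pullBackCount ≤ 2 * (Q.before Q.initPolicy.finish).card) ∧
    -- the transmission time increases in every iteration of PULL_BACK
    (∀ k < Q.pullBackCount,
      (Q.pullBackState k).tEnd - (Q.pullBackState k).tBegin <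
        (Q.pullBackState (k + 1)).tEnd - (Q.pullBackState (k + 1)).tBegin) := by
  obtain ⟨hinit, hdur, hfin⟩ := Harvest.Problem.pullBackInit_spec hQ
  have hq := (Harvest.Problem.q_spec hQ).1
  obtain ⟨S, hS, hv, hd, hpos⟩ := Harvest.Problem.exists_valid_OFF hinit hq hdur
  obtain ⟨hend, hcount, -⟩ := Harvest.Problem.pullBackCount_spec hinit hq
  refine ⟨⟨?_, ?_⟩, ?_, ⟨hend, ?_⟩, fun k hk => Harvest.Problem.duration_lt hinit hq hk⟩
  · rw [hS]
    exact hv.isOptimal hpos hd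
  · rw [hS]
    exact hv.powers_pos
  · rw [hS]
    exact hv.sufficientConditions hpos hd
  · rw [hfin]
    exact hcount
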